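/- Let $s\ge 1$ be an integer, and let $\{(\xi_l^{(1)},\dots,\xi_l^{(s)})\}_{l\in\mathbb Z}$ be i.i.d. zero-mean random vectors in $\mathbb R^s$ (the components of one vector may be dependent). Let $(c_l^{(r)})_{l\in\mathbb Z}$, $1\le r\le s$, be real sequences, let $\alpha_0>1$ and $\sigma_1,\dots,\sigma_s\in(\tfrac12,1]$, and put $\alpha_i=\frac{s}{s-i}\alpha_0$ for $0\le i\le\lfloor\frac{s-1}{2}\rfloor$. Assume: (Reg) $E\big[|\xi_1^{(r)}|^{s\vee 2}\big]<\infty$ for $1\le r\le s$; (Tail) for every permutation $\pi$ of $\{1,\dots,s\}$ and every $0\le i\le\lfloor\frac{s-1}{2}\rfloor$, $\ \sup_{t\ge 1}\,t^{\alpha_i}\,P\Big(\prod_{r\in\{\pi(1),\dots,\pi(s-i)\}}|\xi_1^{(r)}|>t\Big)<\infty$; (Decay) $\sup_{l\in\mathbb Z}|l|^{\sigma_r}|c_l^{(r)}|<\infty$ for $1\le r\le s$. Then for all $r$ and $k\in\mathbb Z$ the series $x_k^{(r)}=\sum_{l=-\infty}^{\infty}c_{k-l}^{(r)}\xi_l^{(r)}$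 converges almost surely (as the limit of $\sum_{l=a}^{b}$ when $a\to-\infty$, $b\to\infty$), and, with $d_k=\prod_{r=1}^{s}x_k^{(r)}$, the variable $d_1$ is integrable. Put $d=E[d_1]$. Then $$\lim_{n\to\infty}n^{-1/p}\sum_{k=1}^{n}(d_k-d)=0\quad\text{a.s.}$$ for every $p$ with $$0<p<\begin{cases}\dfrac{2}{3-2\sigma_1},& s=1,\\[2mm] 2\wedge\alpha_0\wedge\dfrac{1}{2-\sigma_1-\sigma_2},& s=2,\\[2mm] \alpha_0\wedge\dfrac{2}{3-2\min_{1\le i\le s}\sigma_i},& s>2.\end{cases}$$ If moreover $\xi_1^{(1)}=\xi_1^{(2)}=\dots=\xi_1^{(s)}$ almost surely, $\xi_1^{(1)}$ is symmetric (it has the same law as $-\xi_1^{(1)}$), and $s$ is even, then the same limit holds for every $p$ with $$0<p<2\wedge\alpha_0\wedge\frac{1}{2-\min_{1\le i<j\le s}(\sigma_i+\sigma_j)}.$$ Here $1/0=+\infty$. -/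

import Mathlib

open MeasureTheory ProbabilityTheory Filter Topology

namespace ProductMSLLN

noncomputable section

/-- The innovation vectors `ξ l = (ξ l 1, …, ξ l s)`, `l ∈ ℤ`, are i.i.d. random vectors with mean
zero.  The components of one vector may depend on each other in any way. -/
structure IsInnovation {Ω : Type*} [MeasurableSpace Ω] (μ : Measure Ω) {s : ℕ}
    (ξ : ℤ → Ω → (Fin s → ℝ)) : Prop where
  measurable : ∀ l, Measurable (ξ l)
  indep : iIndepFun ξ μ
  identDistrib : ∀ l, IdentDistrib (ξ l) (ξ 1) μ μ
  integrable : ∀ r, Integrable (fun ω => ξ 1 ω r) μ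
  mean_zero : ∀ r, ∫ ω, ξ 1 ω r ∂μ = 0

/-- (Reg): `E |ξ₁^(r)|^(s ∨ 2) < ∞` for every `r`. -/
def Reg {Ω : Type*} [MeasurableSpace Ω] (μ : Measure Ω) {s : ℕ}
    (ξ : ℤ → Ω → (Fin s → ℝ)) : Prop :=
  ∀ r, Integrable (fun ω => |ξ 1 ω r| ^ (max s 2)) μ

/-- The tail exponents `α_i = s α₀ / (s - i)`; in particular `α_0 = α₀`. -/
def tailExponent (s : ℕ) (α₀ : ℝ) (i : ℕ) : ℝ :=
  (s : ℝ) / ((s : ℝ) - (i : ℝ)) * α₀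

/-- (Tail): for every permutation `π` of the indices and every `0 ≤ i ≤ ⌊(s-1)/2⌋`,
`sup_{t ≥ 1} t^{α_i} P(∏_{r ∈ {π(1), …, π(s-i)}} |ξ₁^(r)| > t) < ∞`. -/
def Tail {Ω : Type*} [MeasurableSpace Ω] (μ : Measure Ω) {s : ℕ}
    (ξ : ℤ → Ω → (Fin s → ℝ)) (α₀ : ℝ) : Prop :=
  ∀ π : Equiv.Perm (Fin s), ∀ i : ℕ, i ≤ (s - 1) / 2 →
    BddAbove ((fun t : ℝ => t ^ tailExponent s α₀ i *
      μ.real {ω | t < ∏ j : Fin s with j.val < s - i, |ξ 1 ω (π j)|}) '' Set.Ici 1)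

/-- (Decay): `sup_{l ∈ ℤ} |l|^{σ_r} |c_l^(r)| < ∞` for every `r`. -/
def Decay {s : ℕ} (c : Fin s → ℤ → ℝ) (σ : Fin s → ℝ) : Prop :=
  ∀ r, BddAbove (Set.range fun l : ℤ => |(l : ℝ)| ^ σ r * |c r l|)

/-- The two-sided linear process `x_k^(r) = ∑_{l=-∞}^{∞} c_{k-l}^(r) ξ_l^(r)`.  The series need not
converge absolutely: its value is the limit of the sums over `a ≤ l ≤ b` as `a → -∞`, `b → ∞`. -/
def linearProcess {Ω : Type*} {s : ℕ} (c : Fin s → ℤ → ℝ) (ξ : ℤ → Ω → (Fin s → ℝ))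
    (r : Fin s) (k : ℤ) (ω : Ω) : ℝ :=
  ∑'[SummationFilter.conditional ℤ] l : ℤ, c r (k - l) * ξ l ω r

/-- `d_k = ∏_{r=1}^s x_k^(r)`. -/
def productProcess {Ω : Type*} {s : ℕ} (c : Fin s → ℤ → ℝ) (ξ : ℤ → Ω → (Fin s → ℝ))
    (k : ℤ) (ω : Ω) : ℝ :=
  ∏ r, linearProcess c ξ r k ω

/-- `lim_{n → ∞} n^{-1/p} ∑_{k=1}^n (d_k - E d_1) = 0` almost surely. -/
def StrongLaw {Ω : Type*} [MeasurableSpace Ω] (μ : Measure Ω) (d : ℤ → Ω → ℝ) (p : ℝ) : Prop :=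
  ∀ᵐ ω ∂μ, Tendsto
    (fun n : ℕ => (n : ℝ) ^ (-(1 / p)) * ∑ k ∈ Finset.Icc 1 n, (d (k : ℤ) ω - ∫ ω', d 1 ω' ∂μ))
    atTop (𝓝 0)

/-- The range of `p` for general innovations:
`0 < p < 2/(3-2σ₁)` if `s = 1`, `0 < p < 2 ∧ α₀ ∧ 1/(2-σ₁-σ₂)` if `s = 2`, and
`0 < p < α₀ ∧ 2/(3-2 min_i σ_i)` if `s > 2`.  The bound `p < 1/(2-σ₁-σ₂)` is written without a
division, so that it is no restriction when `σ₁ = σ₂ = 1`. -/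
def InRange {s : ℕ} (α₀ : ℝ) (σ : Fin s → ℝ) (p : ℝ) : Prop :=
  0 < p ∧
  (s = 1 → ∀ r, p < 2 / (3 - 2 * σ r)) ∧
  (s = 2 → p < 2 ∧ p < α₀ ∧ ∀ i j, i < j → p * (2 - (σ i + σ j)) < 1) ∧
  (2 < s → p < α₀ ∧ ∀ r, p < 2 / (3 - 2 * σ r))

/-- The relaxed range `0 < p < 2 ∧ α₀ ∧ 1/(2 - min_{i<j} (σ_i+σ_j))`, where again the last bound is
no restriction when its denominator is zero. -/
def InRelaxedRange {s : ℕ} (α₀ : ℝ) (σ : Fin s → ℝ) (p : ℝ) : Prop :=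
  0 < p ∧ p < 2 ∧ p < α₀ ∧ ∀ i j, i < j → p * (2 - (σ i + σ j)) < 1

end

end ProductMSLLN

/-! Restrict the innovations to a finite window and expand the product of the s linear forms. A
monomial is a map g from the indices 1, …, s to the window; its coefficient is ∏ c^(r)_{k-g(r)}, and
each l contributes the product of the ξ_l^(r) over the fibre of g over l. By (Reg) the product over
a fibre B is square integrable if 2|B| ≤ s ∨ 2. Larger fibres are heavy: a monomial has at most one,
and (Tail) gives its product moments of every order q < α₀.

Fix q with p ∨ 1 < q < 2 ∧ α₀ (for s = 1 there are no heavy fibres and α₀ plays no role). On a time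
block of length M, cut the heavy products at level u = M^(1/q). This splits d_k into three random
polynomials (`finiteProduct_eq`).

The first has every heavy product replaced by its mean. It is square integrable and carries the long
memory. A covariance expands over pairs of monomials, read as one map on two copies of the index
set. By independence and centring a pair contributes only if no point is hit exactly once and some
point is hit by both monomials. `sum_prod_le_marks` reduces the sum over such maps to sums ∑_l
|c^(r)_{k-l} c^(r')_{k'-l}|, of order |k-k'|^(-(σ_r+σ_r'-1-ε)). The double sum over k, k' has order
M^(3-2 min σ+2ε), and comparison with M^(2/p) gives p < 2/(3-2 min σ). If all odd blocks have mean
zero and s is even, parity forces two disjoint shared pairs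
(`exists_two_pairs_of_covWeight_ne_zero`), the decay rates add, and the relaxed range results. For s
= 2 this is automatic, since odd blocks are singletons.

The second has heavy products truncated and centred. Their variance is of order u^(2-q), but a
centred heavy fibre in each monomial makes the covariances summable in the lag
(`abs_chaos_cov_le_centred`, `SquareBounded.sum_centredKernel_le`), so sums have variance O(M
u^(2-q)) = O(M^(2/q)). The third has the remainders of the truncation. A heavy factor is independent
of the rest of its monomial, so the first moment is O(u^(1-q)) (`integral_abs_chaos_heavy_le`) and
sums are O(M u^(1-q)) = O(M^(1/q)). Both are negligible against M^(1/p).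

A Rademacher–Menshov inequality passes to maxima at the cost of log² M, and Borel–Cantelli along M =
2^N gives the law. All constants are uniform in the window, so the estimates survive the limit. The
series themselves converge by martingale convergence; a uniform first moment bound for finite
products makes the approximations Cauchy in mean, which gives integrability and, by translation, E
d_k = E d_1. -/

set_option linter.unusedSectionVars false

open MeasureTheory ProbabilityTheory Filter Topology

namespace ProductMSLLN

/-! ### Sums over maps with prescribed coincidences. -/

section Combinatorics

variable {R : Type*}

/-- The preimage of a point under a map from a finite type. -/
def fiber [Fintype R] {T : Type*} [DecidableEq T] (g : R → T) (l : T) : Finset R :=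
  Finset.univ.filter fun r => g r = l

@[simp] lemma mem_fiber [Fintype R] {T : Type*} [DecidableEq T] {g : R → T} {l : T} {r : R} :
    r ∈ fiber g l ↔ g r = l := by simp [fiber]

/-- The sum over `l ∈ Λ` of the product over a block `m` of the sequences `a r`. -/
def blockSum (Λ : Finset ℤ) (a : R → ℤ → ℝ) (m : Finset R) : ℝ :=
  ∑ l ∈ Λ, ∏ r ∈ m, a r l

lemma blockSum_nonneg (Λ : Finset ℤ) {a : R → ℤ → ℝ} (ha : ∀ r l, 0 ≤ a r l) (m : Finset R) :
    0 ≤ blockSum Λ a m :=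
  Finset.sum_nonneg fun _ _ => Finset.prod_nonneg fun _ _ => ha _ _

/-- Each factor in `m' \ m` costs at most `A`, and there are at most `Fintype.card R` of them. -/
lemma blockSum_mono [Fintype R] [DecidableEq R] {Λ : Finset ℤ} {a : R → ℤ → ℝ} {A : ℝ} (hA : 1 ≤ A)
    (ha : ∀ r l, 0 ≤ a r l) (haA : ∀ r, ∀ l ∈ Λ, a r l ≤ A) {m m' : Finset R} (h : m ⊆ m') :
    blockSum Λ a m' ≤ A ^ Fintype.card R * blockSum Λ a m := by
  rw [blockSum, blockSum, Finset.mul_sum]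
  refine Finset.sum_le_sum fun l hl => ?_
  rw [← Finset.prod_sdiff h]
  refine mul_le_mul_of_nonneg_right ?_ (Finset.prod_nonneg fun _ _ => ha _ _)
  calc ∏ r ∈ m' \ m, a r l ≤ ∏ _r ∈ m' \ m, A :=
        Finset.prod_le_prod (fun _ _ => ha _ _) fun r _ => haA r l hl
    _ = A ^ (m' \ m).card := by simp
    _ ≤ A ^ Fintype.card R := pow_le_pow_right₀ hA (Finset.card_le_univ _)

/-- The left side is the diagonal of the expanded product of sums, all of whose terms are
nonnegative. For empty `M` the left side would be the cardinality of `Λ`, hence the nonemptiness. -/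
lemma blockSum_biUnion_le [DecidableEq R] {Λ : Finset ℤ} {a : R → ℤ → ℝ}
    (ha : ∀ r l, 0 ≤ a r l) {M : Finset (Finset R)} (hM : M.Nonempty)
    (hd : (M : Set (Finset R)).PairwiseDisjoint id) :
    blockSum Λ a (M.biUnion id) ≤ ∏ m ∈ M, blockSum Λ a m := by
  induction hM using Finset.Nonempty.cons_induction with
  | singleton m => simp
  | cons m M hm hM ih =>
    rw [Finset.coe_cons] at hd
    have hd' : (M : Set (Finset R)).PairwiseDisjoint id := hd.subset (Set.subset_insert _ _)
    have hdis : Disjoint m (M.biUnion id) := by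
      rw [Finset.disjoint_biUnion_right]
      intro i hi
      exact hd (by simp) (by simp [hi]) (by rintro rfl; exact hm hi)
    rw [Finset.prod_cons, Finset.cons_eq_insert, Finset.biUnion_insert]
    refine le_trans ?_ (mul_le_mul_of_nonneg_left (ih hd') (blockSum_nonneg Λ ha m))
    rw [blockSum, blockSum, Finset.sum_mul]
    refine Finset.sum_le_sum fun l hl => ?_
    rw [id, Finset.prod_union hdis]
    refine mul_le_mul_of_nonneg_left ?_ (Finset.prod_nonneg fun _ _ => ha _ _)
    exact Finset.single_le_sum (f := fun l => ∏ r ∈ M.biUnion id, a r l)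
      (fun _ _ => Finset.prod_nonneg fun _ _ => ha _ _) hl

open Classical in
/-- The sum over functions which are constant on the fibres of an idempotent map. -/
lemma sum_constant_on_fibers_le [Fintype R] [DecidableEq R] (Λ : Finset ℤ) {a : R → ℤ → ℝ} (ha : ∀ r l, 0 ≤ a r l)
    (ρ : R → R) (hρ : ∀ x, ρ (ρ x) = ρ x) :
    ∑ g ∈ Fintype.piFinset (fun _ : R => Λ) with ∀ x y, ρ x = ρ y → g x = g y,
        ∏ r, a r (g r) ≤
      ∏ t ∈ Finset.univ.image ρ, blockSum Λ a (fiber ρ t) := by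
  simp only [blockSum]
  rw [Finset.prod_sum]
  -- A map constant on the classes of `ρ` is determined by its values on the representatives, so the
  -- sum embeds in an unrestricted product of sums over representatives.
  have hinj : Set.InjOn (fun (g : R → ℤ) (t : R) (_ : t ∈ Finset.univ.image ρ) => g t)
      ((Fintype.piFinset fun _ : R => Λ).filter fun g => ∀ x y, ρ x = ρ y → g x = g y) := by
    intro g hg g' hg' h
    simp only [Finset.coe_filter, Set.mem_ofPred_eq] at hg hg'
    ext x
    have h1 := congrFun (congrFun h (ρ x)) (by simp)
    rw [hg.2 x (ρ x) (hρ x).symm, hg'.2 x (ρ x) (hρ x).symm]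
    exact h1
  calc _ = ∑ g ∈ Fintype.piFinset (fun _ : R => Λ) with ∀ x y, ρ x = ρ y → g x = g y,
        ∏ t ∈ (Finset.univ.image ρ).attach, ∏ r ∈ fiber ρ t.1, a r (g t.1) := by
        refine Finset.sum_congr rfl fun g hg => ?_
        simp only [Finset.mem_filter] at hg
        rw [Finset.prod_attach (Finset.univ.image ρ) (fun t => ∏ r ∈ fiber ρ t, a r (g t)),
          ← Finset.prod_fiberwise_of_maps_to (t := Finset.univ.image ρ) (g := ρ) (by simp)]
        refine Finset.prod_congr rfl fun t ht => ?_
        refine Finset.prod_congr rfl fun r hr => ?_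
        obtain ⟨x, -, rfl⟩ := Finset.mem_image.1 ht
        have hr' : ρ r = ρ x := by simpa using hr
        rw [hg.2 r (ρ x) (by rw [hr', hρ])]
    _ = ∑ p ∈ ((Fintype.piFinset fun _ : R => Λ).filter
          fun g => ∀ x y, ρ x = ρ y → g x = g y).image
          (fun (g : R → ℤ) (t : R) (_ : t ∈ Finset.univ.image ρ) => g t),
        ∏ t ∈ (Finset.univ.image ρ).attach, ∏ r ∈ fiber ρ t.1, a r (p t.1 t.2) := by
        rw [Finset.sum_image hinj]
    _ ≤ _ := by
        refine Finset.sum_le_sum_of_subset_of_nonneg ?_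
          fun g _ _ => Finset.prod_nonneg fun _ _ => Finset.prod_nonneg fun _ _ => ha _ _
        intro p hp
        obtain ⟨g, hg, rfl⟩ := Finset.mem_image.1 hp
        simp only [Finset.mem_filter, Fintype.mem_piFinset] at hg
        rw [Finset.mem_pi]
        exact fun t _ => hg.1 t

-- Sending each point to a chosen representative of its fibre encodes the coincidence pattern of `g`
-- as a self-map of `R`. There are finitely many of these, with a number independent of the window.
open Classical in
lemma exists_idempotent_same_kernel (g : R → ℤ) :
    ∃ ρ : R → R, (∀ x, ρ (ρ x) = ρ x) ∧ ∀ x y, ρ x = ρ y ↔ g x = g y := by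
  have hg : ∀ x, g (Set.rangeSplitting g ⟨g x, x, rfl⟩) = g x := fun x =>
    Set.apply_rangeSplitting g ⟨g x, x, rfl⟩
  have key : ∀ x y, Set.rangeSplitting g ⟨g x, x, rfl⟩ = Set.rangeSplitting g ⟨g y, y, rfl⟩ ↔
      g x = g y := by
    intro x y
    constructor
    · intro h
      rw [← hg x, ← hg y, h]
    · intro h
      simp [h]
  exact ⟨fun x => Set.rangeSplitting g ⟨g x, x, rfl⟩, fun x => (key _ _).2 (hg x), key⟩

/-- Every marked block lies in one class of `ρ`. A class that contains marks is bounded by the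
product of their sums; a class without marks still has two elements and is bounded through `hpair`.
Either way the superfluous factors cost a power of `A`. -/
lemma prod_blockSum_fiber_le [Fintype R] [DecidableEq R] {Λ : Finset ℤ} {a : R → ℤ → ℝ} {A : ℝ} (hA : 1 ≤ A)
    (ha : ∀ r l, 0 ≤ a r l) (haA : ∀ r, ∀ l ∈ Λ, a r l ≤ A)
    (hpair : ∀ r r', r ≠ r' → blockSum Λ a {r, r'} ≤ A)
    {ρ : R → R} (hρ : ∀ x, ∃ y, y ≠ x ∧ ρ x = ρ y) {M : Finset (Finset R)}
    (hd : (M : Set (Finset R)).PairwiseDisjoint id) (hne : ∀ m ∈ M, m.Nonempty)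
    (hM : ∀ m ∈ M, ∀ x ∈ m, ∀ y ∈ m, ρ x = ρ y) :
    ∏ t ∈ Finset.univ.image ρ, blockSum Λ a (fiber ρ t) ≤
      (A ^ (Fintype.card R + 1)) ^ Fintype.card R * ∏ m ∈ M, blockSum Λ a m := by
  classical
  rcases isEmpty_or_nonempty R with hR | ⟨⟨r₀⟩⟩
  · have : M = ∅ := by
      refine Finset.eq_empty_of_forall_notMem fun m hm => ?_
      obtain ⟨x, -⟩ := hne m hm
      exact hR.elim x
    simp [this]
  have hA0 : 0 ≤ A := by linarith
  -- `κ m` represents the class that contains the mark `m`; the value `r₀` at the empty set is never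
  -- used.
  set κ : Finset R → R := fun m => if h : m.Nonempty then ρ h.choose else r₀ with hκ
  have hκm : ∀ m ∈ M, ∀ x ∈ m, ρ x = κ m := by
    intro m hm x hx
    have h : m.Nonempty := ⟨x, hx⟩
    simp only [hκ, h, dif_pos]
    exact hM m hm x hx _ h.choose_spec
  have hmaps : ∀ m ∈ M, κ m ∈ Finset.univ.image ρ := by
    intro m hm
    obtain ⟨x, hx⟩ := hne m hm
    rw [← hκm m hm x hx]
    simp
  rw [← Finset.prod_fiberwise_of_maps_to hmaps]
  have hblock : ∀ t ∈ Finset.univ.image ρ, blockSum Λ a (fiber ρ t) ≤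
      A ^ (Fintype.card R + 1) * ∏ m ∈ M with κ m = t, blockSum Λ a m := by
    intro t ht
    obtain ⟨x, -, rfl⟩ := Finset.mem_image.1 ht
    rcases (M.filter fun m => κ m = ρ x).eq_empty_or_nonempty with h0 | h0
    · rw [h0, Finset.prod_empty, mul_one, pow_succ]
      obtain ⟨y, hyx, hy⟩ := hρ x
      refine (blockSum_mono hA ha haA (m := {x, y}) ?_).trans ?_
      · intro z hz
        simp only [Finset.mem_insert, Finset.mem_singleton] at hz
        rcases hz with rfl | rfl <;> simp [hy]
      · exact mul_le_mul_of_nonneg_left (hpair _ _ hyx.symm) (by positivity)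
    · refine (blockSum_mono hA ha haA (m := (M.filter fun m => κ m = ρ x).biUnion id) ?_).trans ?_
      · intro z hz
        simp only [Finset.mem_biUnion, Finset.mem_filter, id] at hz
        obtain ⟨m, ⟨hm, hmx⟩, hzm⟩ := hz
        rw [mem_fiber, hκm m hm z hzm, hmx]
      · refine mul_le_mul (pow_le_pow_right₀ hA (Nat.le_succ _)) ?_ (blockSum_nonneg _ ha _)
          (by positivity)
        exact blockSum_biUnion_le ha h0 (hd.subset fun m hm => by simpa using (Finset.mem_filter.1 hm).1)
  calc ∏ t ∈ Finset.univ.image ρ, blockSum Λ a (fiber ρ t)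
      ≤ ∏ t ∈ Finset.univ.image ρ,
          (A ^ (Fintype.card R + 1) * ∏ m ∈ M with κ m = t, blockSum Λ a m) :=
        Finset.prod_le_prod (fun _ _ => blockSum_nonneg _ ha _) hblock
    _ = (A ^ (Fintype.card R + 1)) ^ (Finset.univ.image ρ).card *
          ∏ t ∈ Finset.univ.image ρ, ∏ m ∈ M with κ m = t, blockSum Λ a m := by
        rw [Finset.prod_mul_distrib, Finset.prod_const]
    _ ≤ _ := by
        refine mul_le_mul_of_nonneg_right ?_
          (Finset.prod_nonneg fun _ _ => Finset.prod_nonneg fun _ _ => blockSum_nonneg _ ha _)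
        exact pow_le_pow_right₀ (one_le_pow₀ hA) (Finset.card_le_univ _)

open Classical in
/-- A sum over functions without singleton fibres which are constant on the blocks of one of a
finite list of families of marked blocks is bounded by the products of the marked block sums. -/
theorem sum_prod_le_marks [Fintype R] [DecidableEq R] {Λ : Finset ℤ} {a : R → ℤ → ℝ} {A : ℝ} (hA : 1 ≤ A)
    (ha : ∀ r l, 0 ≤ a r l) (haA : ∀ r, ∀ l ∈ Λ, a r l ≤ A)
    (hpair : ∀ r r', r ≠ r' → blockSum Λ a {r, r'} ≤ A)
    (Q : (R → ℤ) → Prop) [DecidablePred Q] {ι : Type*} (I : Finset ι) (MM : ι → Finset (Finset R))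
    (hd : ∀ i ∈ I, (MM i : Set (Finset R)).PairwiseDisjoint id)
    (hne : ∀ i ∈ I, ∀ m ∈ MM i, m.Nonempty)
    (hQ : ∀ g ∈ Fintype.piFinset (fun _ : R => Λ), Q g → (∀ x, ∃ y, y ≠ x ∧ g x = g y) ∧
      ∃ i ∈ I, ∀ m ∈ MM i, ∀ x ∈ m, ∀ y ∈ m, g x = g y) :
    ∑ g ∈ Fintype.piFinset (fun _ : R => Λ) with Q g, ∏ r, a r (g r) ≤
      (Fintype.card R ^ Fintype.card R * (A ^ (Fintype.card R + 1)) ^ Fintype.card R : ℝ) *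
        ∑ i ∈ I, ∏ m ∈ MM i, blockSum Λ a m := by
  -- Only patterns realised by some admissible `g` are kept, so that `hQ` supplies marks and
  -- excludes singleton classes for each of them.
  set Φ : Finset (R → R) := Finset.univ.filter fun ρ => (∀ x, ρ (ρ x) = ρ x) ∧
    ∃ g ∈ Fintype.piFinset (fun _ : R => Λ), Q g ∧ ∀ x y, ρ x = ρ y ↔ g x = g y with hΦ
  have hS : 0 ≤ ∑ i ∈ I, ∏ m ∈ MM i, blockSum Λ a m :=
    Finset.sum_nonneg fun _ _ => Finset.prod_nonneg fun _ _ => blockSum_nonneg _ ha _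
  have hA0 : 0 ≤ A := by linarith
  calc ∑ g ∈ Fintype.piFinset (fun _ : R => Λ) with Q g, ∏ r, a r (g r)
      ≤ ∑ g ∈ Fintype.piFinset (fun _ : R => Λ), ∑ ρ ∈ Φ,
          if ∀ x y, ρ x = ρ y → g x = g y then ∏ r, a r (g r) else 0 := by
        rw [Finset.sum_filter]
        refine Finset.sum_le_sum fun g hg => ?_
        have h0 : ∀ ρ ∈ Φ, 0 ≤ if ∀ x y, ρ x = ρ y → g x = g y then ∏ r, a r (g r) else 0 := by
          intro ρ _
          split_ifs
          exacts [Finset.prod_nonneg fun _ _ => ha _ _, le_rfl]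
        split_ifs with hQg
        · obtain ⟨ρ, h1, h2⟩ := exists_idempotent_same_kernel g
          have hρ : ρ ∈ Φ := by
            simp only [hΦ, Finset.mem_filter, Finset.mem_univ, true_and]
            exact ⟨h1, g, hg, hQg, h2⟩
          refine le_trans ?_ (Finset.single_le_sum h0 hρ)
          rw [if_pos fun x y => (h2 x y).1]
        · exact Finset.sum_nonneg h0
    _ = ∑ ρ ∈ Φ, ∑ g ∈ Fintype.piFinset (fun _ : R => Λ) with ∀ x y, ρ x = ρ y → g x = g y,
          ∏ r, a r (g r) := by
        rw [Finset.sum_comm]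
        simp only [Finset.sum_filter]
    _ ≤ ∑ _ρ ∈ Φ, (A ^ (Fintype.card R + 1)) ^ Fintype.card R *
          ∑ i ∈ I, ∏ m ∈ MM i, blockSum Λ a m := by
        refine Finset.sum_le_sum fun ρ hρ => ?_
        simp only [hΦ, Finset.mem_filter, Finset.mem_univ, true_and] at hρ
        obtain ⟨h1, g, hg, hQg, h2⟩ := hρ
        obtain ⟨h3, i, hi, h4⟩ := hQ g hg hQg
        refine (sum_constant_on_fibers_le Λ ha ρ h1).trans ?_
        refine (prod_blockSum_fiber_le hA ha haA hpair (M := MM i) ?_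
          (hd i hi) (hne i hi) ?_).trans ?_
        · intro x
          obtain ⟨y, hy, hxy⟩ := h3 x
          exact ⟨y, hy, (h2 x y).2 hxy⟩
        · intro m hm x hx y hy
          exact (h2 x y).2 (h4 m hm x hx y hy)
        · refine mul_le_mul_of_nonneg_left ?_ (by positivity)
          exact Finset.single_le_sum (f := fun i => ∏ m ∈ MM i, blockSum Λ a m)
            (fun _ _ => Finset.prod_nonneg fun _ _ => blockSum_nonneg _ ha _) hi
    _ ≤ _ := by
        rw [Finset.sum_const, nsmul_eq_mul, mul_assoc]
        refine mul_le_mul_of_nonneg_right ?_ (by positivity)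
        have : Φ.card ≤ Fintype.card (R → R) := Finset.card_le_univ _
        rw [Fintype.card_fun] at this
        exact_mod_cast this

end Combinatorics

/-! ### Random polynomials in independent innovations and their covariances. -/

section Chaos

variable {Ω E R : Type*} [MeasurableSpace Ω] [MeasurableSpace E] {μ : Measure Ω}

/-- Independent and identically distributed random elements indexed by the integers. -/
structure IsIID (μ : Measure Ω) (ξ : ℤ → Ω → E) : Prop where
  measurable : ∀ l, Measurable (ξ l)
  indep : iIndepFun ξ μ
  identDistrib : ∀ l, IdentDistrib (ξ l) (ξ 1) μ μ

lemma IsIID.integrable_comp {ξ : ℤ → Ω → E} (hξ : IsIID μ ξ) {θ : E → ℝ} (hθ : Measurable θ)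
    (hi : Integrable (fun ω => θ (ξ 1 ω)) μ) (l : ℤ) : Integrable (fun ω => θ (ξ l ω)) μ :=
  ((hξ.identDistrib l).comp hθ).integrable_iff.2 hi

lemma IsIID.integral_comp {ξ : ℤ → Ω → E} (hξ : IsIID μ ξ) {θ : E → ℝ} (hθ : Measurable θ)
    (l : ℤ) : ∫ ω, θ (ξ l ω) ∂μ = ∫ ω, θ (ξ 1 ω) ∂μ :=
  ((hξ.identDistrib l).comp hθ).integral_eq

lemma IsIID.integral_prod [IsProbabilityMeasure μ] {ξ : ℤ → Ω → E} (hξ : IsIID μ ξ)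
    (Λ : Finset ℤ) {θ : ℤ → E → ℝ} (hθ : ∀ l, Measurable (θ l))
    (hi : ∀ l ∈ Λ, Integrable (fun ω => θ l (ξ 1 ω)) μ) :
    Integrable (fun ω => ∏ l ∈ Λ, θ l (ξ l ω)) μ ∧
      ∫ ω, ∏ l ∈ Λ, θ l (ξ l ω) ∂μ = ∏ l ∈ Λ, ∫ ω, θ l (ξ 1 ω) ∂μ := by
  classical
  induction Λ using Finset.induction_on with
  | empty => simp
  | insert l Λ hl ih =>
    obtain ⟨ih1, ih2⟩ := ih fun l' hl' => hi l' (Finset.mem_insert_of_mem hl')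
    have hind : iIndepFun (fun l ω => θ l (ξ l ω)) μ := hξ.indep.comp θ hθ
    have h1 := (hind.indepFun_finsetProd_of_notMem
      (fun l => (hθ l).comp (hξ.measurable l)) hl).symm
    have h2 : (∏ j ∈ Λ, fun ω => θ j (ξ j ω)) = fun ω => ∏ j ∈ Λ, θ j (ξ j ω) := by
      ext ω; simp
    rw [h2] at h1
    have h3 := hξ.integrable_comp (hθ l) (hi l (Finset.mem_insert_self _ _)) l
    simp only [Finset.prod_insert hl]
    refine ⟨h1.integrable_mul h3 ih1, ?_⟩
    have h4 := h1.integral_mul_eq_mul_integral h3.aestronglyMeasurable ih1.aestronglyMeasurable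
    rw [← ih2, ← hξ.integral_comp (hθ l) l]
    exact h4

variable [Fintype R] [DecidableEq R]

open Classical in
/-- The random polynomial whose monomials are indexed by the functions `g : R → Λ` with property
`Q`; the monomial of `g` has the coefficient `∏ r, a r (g r)` and the factor `η B (ξ l)` for the
fibre `B` of `g` over `l`. -/
noncomputable def chaos (ξ : ℤ → Ω → E) (Λ : Finset ℤ) (Q : (R → ℤ) → Prop) (η : Finset R → E → ℝ)
    (a : R → ℤ → ℝ) (ω : Ω) : ℝ :=
  ∑ g ∈ Fintype.piFinset (fun _ : R => Λ) with Q g,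
    (∏ r, a r (g r)) * ∏ l ∈ Λ, η (fiber g l) (ξ l ω)

/-- A family of square integrable functions of one innovation, indexed by blocks. -/
structure IsBlockFamily (μ : Measure Ω) (ξ : ℤ → Ω → E) (η : Finset R → E → ℝ) (V : ℝ) :
    Prop where
  measurable : ∀ B, Measurable (η B)
  empty : ∀ x, η ∅ x = 1
  memLp : ∀ B, MemLp (fun ω => η B (ξ 1 ω)) 2 μ
  integral_sq_le : ∀ B, ∫ ω, η B (ξ 1 ω) ^ 2 ∂μ ≤ V

/-- The mean of a block variable. -/
noncomputable def blockMean (μ : Measure Ω) (ξ : ℤ → Ω → E) (η : Finset R → E → ℝ)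
    (B : Finset R) : ℝ :=
  ∫ ω, η B (ξ 1 ω) ∂μ

/-- The mixed second moment of two block variables. -/
noncomputable def blockCorr (μ : Measure Ω) (ξ : ℤ → Ω → E) (η : Finset R → E → ℝ)
    (B B' : Finset R) : ℝ :=
  ∫ ω, η B (ξ 1 ω) * η B' (ξ 1 ω) ∂μ

/-- The joint cumulant-like weight of a pair of monomials, indexed by `R ⊕ R`. -/
noncomputable def covWeight (μ : Measure Ω) (ξ : ℤ → Ω → E) (Λ : Finset ℤ) (η : Finset R → E → ℝ)
    (G : R ⊕ R → ℤ) : ℝ :=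
  ∏ l ∈ Λ, blockCorr μ ξ η (fiber (G ∘ Sum.inl) l) (fiber (G ∘ Sum.inr) l) -
    ∏ l ∈ Λ, blockMean μ ξ η (fiber (G ∘ Sum.inl) l) * blockMean μ ξ η (fiber (G ∘ Sum.inr) l)

section

variable [IsProbabilityMeasure μ] {ξ : ℤ → Ω → E} {Λ : Finset ℤ} {Q : (R → ℤ) → Prop}
  {η : Finset R → E → ℝ} {V : ℝ} {a b : R → ℤ → ℝ}

lemma IsBlockFamily.integrable (hη : IsBlockFamily μ ξ η V) (B : Finset R) :
    Integrable (fun ω => η B (ξ 1 ω)) μ := (hη.memLp B).integrable (by norm_num)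

lemma IsBlockFamily.integrable_mul (hη : IsBlockFamily μ ξ η V) (B B' : Finset R) :
    Integrable (fun ω => η B (ξ 1 ω) * η B' (ξ 1 ω)) μ := (hη.memLp B).integrable_mul (hη.memLp B')

lemma integral_chaos (hξ : IsIID μ ξ) (hm : ∀ B, Measurable (η B))
    (hi : ∀ B, Integrable (fun ω => η B (ξ 1 ω)) μ) :
    Integrable (chaos ξ Λ Q η a) μ ∧ ∫ ω, chaos ξ Λ Q η a ω ∂μ = by
      classical exact ∑ g ∈ Fintype.piFinset (fun _ : R => Λ) with Q g,
        (∏ r, a r (g r)) * ∏ l ∈ Λ, blockMean μ ξ η (fiber g l) := by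
  have h := fun g : R → ℤ => hξ.integral_prod Λ (θ := fun l => η (fiber g l)) (fun l => hm _)
    fun l _ => hi _
  constructor
  · exact integrable_finsetSum _ fun g _ => (h g).1.const_mul _
  · unfold chaos
    rw [integral_finsetSum _ fun g _ => (h g).1.const_mul _]
    refine Finset.sum_congr (by congr) fun g _ => ?_
    rw [integral_const_mul, (h g).2]
    rfl

-- A pair of monomials becomes one map on `R ⊕ R`, so the coincidence patterns of both are treated
-- at once.
open Classical in
lemma sum_pair_eq (F : (R → ℤ) → (R → ℤ) → ℝ) :
    ∑ g ∈ Fintype.piFinset (fun _ : R => Λ) with Q g,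
        ∑ g' ∈ Fintype.piFinset (fun _ : R => Λ) with Q g', F g g' =
      ∑ G ∈ Fintype.piFinset (fun _ : R ⊕ R => Λ) with
        Q (G ∘ Sum.inl) ∧ Q (G ∘ Sum.inr), F (G ∘ Sum.inl) (G ∘ Sum.inr) := by
  rw [← Finset.sum_product']
  refine Finset.sum_nbij' (fun p => Sum.elim p.1 p.2)
    (fun G => (G ∘ Sum.inl, G ∘ Sum.inr)) ?_ ?_ ?_ ?_ ?_
  · rintro ⟨g, g'⟩ h
    simp only [Finset.mem_product, Finset.mem_filter, Fintype.mem_piFinset] at h ⊢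
    exact ⟨by rintro (r | r); exacts [h.1.1 r, h.2.1 r], by simpa using ⟨h.1.2, h.2.2⟩⟩
  · intro G h
    simp only [Finset.mem_product, Finset.mem_filter, Fintype.mem_piFinset] at h ⊢
    exact ⟨⟨fun r => h.1 _, h.2.1⟩, ⟨fun r => h.1 _, h.2.2⟩⟩
  · rintro ⟨g, g'⟩ _
    simp
  · intro G _
    simp
  · rintro ⟨g, g'⟩ _
    simp

open Classical in
lemma integral_chaos_mul (hξ : IsIID μ ξ) (hη : IsBlockFamily μ ξ η V) :
    Integrable (fun ω => chaos ξ Λ Q η a ω * chaos ξ Λ Q η b ω) μ ∧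
    ∫ ω, chaos ξ Λ Q η a ω * chaos ξ Λ Q η b ω ∂μ =
      ∑ G ∈ Fintype.piFinset (fun _ : R ⊕ R => Λ) with Q (G ∘ Sum.inl) ∧ Q (G ∘ Sum.inr),
        (∏ x, Sum.elim a b x (G x)) *
          ∏ l ∈ Λ, blockCorr μ ξ η (fiber (G ∘ Sum.inl) l) (fiber (G ∘ Sum.inr) l) := by
  have h := fun g g' : R → ℤ => hξ.integral_prod Λ
    (θ := fun l x => η (fiber g l) x * η (fiber g' l) x)
    (fun l => (hη.measurable _).mul (hη.measurable _)) fun l _ => hη.integrable_mul _ _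
  have h1 : ∀ ω, chaos ξ Λ Q η a ω * chaos ξ Λ Q η b ω =
      ∑ g ∈ Fintype.piFinset (fun _ : R => Λ) with Q g,
        ∑ g' ∈ Fintype.piFinset (fun _ : R => Λ) with Q g',
          ((∏ r, a r (g r)) * ∏ r, b r (g' r)) *
            ∏ l ∈ Λ, η (fiber g l) (ξ l ω) * η (fiber g' l) (ξ l ω) := by
    intro ω
    rw [chaos, chaos, Finset.sum_mul_sum]
    refine Finset.sum_congr rfl fun g _ => Finset.sum_congr rfl fun g' _ => ?_
    rw [Finset.prod_mul_distrib]
    ring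
  simp only [h1]
  have hint : ∀ g g' : R → ℤ, Integrable (fun ω => ((∏ r, a r (g r)) * ∏ r, b r (g' r)) *
            ∏ l ∈ Λ, η (fiber g l) (ξ l ω) * η (fiber g' l) (ξ l ω)) μ :=
    fun g g' => (h g g').1.const_mul _
  refine ⟨integrable_finsetSum _ fun g _ => integrable_finsetSum _ fun g' _ => hint g g', ?_⟩
  have h2 := sum_pair_eq (Λ := Λ) (Q := Q) (fun g g' => ((∏ r, a r (g r)) * ∏ r, b r (g' r)) *
    ∏ l ∈ Λ, blockCorr μ ξ η (fiber g l) (fiber g' l))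
  simp only [Fintype.prod_sum_type, Sum.elim_inl, Sum.elim_inr]
  refine Eq.trans ?_ h2
  rw [integral_finsetSum _ fun g _ => integrable_finsetSum _ fun g' _ => hint g g']
  refine Finset.sum_congr rfl fun g _ => ?_
  rw [integral_finsetSum _ fun g' _ => hint g g']
  refine Finset.sum_congr rfl fun g' _ => ?_
  rw [integral_const_mul, (h g g').2]
  rfl

lemma IsBlockFamily.abs_blockCorr_le (hη : IsBlockFamily μ ξ η V) (B B' : Finset R) :
    |blockCorr μ ξ η B B'| ≤ V := by
  have h1 := (hη.memLp B).integrable_sq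
  have h2 := (hη.memLp B').integrable_sq
  calc |blockCorr μ ξ η B B'| ≤ ∫ ω, |η B (ξ 1 ω) * η B' (ξ 1 ω)| ∂μ := abs_integral_le_integral_abs
    _ ≤ ∫ ω, (η B (ξ 1 ω) ^ 2 + η B' (ξ 1 ω) ^ 2) / 2 ∂μ := by
        refine integral_mono (hη.integrable_mul B B').abs ((h1.add h2).div_const 2) fun ω => ?_
        simp only
        rw [abs_mul]
        nlinarith [sq_nonneg (|η B (ξ 1 ω)| - |η B' (ξ 1 ω)|), sq_abs (η B (ξ 1 ω)),
          sq_abs (η B' (ξ 1 ω))]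
    _ = (∫ ω, η B (ξ 1 ω) ^ 2 ∂μ + ∫ ω, η B' (ξ 1 ω) ^ 2 ∂μ) / 2 := by
        rw [integral_div, integral_add h1 h2]
    _ ≤ V := by linarith [hη.integral_sq_le B, hη.integral_sq_le B']

lemma IsBlockFamily.blockCorr_empty_right (hη : IsBlockFamily μ ξ η V) (B : Finset R) :
    blockCorr μ ξ η B ∅ = blockMean μ ξ η B := by
  simp [blockCorr, blockMean, hη.empty]

lemma IsBlockFamily.blockCorr_empty_left (hη : IsBlockFamily μ ξ η V) (B : Finset R) :
    blockCorr μ ξ η ∅ B = blockMean μ ξ η B := by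
  simp [blockCorr, blockMean, hη.empty]

lemma IsBlockFamily.blockMean_empty (hη : IsBlockFamily μ ξ η V) :
    blockMean μ ξ η ∅ = 1 := by
  simp [blockMean, hη.empty]

lemma IsBlockFamily.one_le (hη : IsBlockFamily μ ξ η V) : 1 ≤ V := by
  have := hη.integral_sq_le ∅
  simpa [hη.empty] using this

lemma IsBlockFamily.abs_blockMean_le (hη : IsBlockFamily μ ξ η V) (B : Finset R) :
    |blockMean μ ξ η B| ≤ V := by
  rw [← hη.blockCorr_empty_right]
  exact hη.abs_blockCorr_le B ∅

lemma sum_card_fiber {g : R → ℤ} (hg : ∀ r, g r ∈ Λ) :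
    ∑ l ∈ Λ, (fiber g l).card = Fintype.card R :=
  (Finset.card_eq_sum_card_fiberwise (s := Finset.univ) (f := g) (t := Λ)
    (fun r _ => hg r)).symm

/-- The cardinalities of the fibres add up to that of `R`, so the bound does not depend on the size
of `Λ`. -/
lemma prod_pow_card_fiber_le {g : R → ℤ} (hg : ∀ r, g r ∈ Λ) {f : ℤ → ℝ}
    (hf : ∀ l, |f l| ≤ V ^ (fiber g l).card) :
    |∏ l ∈ Λ, f l| ≤ V ^ Fintype.card R := by
  rw [Finset.abs_prod, ← sum_card_fiber hg, ← Finset.prod_pow_eq_pow_sum]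
  exact Finset.prod_le_prod (fun _ _ => abs_nonneg _) fun l _ => hf l

lemma IsBlockFamily.abs_prod_blockCorr_le (hη : IsBlockFamily μ ξ η V) {G : R ⊕ R → ℤ}
    (hG : ∀ x, G x ∈ Λ) :
    |∏ l ∈ Λ, blockCorr μ ξ η (fiber (G ∘ Sum.inl) l) (fiber (G ∘ Sum.inr) l)| ≤
      V ^ (2 * Fintype.card R) := by
  have h0 : 2 * Fintype.card R = Fintype.card (R ⊕ R) := by rw [Fintype.card_sum]; ring
  rw [h0]
  refine prod_pow_card_fiber_le hG fun l => ?_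
  rcases (fiber G l).eq_empty_or_nonempty with h | h
  · have h1 : fiber (G ∘ Sum.inl) l = ∅ := by
      ext r; simpa using (Finset.ext_iff.1 h (Sum.inl r))
    have h2 : fiber (G ∘ Sum.inr) l = ∅ := by
      ext r; simpa using (Finset.ext_iff.1 h (Sum.inr r))
    simp [h, h1, h2, hη.blockCorr_empty_right, hη.blockMean_empty]
  · exact (hη.abs_blockCorr_le _ _).trans (le_self_pow₀ hη.one_le (Finset.card_pos.2 h).ne')

lemma IsBlockFamily.abs_prod_blockMean_le (hη : IsBlockFamily μ ξ η V) {g : R → ℤ}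
    (hg : ∀ x, g x ∈ Λ) :
    |∏ l ∈ Λ, blockMean μ ξ η (fiber g l)| ≤ V ^ Fintype.card R := by
  refine prod_pow_card_fiber_le hg fun l => ?_
  rcases (fiber g l).eq_empty_or_nonempty with h | h
  · simp [h, hη.blockMean_empty]
  · exact (hη.abs_blockMean_le _).trans (le_self_pow₀ hη.one_le (Finset.card_pos.2 h).ne')

lemma IsBlockFamily.abs_covWeight_le (hη : IsBlockFamily μ ξ η V) {G : R ⊕ R → ℤ}
    (hG : ∀ x, G x ∈ Λ) :
    |covWeight μ ξ Λ η G| ≤ 2 * V ^ (2 * Fintype.card R) := by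
  refine (abs_sub _ _).trans ?_
  rw [two_mul (V ^ _)]
  refine add_le_add (hη.abs_prod_blockCorr_le hG) ?_
  rw [Finset.prod_mul_distrib, abs_mul, two_mul, pow_add]
  exact mul_le_mul (hη.abs_prod_blockMean_le fun x => hG _)
    (hη.abs_prod_blockMean_le fun x => hG _) (abs_nonneg _)
    (pow_nonneg (zero_le_one.trans hη.one_le) _)

open Classical in
lemma chaos_cov_eq (hξ : IsIID μ ξ) (hη : IsBlockFamily μ ξ η V) :
    ∫ ω, chaos ξ Λ Q η a ω * chaos ξ Λ Q η b ω ∂μ -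
        (∫ ω, chaos ξ Λ Q η a ω ∂μ) * ∫ ω, chaos ξ Λ Q η b ω ∂μ =
      ∑ G ∈ Fintype.piFinset (fun _ : R ⊕ R => Λ) with Q (G ∘ Sum.inl) ∧ Q (G ∘ Sum.inr),
        (∏ x, Sum.elim a b x (G x)) * covWeight μ ξ Λ η G := by
  rw [(integral_chaos_mul hξ hη).2, (integral_chaos hξ hη.measurable hη.integrable).2,
    (integral_chaos hξ hη.measurable hη.integrable).2, Finset.sum_mul_sum,
    sum_pair_eq, ← Finset.sum_sub_distrib]
  refine Finset.sum_congr rfl fun G _ => ?_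
  rw [covWeight, Fintype.prod_sum_type, Finset.prod_mul_distrib]
  simp only [Function.comp_apply, Sum.elim_inl, Sum.elim_inr]
  ring

open Classical in
lemma abs_chaos_cov_le (hξ : IsIID μ ξ) (hη : IsBlockFamily μ ξ η V) :
    |∫ ω, chaos ξ Λ Q η a ω * chaos ξ Λ Q η b ω ∂μ -
        (∫ ω, chaos ξ Λ Q η a ω ∂μ) * ∫ ω, chaos ξ Λ Q η b ω ∂μ| ≤
      2 * V ^ (2 * Fintype.card R) * ∑ G ∈ Fintype.piFinset (fun _ : R ⊕ R => Λ) with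
        (Q (G ∘ Sum.inl) ∧ Q (G ∘ Sum.inr)) ∧ covWeight μ ξ Λ η G ≠ 0,
        ∏ x, |Sum.elim a b x (G x)| := by
  have h0 : ((Fintype.piFinset fun _ : R ⊕ R => Λ).filter fun G =>
      (Q (G ∘ Sum.inl) ∧ Q (G ∘ Sum.inr)) ∧ covWeight μ ξ Λ η G ≠ 0) =
      ((Fintype.piFinset fun _ : R ⊕ R => Λ).filter fun G =>
        Q (G ∘ Sum.inl) ∧ Q (G ∘ Sum.inr)).filter fun G => covWeight μ ξ Λ η G ≠ 0 :=
    (Finset.filter_filter _ _ _).symm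
  rw [chaos_cov_eq hξ hη, h0, Finset.sum_filter (p := fun G => covWeight μ ξ Λ η G ≠ 0),
    Finset.mul_sum]
  refine (Finset.abs_sum_le_sum_abs _ _).trans (Finset.sum_le_sum fun G hG => ?_)
  simp only [Finset.mem_filter, Fintype.mem_piFinset] at hG
  split_ifs with h
  · rw [abs_mul, mul_comm, Finset.abs_prod]
    exact mul_le_mul_of_nonneg_right (hη.abs_covWeight_le hG.1)
      (Finset.prod_nonneg fun _ _ => abs_nonneg _)
  · rw [not_not] at h
    simp [h]

end

end Chaos

/-! ### Which pairs of monomials are correlated, and the resulting covariance bounds. -/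

section ChaosBounds

variable {Ω E R : Type*} [MeasurableSpace Ω] [MeasurableSpace E] {μ : Measure Ω} [Fintype R]
  [DecidableEq R] [IsProbabilityMeasure μ] {ξ : ℤ → Ω → E} {Λ : Finset ℤ} {Q : (R → ℤ) → Prop}
  {η : Finset R → E → ℝ} {V : ℝ} {a b : R → ℤ → ℝ}

/-- Weights of monomials with a singleton fibre vanish. -/
lemma singleton_fiber_cases (hη : IsBlockFamily μ ξ η V) (h1 : ∀ r, blockMean μ ξ η {r} = 0)
    {G : R ⊕ R → ℤ} {x : R ⊕ R} (hx : ∀ y, y ≠ x → G x ≠ G y) :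
    blockCorr μ ξ η (fiber (G ∘ Sum.inl) (G x)) (fiber (G ∘ Sum.inr) (G x)) = 0 ∧
    blockMean μ ξ η (fiber (G ∘ Sum.inl) (G x)) * blockMean μ ξ η (fiber (G ∘ Sum.inr) (G x)) =
      0 := by
  rcases x with r | r
  · have e1 : fiber (G ∘ Sum.inl) (G (Sum.inl r)) = {r} := by
      ext r'
      simp only [mem_fiber, Function.comp_apply, Finset.mem_singleton]
      refine ⟨fun h => ?_, fun h => by rw [h]⟩
      by_contra hne
      exact hx (Sum.inl r') (by simpa using hne) h.symm
    have e2 : fiber (G ∘ Sum.inr) (G (Sum.inl r)) = ∅ := by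
      ext r'
      simp only [mem_fiber, Function.comp_apply, Finset.notMem_empty, iff_false]
      exact fun h => hx (Sum.inr r') (by simp) h.symm
    rw [e1, e2, hη.blockCorr_empty_right, h1]
    simp
  · have e1 : fiber (G ∘ Sum.inr) (G (Sum.inr r)) = {r} := by
      ext r'
      simp only [mem_fiber, Function.comp_apply, Finset.mem_singleton]
      refine ⟨fun h => ?_, fun h => by rw [h]⟩
      by_contra hne
      exact hx (Sum.inr r') (by simpa using hne) h.symm
    have e2 : fiber (G ∘ Sum.inl) (G (Sum.inr r)) = ∅ := by
      ext r'
      simp only [mem_fiber, Function.comp_apply, Finset.notMem_empty, iff_false]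
      exact fun h => hx (Sum.inl r') (by simp) h.symm
    rw [e1, e2, hη.blockCorr_empty_left, h1]
    simp

lemma covWeight_eq_zero_of_factor {G : R ⊕ R → ℤ} {l : ℤ} (hl : l ∈ Λ)
    (h1 : blockCorr μ ξ η (fiber (G ∘ Sum.inl) l) (fiber (G ∘ Sum.inr) l) = 0)
    (h2 : blockMean μ ξ η (fiber (G ∘ Sum.inl) l) * blockMean μ ξ η (fiber (G ∘ Sum.inr) l) = 0) :
    covWeight μ ξ Λ η G = 0 := by
  rw [covWeight, Finset.prod_eq_zero hl h1, Finset.prod_eq_zero hl h2, sub_zero]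

lemma exists_ne_of_covWeight_ne_zero (hη : IsBlockFamily μ ξ η V)
    (h1 : ∀ r, blockMean μ ξ η {r} = 0) {G : R ⊕ R → ℤ} (hG : ∀ x, G x ∈ Λ)
    (hw : covWeight μ ξ Λ η G ≠ 0) (x : R ⊕ R) : ∃ y, y ≠ x ∧ G x = G y := by
  by_contra! h
  have := singleton_fiber_cases hη h1 h
  exact hw (covWeight_eq_zero_of_factor (hG x) this.1 this.2)

lemma blockCorr_eq_of_not_mixed (hη : IsBlockFamily μ ξ η V) {G : R ⊕ R → ℤ} {l : ℤ}
    (h : ∀ i i', G (Sum.inl i) = l → G (Sum.inr i') ≠ l) :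
    blockCorr μ ξ η (fiber (G ∘ Sum.inl) l) (fiber (G ∘ Sum.inr) l) =
      blockMean μ ξ η (fiber (G ∘ Sum.inl) l) * blockMean μ ξ η (fiber (G ∘ Sum.inr) l) := by
  rcases (fiber (G ∘ Sum.inl) l).eq_empty_or_nonempty with h0 | ⟨i, hi⟩
  · rw [h0, hη.blockCorr_empty_left, hη.blockMean_empty, one_mul]
  · have h1 : fiber (G ∘ Sum.inr) l = ∅ := by
      ext i'
      simp only [mem_fiber, Function.comp_apply, Finset.notMem_empty, iff_false]
      exact h i i' (by simpa using hi)
    rw [h1, hη.blockCorr_empty_right, hη.blockMean_empty, mul_one]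

/-- Two monomials without a common innovation are independent: at each point one of the two blocks
is empty, and the two products that define the weight agree factor by factor. -/
lemma exists_mixed_of_covWeight_ne_zero (hη : IsBlockFamily μ ξ η V) {G : R ⊕ R → ℤ}
    (hw : covWeight μ ξ Λ η G ≠ 0) : ∃ i i', G (Sum.inl i) = G (Sum.inr i') := by
  by_contra! h
  refine hw ?_
  rw [covWeight, sub_eq_zero]
  refine Finset.prod_congr rfl fun l _ => blockCorr_eq_of_not_mixed hη ?_
  rintro i i' rfl
  exact (h i i').symm

lemma even_card_fiber_of_others {g : R → ℤ} (hg : ∀ r, g r ∈ Λ) (hR : Even (Fintype.card R))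
    {l : ℤ} (hl : l ∈ Λ) (h : ∀ l' ∈ Λ.erase l, Even (fiber g l').card) :
    Even (fiber g l).card := by
  rw [← sum_card_fiber hg, ← Finset.add_sum_erase _ _ hl] at hR
  exact (Nat.even_add.1 hR).2 (Finset.even_sum _ h)

/-- Two different common points give two pairs at once. With a single common point, the weight
factors through the means at all other points, so the blocks there are even; since `R` has even
size, the blocks at the common point are even too. They are nonempty, hence each has a second
element. -/
lemma exists_two_pairs_of_covWeight_ne_zero (hη : IsBlockFamily μ ξ η V)
    (hodd : ∀ B : Finset R, Odd B.card → blockMean μ ξ η B = 0) (hR : Even (Fintype.card R))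
    {G : R ⊕ R → ℤ} (hG : ∀ x, G x ∈ Λ) (hw : covWeight μ ξ Λ η G ≠ 0) :
    ∃ i j i' j', i ≠ j ∧ i' ≠ j' ∧ G (Sum.inl i) = G (Sum.inr i') ∧
      G (Sum.inl j) = G (Sum.inr j') := by
  obtain ⟨i, i', hi⟩ := exists_mixed_of_covWeight_ne_zero hη hw
  by_cases h : ∃ j j', G (Sum.inl j) = G (Sum.inr j') ∧ G (Sum.inl j) ≠ G (Sum.inl i)
  · obtain ⟨j, j', hj, hne⟩ := h
    refine ⟨i, j, i', j', ?_, ?_, hi, hj⟩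
    · rintro rfl; exact hne rfl
    · rintro rfl; exact hne (hj.trans hi.symm)
  · push Not at h
    have hl : G (Sum.inl i) ∈ Λ := hG _
    have hmix : ∀ l' ∈ Λ.erase (G (Sum.inl i)),
        blockCorr μ ξ η (fiber (G ∘ Sum.inl) l') (fiber (G ∘ Sum.inr) l') =
        blockMean μ ξ η (fiber (G ∘ Sum.inl) l') * blockMean μ ξ η (fiber (G ∘ Sum.inr) l') := by
      intro l' hl'
      refine blockCorr_eq_of_not_mixed hη ?_
      rintro j j' rfl hj'
      exact (Finset.mem_erase.1 hl').1 (h j j' hj'.symm)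
    rw [covWeight, ← Finset.mul_prod_erase _ _ hl, ← Finset.mul_prod_erase _ _ hl,
      Finset.prod_congr rfl hmix, ← sub_mul] at hw
    have hprod := (mul_ne_zero_iff.1 hw).2
    rw [Finset.prod_ne_zero_iff] at hprod
    have hev : ∀ l' ∈ Λ.erase (G (Sum.inl i)), Even (fiber (G ∘ Sum.inl) l').card ∧
        Even (fiber (G ∘ Sum.inr) l').card := by
      intro l' hl'
      have := mul_ne_zero_iff.1 (hprod l' hl')
      constructor
      · by_contra hc
        exact this.1 (hodd _ (Nat.not_even_iff_odd.1 hc))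
      · by_contra hc
        exact this.2 (hodd _ (Nat.not_even_iff_odd.1 hc))
    have e1 := even_card_fiber_of_others (g := G ∘ Sum.inl) (fun r => hG _) hR hl
      fun l' hl' => (hev l' hl').1
    have e2 := even_card_fiber_of_others (g := G ∘ Sum.inr) (fun r => hG _) hR hl
      fun l' hl' => (hev l' hl').2
    have m1 : i ∈ fiber (G ∘ Sum.inl) (G (Sum.inl i)) := by simp
    have m2 : i' ∈ fiber (G ∘ Sum.inr) (G (Sum.inl i)) := by simp [hi]
    have two : ∀ {B : Finset R} {x : R}, x ∈ B → Even B.card → 1 < B.card := by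
      intro B x hx hB
      have := Finset.card_pos.2 ⟨x, hx⟩
      obtain ⟨k, hk⟩ := hB
      omega
    obtain ⟨j, hj, hji⟩ := Finset.exists_mem_ne (two m1 e1) i
    obtain ⟨j', hj', hji'⟩ := Finset.exists_mem_ne (two m2 e2) i'
    refine ⟨i, j, i', j', hji.symm, hji'.symm, hi, ?_⟩
    simp only [mem_fiber, Function.comp_apply] at hj hj'
    rw [hj, hj']

/-- If both monomials have a centred block with at least two elements, then these two blocks lie
over a common point, or each of them meets a variable of the other monomial. -/
lemma exists_centred_of_covWeight_ne_zero (hη : IsBlockFamily μ ξ η V) {H : Finset R → Prop}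
    (hH : ∀ B, H B → blockMean μ ξ η B = 0 ∧ 2 ≤ B.card) {G : R ⊕ R → ℤ}
    (hw : covWeight μ ξ Λ η G ≠ 0) (h1 : ∃ l ∈ Λ, H (fiber (G ∘ Sum.inl) l))
    (h2 : ∃ l ∈ Λ, H (fiber (G ∘ Sum.inr) l)) :
    (∃ i j i' j', i ≠ j ∧ i' ≠ j' ∧ G (Sum.inl i) = G (Sum.inl j) ∧
      G (Sum.inl i) = G (Sum.inr i') ∧ G (Sum.inl i) = G (Sum.inr j')) ∨
    ∃ i j i' j' r r', i ≠ j ∧ i' ≠ j' ∧ r ≠ i ∧ r ≠ j ∧ r' ≠ i' ∧ r' ≠ j' ∧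
      G (Sum.inl i) = G (Sum.inl j) ∧ G (Sum.inl i) = G (Sum.inr r') ∧
      G (Sum.inr i') = G (Sum.inr j') ∧ G (Sum.inr i') = G (Sum.inl r) := by
  obtain ⟨l, hl, hHl⟩ := h1
  obtain ⟨l', hl', hHl'⟩ := h2
  have hmixl : ∃ r', G (Sum.inr r') = l := by
    by_contra! h
    have e : fiber (G ∘ Sum.inr) l = ∅ := by
      ext i'
      simpa using h i'
    refine hw (covWeight_eq_zero_of_factor hl ?_ ?_)
    · rw [e, hη.blockCorr_empty_right, (hH _ hHl).1]
    · rw [(hH _ hHl).1, zero_mul]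
  have hmixl' : ∃ r, G (Sum.inl r) = l' := by
    by_contra! h
    have e : fiber (G ∘ Sum.inl) l' = ∅ := by
      ext i'
      simpa using h i'
    refine hw (covWeight_eq_zero_of_factor hl' ?_ ?_)
    · rw [e, hη.blockCorr_empty_left, (hH _ hHl').1]
    · rw [(hH _ hHl').1, mul_zero]
  obtain ⟨i, hi, j, hj, hij⟩ := Finset.one_lt_card.1 (hH _ hHl).2
  obtain ⟨i', hi', j', hj', hij'⟩ := Finset.one_lt_card.1 (hH _ hHl').2
  simp only [mem_fiber, Function.comp_apply] at hi hj hi' hj'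
  by_cases hll : l = l'
  · left
    subst hll
    exact ⟨i, j, i', j', hij, hij', by rw [hi, hj], by rw [hi, hi'], by rw [hi, hj']⟩
  · right
    obtain ⟨r', hr'⟩ := hmixl
    obtain ⟨r, hr⟩ := hmixl'
    refine ⟨i, j, i', j', r, r', hij, hij', ?_, ?_, ?_, ?_, by rw [hi, hj], by rw [hi, hr'],
      by rw [hi', hj'], by rw [hi', hr]⟩
    · rintro rfl; exact hll (hi.symm.trans hr)
    · rintro rfl; exact hll (hj.symm.trans hr)
    · rintro rfl; exact hll (hr'.symm.trans hi')
    · rintro rfl; exact hll (hr'.symm.trans hj')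

/-- The sum of absolute products of two sequences. -/
def pairSum (Λ : Finset ℤ) (u v : ℤ → ℝ) : ℝ := ∑ l ∈ Λ, |u l| * |v l|

lemma pairSum_nonneg (Λ : Finset ℤ) (u v : ℤ → ℝ) : 0 ≤ pairSum Λ u v :=
  Finset.sum_nonneg fun _ _ => by positivity

/-- The constant in the moment bounds for polynomials of degree `n`. -/
noncomputable def chaosConst (n : ℕ) (V A : ℝ) : ℝ :=
  2 * V ^ (2 * n) * ((2 * n) ^ (2 * n) * (A ^ (2 * n + 1)) ^ (2 * n))

lemma chaosConst_nonneg (n : ℕ) {V A : ℝ} (hV : 0 ≤ V) (hA : 0 ≤ A) : 0 ≤ chaosConst n V A := by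
  unfold chaosConst; positivity

section

variable {A : ℝ} (hA : 1 ≤ A) (ha : ∀ r, ∑ l ∈ Λ, a r l ^ 2 ≤ A) (hb : ∀ r, ∑ l ∈ Λ, b r l ^ 2 ≤ A)

include hA ha in
lemma abs_le_of_sum_sq_le (r : R) {l : ℤ} (hl : l ∈ Λ) : |a r l| ≤ A := by
  have h1 : a r l ^ 2 ≤ A :=
    (Finset.single_le_sum (f := fun l => a r l ^ 2) (fun _ _ => sq_nonneg _) hl).trans (ha r)
  refine abs_le_of_sq_le_sq ?_ (by linarith)
  nlinarith

include ha hb in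
lemma pairSum_le (r r' : R) : pairSum Λ (a r) (b r') ≤ A := by
  calc pairSum Λ (a r) (b r') ≤ ∑ l ∈ Λ, (a r l ^ 2 + b r' l ^ 2) / 2 := by
        refine Finset.sum_le_sum fun l _ => ?_
        nlinarith [sq_nonneg (|a r l| - |b r' l|), sq_abs (a r l), sq_abs (b r' l)]
    _ = (∑ l ∈ Λ, a r l ^ 2 + ∑ l ∈ Λ, b r' l ^ 2) / 2 := by
        rw [← Finset.sum_div, Finset.sum_add_distrib]
    _ ≤ A := by linarith [ha r, hb r']

lemma blockSum_pair {x y : R} (h : x ≠ y) :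
    blockSum Λ (fun x l => |a x l|) {x, y} = pairSum Λ (a x) (a y) := by
  simp [blockSum, pairSum, Finset.prod_pair h]

-- The form of `sum_prod_le_marks` used for covariances: square bounds on the coefficients supply
-- both the uniform bound and the bound for pairs, and each covariance estimate below only has to
-- name its marks.
include hA ha hb in
lemma sum_prod_abs_le (Q : (R ⊕ R → ℤ) → Prop) [DecidablePred Q] {ι : Type*} (I : Finset ι)
    (MM : ι → Finset (Finset (R ⊕ R)))
    (hd : ∀ i ∈ I, (MM i : Set (Finset (R ⊕ R))).PairwiseDisjoint id)
    (hne : ∀ i ∈ I, ∀ m ∈ MM i, m.Nonempty)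
    (hQ : ∀ G ∈ Fintype.piFinset (fun _ : R ⊕ R => Λ), Q G → (∀ x, ∃ y, y ≠ x ∧ G x = G y) ∧
      ∃ i ∈ I, ∀ m ∈ MM i, ∀ x ∈ m, ∀ y ∈ m, G x = G y) :
    2 * V ^ (2 * Fintype.card R) * ∑ G ∈ Fintype.piFinset (fun _ : R ⊕ R => Λ) with Q G,
        ∏ x, |Sum.elim a b x (G x)| ≤
      chaosConst (Fintype.card R) V A *
        ∑ i ∈ I, ∏ m ∈ MM i, blockSum Λ (fun x l => |Sum.elim a b x l|) m := by
  have hab : ∀ x, ∑ l ∈ Λ, Sum.elim a b x l ^ 2 ≤ A := by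
    rintro (r | r); exacts [ha r, hb r]
  have h0 : Fintype.card (R ⊕ R) = 2 * Fintype.card R := by rw [Fintype.card_sum]; ring
  have := sum_prod_le_marks (a := fun x l => |Sum.elim a b x l|) hA (fun _ _ => abs_nonneg _)
    (fun x l hl => abs_le_of_sum_sq_le hA hab x hl) (Λ := Λ)
    (fun x y hxy => (blockSum_pair hxy).trans_le (pairSum_le hab hab x y)) Q I MM hd hne hQ
  rw [h0] at this
  rw [chaosConst, mul_assoc (2 * V ^ _)]
  refine mul_le_mul_of_nonneg_left (this.trans_eq (by push_cast; rfl)) ?_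
  rw [pow_mul]
  positivity

-- The only mark is one pair of variables, one from each monomial, at a common point.
include hA ha hb in
theorem abs_chaos_cov_le_pair (hξ : IsIID μ ξ) (hη : IsBlockFamily μ ξ η V)
    (h1 : ∀ r, blockMean μ ξ η {r} = 0) :
    |∫ ω, chaos ξ Λ Q η a ω * chaos ξ Λ Q η b ω ∂μ -
        (∫ ω, chaos ξ Λ Q η a ω ∂μ) * ∫ ω, chaos ξ Λ Q η b ω ∂μ| ≤
      chaosConst (Fintype.card R) V A * ∑ p : R × R, pairSum Λ (a p.1) (b p.2) := by
  classical
  refine (abs_chaos_cov_le hξ hη).trans ?_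
  refine (sum_prod_abs_le (V := V) hA ha hb _ (Finset.univ : Finset (R × R))
    (fun p => {{Sum.inl p.1, Sum.inr p.2}}) (by simp) (by simp) ?_).trans_eq ?_
  · intro G hG hQ
    rw [Fintype.mem_piFinset] at hG
    refine ⟨exists_ne_of_covWeight_ne_zero hη h1 hG hQ.2, ?_⟩
    obtain ⟨i, i', h⟩ := exists_mixed_of_covWeight_ne_zero hη hQ.2
    refine ⟨(i, i'), Finset.mem_univ _, ?_⟩
    simp [h]
  · congr 1
    refine Finset.sum_congr rfl fun p _ => ?_
    rw [Finset.prod_singleton, blockSum_pair (a := Sum.elim a b) (by simp)]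
    rfl

-- The marks are two pairs across the monomials. The conditions on the indices make the pairs
-- disjoint, which is what allows a product of two pair sums.
include hA ha hb in
open Classical in
theorem abs_chaos_cov_le_two_pairs (hξ : IsIID μ ξ) (hη : IsBlockFamily μ ξ η V)
    (hodd : ∀ B : Finset R, Odd B.card → blockMean μ ξ η B = 0) (hR : Even (Fintype.card R)) :
    |∫ ω, chaos ξ Λ Q η a ω * chaos ξ Λ Q η b ω ∂μ -
        (∫ ω, chaos ξ Λ Q η a ω ∂μ) * ∫ ω, chaos ξ Λ Q η b ω ∂μ| ≤
      chaosConst (Fintype.card R) V A *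
        ∑ p : (R × R) × (R × R) with p.1.1 ≠ p.1.2 ∧ p.2.1 ≠ p.2.2,
          pairSum Λ (a p.1.1) (b p.2.1) * pairSum Λ (a p.1.2) (b p.2.2) := by
  have hne : ∀ p : (R × R) × (R × R), p.1.1 ≠ p.1.2 ∧ p.2.1 ≠ p.2.2 →
      Disjoint ({Sum.inl p.1.1, Sum.inr p.2.1} : Finset (R ⊕ R))
        {Sum.inl p.1.2, Sum.inr p.2.2} := by
    intro p hp
    rw [Finset.disjoint_left]
    simp only [Finset.mem_insert, Finset.mem_singleton]
    rintro x (rfl | rfl) (h | h) <;> simp at h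
    exacts [hp.1 h, hp.2 h]
  refine (abs_chaos_cov_le hξ hη).trans ?_
  refine (sum_prod_abs_le (V := V) hA ha hb _
    ((Finset.univ : Finset ((R × R) × (R × R))).filter
      fun p => p.1.1 ≠ p.1.2 ∧ p.2.1 ≠ p.2.2)
    (fun p => {{Sum.inl p.1.1, Sum.inr p.2.1}, {Sum.inl p.1.2, Sum.inr p.2.2}})
      ?_ (by simp) ?_).trans_eq ?_
  · intro p hp
    rw [Finset.mem_filter] at hp
    rw [Finset.coe_pair]
    exact Set.pairwise_pair.2 fun _ => ⟨hne p hp.2, (hne p hp.2).symm⟩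
  · intro G hG hQ
    rw [Fintype.mem_piFinset] at hG
    refine ⟨exists_ne_of_covWeight_ne_zero hη (fun r => hodd _ (by simp)) hG hQ.2, ?_⟩
    obtain ⟨i, j, i', j', h1, h2, h3, h4⟩ :=
      exists_two_pairs_of_covWeight_ne_zero hη hodd hR hG hQ.2
    refine ⟨((i, j), (i', j')), by simp [h1, h2], ?_⟩
    simp [h3, h4]
  · congr 1
    refine Finset.sum_congr rfl fun p hp => ?_
    rw [Finset.mem_filter] at hp
    have h := hne p hp.2
    rw [Finset.prod_pair, blockSum_pair (a := Sum.elim a b) (by simp),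
      blockSum_pair (a := Sum.elim a b) (by simp)]
    · rfl
    · intro h'
      rw [h', Finset.disjoint_self_iff_empty] at h
      simp at h

/-- The kernel which bounds the covariances of polynomials with a centred block in every
monomial. -/
def centredKernel (Λ : Finset ℤ) (a b : R → ℤ → ℝ) : ℝ :=
  (∑ p : (R × R) × (R × R), ∑ l ∈ Λ, |a p.1.1 l| * |a p.1.2 l| * |b p.2.1 l| * |b p.2.2 l|) +
  ∑ p : (R × R × R) × (R × R × R), (∑ l ∈ Λ, |a p.1.1 l| * |a p.1.2.1 l| * |b p.1.2.2 l|) *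
    ∑ l ∈ Λ, |a p.2.1 l| * |b p.2.2.1 l| * |b p.2.2.2 l|

-- The marks follow the two alternatives of `exists_centred_of_covWeight_ne_zero`: one block with
-- two variables from each side, or two disjoint blocks, each with two variables from one side and
-- one from the other. At the end the distinctness conditions are dropped, since all terms are
-- nonnegative.
include hA ha hb in
theorem abs_chaos_cov_le_centred (hξ : IsIID μ ξ) (hη : IsBlockFamily μ ξ η V)
    (h1 : ∀ r, blockMean μ ξ η {r} = 0) {H : Finset R → Prop}
    (hH : ∀ B, H B → blockMean μ ξ η B = 0 ∧ 2 ≤ B.card) (hQ : ∀ g, Q g → ∃ l ∈ Λ, H (fiber g l)) :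
    |∫ ω, chaos ξ Λ Q η a ω * chaos ξ Λ Q η b ω ∂μ -
        (∫ ω, chaos ξ Λ Q η a ω ∂μ) * ∫ ω, chaos ξ Λ Q η b ω ∂μ| ≤
      chaosConst (Fintype.card R) V A * centredKernel Λ a b := by
  classical
  refine (abs_chaos_cov_le hξ hη).trans ?_
  set I₁ : Finset ((R × R) × (R × R)) := Finset.univ.filter
    fun p => p.1.1 ≠ p.1.2 ∧ p.2.1 ≠ p.2.2 with hI₁
  set I₂ : Finset ((R × R × R) × (R × R × R)) := Finset.univ.filter
    fun p => p.1.1 ≠ p.1.2.1 ∧ p.2.2.1 ≠ p.2.2.2 ∧ p.2.1 ≠ p.1.1 ∧ p.2.1 ≠ p.1.2.1 ∧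
      p.1.2.2 ≠ p.2.2.1 ∧ p.1.2.2 ≠ p.2.2.2 with hI₂
  set M₁ : (R × R) × (R × R) → Finset (Finset (R ⊕ R)) := fun p =>
    {{Sum.inl p.1.1, Sum.inl p.1.2, Sum.inr p.2.1, Sum.inr p.2.2}} with hM₁
  set M₂ : (R × R × R) × (R × R × R) → Finset (Finset (R ⊕ R)) := fun p =>
    {{Sum.inl p.1.1, Sum.inl p.1.2.1, Sum.inr p.1.2.2},
      {Sum.inl p.2.1, Sum.inr p.2.2.1, Sum.inr p.2.2.2}} with hM₂
  have hdis : ∀ p ∈ I₂, Disjoint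
      ({Sum.inl p.1.1, Sum.inl p.1.2.1, Sum.inr p.1.2.2} : Finset (R ⊕ R))
      {Sum.inl p.2.1, Sum.inr p.2.2.1, Sum.inr p.2.2.2} := by
    intro p hp
    simp only [hI₂, Finset.mem_filter, Finset.mem_univ, true_and] at hp
    obtain ⟨-, -, h3, h4, h5, h6⟩ := hp
    rw [Finset.disjoint_left]
    simp only [Finset.mem_insert, Finset.mem_singleton]
    rintro x (rfl | rfl | rfl) (h | h | h) <;> simp at h
    exacts [h3 h.symm, h4 h.symm, h5 h, h6 h]
  refine (sum_prod_abs_le (V := V) hA ha hb _ (I₁.disjSum I₂) (Sum.elim M₁ M₂)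
      ?_ ?_ ?_).trans ?_
  · rintro (p | p) hp
    · simp [hM₁]
    · rw [Finset.inr_mem_disjSum] at hp
      rw [Sum.elim_inr, hM₂, Finset.coe_pair]
      exact Set.pairwise_pair.2 fun _ => ⟨hdis p hp, (hdis p hp).symm⟩
  · rintro (p | p) hp <;> simp [hM₁, hM₂]
  · intro G hG hw
    rw [Fintype.mem_piFinset] at hG
    refine ⟨exists_ne_of_covWeight_ne_zero hη h1 hG hw.2, ?_⟩
    rcases exists_centred_of_covWeight_ne_zero hη hH hw.2 (hQ _ hw.1.1) (hQ _ hw.1.2) with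
      ⟨i, j, i', j', h2, h3, h4, h5, h6⟩ |
      ⟨i, j, i', j', r, r', h2, h3, h4, h5, h6, h7, h8, h9, h10, h11⟩
    · refine ⟨Sum.inl ((i, j), (i', j')), by simp [hI₁, h2, h3], ?_⟩
      simp [hM₁, ← h4, ← h5, ← h6]
    · refine ⟨Sum.inr ((i, j, r'), (r, i', j')), by simp [hI₂, h2, h3, h4, h5, h6, h7], ?_⟩
      simp [hM₂, ← h8, ← h9, ← h10, ← h11]
  · refine mul_le_mul_of_nonneg_left ?_
      (chaosConst_nonneg _ (zero_le_one.trans hη.one_le) (zero_le_one.trans hA))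
    rw [Finset.sum_disjSum, centredKernel]
    refine add_le_add ?_ ?_
    · refine le_trans (Finset.sum_le_sum fun p hp => ?_)
        (Finset.sum_le_sum_of_subset_of_nonneg (Finset.subset_univ I₁)
          fun p _ _ => Finset.sum_nonneg fun _ _ => by positivity)
      simp only [hI₁, Finset.mem_filter, Finset.mem_univ, true_and] at hp
      simp only [hM₁, Sum.elim_inl, Finset.prod_singleton, blockSum]
      refine Finset.sum_le_sum fun l _ => le_of_eq ?_
      rw [Finset.prod_insert (by simp [hp.1]), Finset.prod_insert (by simp),
        Finset.prod_pair (by simp [hp.2])]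
      simp only [Sum.elim_inl, Sum.elim_inr]
      ring
    · refine le_trans (Finset.sum_le_sum fun p hp => ?_)
        (Finset.sum_le_sum_of_subset_of_nonneg (Finset.subset_univ I₂)
          fun p _ _ => mul_nonneg (Finset.sum_nonneg fun _ _ => by positivity)
            (Finset.sum_nonneg fun _ _ => by positivity))
      have hd := hdis p hp
      simp only [hI₂, Finset.mem_filter, Finset.mem_univ, true_and] at hp
      simp only [hM₂, Sum.elim_inr]
      rw [Finset.prod_pair]
      · simp only [blockSum]
        refine le_of_eq (congrArg₂ _ (Finset.sum_congr rfl fun l _ => ?_)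
          (Finset.sum_congr rfl fun l _ => ?_))
        · rw [Finset.prod_insert (by simp [hp.1]), Finset.prod_pair (by simp)]
          simp only [Sum.elim_inl, Sum.elim_inr]
          ring
        · rw [Finset.prod_insert (by simp), Finset.prod_pair (by simp [hp.2.1])]
          simp only [Sum.elim_inl, Sum.elim_inr]
          ring
      · intro h'
        rw [h', Finset.disjoint_self_iff_empty] at hd
        simp at hd

-- A monomial in the second moment with a singleton fibre has expectation zero. The remaining ones
-- are summable because every point is shared by at least two variables, whose coefficients are
-- square summable.
include hA ha in
theorem integral_chaos_sq_le (hξ : IsIID μ ξ) (hη : IsBlockFamily μ ξ η V)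
    (h1 : ∀ r, blockMean μ ξ η {r} = 0) :
    ∫ ω, chaos ξ Λ Q η a ω ^ 2 ∂μ ≤ chaosConst (Fintype.card R) V A := by
  classical
  have hV := zero_le_one.trans hη.one_le
  simp only [pow_two (chaos _ _ _ _ _ _)]
  rw [(integral_chaos_mul hξ hη).2]
  -- One family, with no marks at all: only the absence of singleton fibres is used.
  refine le_trans ?_ ((sum_prod_abs_le (V := V) hA ha ha
    (fun G => ∀ x, ∃ y, y ≠ x ∧ G x = G y) ({()} : Finset Unit) (fun _ => ∅) (by simp) (by simp)
    (fun G _ h => ⟨h, by simp⟩)).trans_eq (by simp))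
  rw [Finset.sum_filter, Finset.sum_filter, Finset.mul_sum]
  refine Finset.sum_le_sum fun G hG => ?_
  rw [Fintype.mem_piFinset] at hG
  have hp : 0 ≤ ∏ x, |Sum.elim a a x (G x)| := Finset.prod_nonneg fun _ _ => abs_nonneg _
  by_cases hs : ∀ x, ∃ y, y ≠ x ∧ G x = G y
  · rw [if_pos hs]
    split_ifs
    · refine (le_abs_self _).trans ?_
      rw [abs_mul, mul_comm, Finset.abs_prod (f := fun x => Sum.elim a a x (G x))]
      refine mul_le_mul_of_nonneg_right ((hη.abs_prod_blockCorr_le hG).trans ?_) hp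
      linarith [pow_nonneg hV (2 * Fintype.card R)]
    · positivity
  · rw [if_neg hs, mul_zero]
    push Not at hs
    obtain ⟨x, hx⟩ := hs
    rw [Finset.prod_eq_zero (hG x) (singleton_fiber_cases hη h1 hx).1]
    simp

end

end ChaosBounds

/-! ### Heavy blocks and first moments of polynomials that contain them. -/

section HeavyBlocks

variable {Ω R : Type*} [MeasurableSpace Ω] {μ : Measure Ω} [Fintype R] [DecidableEq R]

/-- The product of the coordinates of a vector over a block. -/
def monomial {R' : Type*} (ι : R' → R) (B : Finset R') (x : R → ℝ) : ℝ := ∏ r ∈ B, x (ι r)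

lemma measurable_monomial {R' : Type*} (ι : R' → R) (B : Finset R') :
    Measurable (monomial ι B) :=
  Finset.measurable_fun_prod _ fun _ _ => measurable_pi_apply _

lemma prod_monomial_fiber {R' : Type*} [Fintype R'] {Λ : Finset ℤ} (ι : R' → R) {g : R' → ℤ}
    (hg : ∀ r, g r ∈ Λ) (x : ℤ → R → ℝ) :
    ∏ l ∈ Λ, monomial ι (fiber g l) (x l) = ∏ r, x (g r) (ι r) := by
  rw [← Finset.prod_fiberwise_of_maps_to (s := Finset.univ) (t := Λ) (g := g) (fun r _ => hg r)]
  refine Finset.prod_congr rfl fun l _ => Finset.prod_congr rfl fun r hr => ?_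
  have hr' : g r = l := by simpa using hr
  rw [hr']

/-- The map `ι` lets the factors be indexed by part of the components; this is needed for the
complement of a heavy block. -/
lemma prod_sum_eq_chaos {R' : Type*} [Fintype R'] [DecidableEq R'] (ι : R' → R) (Λ : Finset ℤ)
    (ξ : ℤ → Ω → (R → ℝ)) (a : R' → ℤ → ℝ) (ω : Ω) :
    ∏ r, ∑ l ∈ Λ, a r l * ξ l ω (ι r) = chaos ξ Λ (fun _ => True) (monomial ι) a ω := by
  rw [Finset.prod_univ_sum, chaos, Finset.filter_true]
  refine Finset.sum_congr rfl fun g hg => ?_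
  rw [Fintype.mem_piFinset] at hg
  rw [Finset.prod_mul_distrib, prod_monomial_fiber ι hg fun l => ξ l ω]

/-- A block is heavy if its product of innovations need not have a second moment. -/
def IsHeavy (B : Finset R) : Prop := max (Fintype.card R) 2 < 2 * B.card

lemma IsHeavy.two_le {B : Finset R} (h : IsHeavy B) : 2 ≤ B.card := by
  unfold IsHeavy at h; omega

lemma not_isHeavy_empty : ¬ IsHeavy (∅ : Finset R) := by simp [IsHeavy]

lemma not_isHeavy_of_card_le_one {B : Finset R} (h : B.card ≤ 1) : ¬ IsHeavy B := by
  unfold IsHeavy; omega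

/-- A heavy block has more than half of the elements of `R`, and distinct fibres are disjoint. -/
lemma IsHeavy.unique {g : R → ℤ} {l l' : ℤ} (h : IsHeavy (fiber g l)) (h' : IsHeavy (fiber g l')) :
    l = l' := by
  by_contra hne
  have hd : Disjoint (fiber g l) (fiber g l') := by
    rw [Finset.disjoint_left]
    intro r hr hr'
    rw [mem_fiber] at hr hr'
    exact hne (hr.symm.trans hr')
  have := Finset.card_le_univ (fiber g l ∪ fiber g l')
  rw [Finset.card_union_of_disjoint hd] at this
  unfold IsHeavy at h h'
  omega

lemma IsHeavy.not_isHeavy_of_card_le_compl {B D : Finset R} (h : IsHeavy B)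
    (hD : D.card ≤ (Bᶜ).card) : ¬ IsHeavy D := by
  rw [Finset.card_compl] at hD
  unfold IsHeavy at h ⊢
  omega

/-- A monomial has a heavy fibre. -/
def HasHeavyFiber (Λ : Finset ℤ) (g : R → ℤ) : Prop := ∃ l ∈ Λ, IsHeavy (fiber g l)

/-- Splitting the heavy blocks into three parts splits the random polynomial, because a monomial
has at most one heavy block. -/
lemma chaos_split {E : Type*} (ξ : ℤ → Ω → E) (Λ : Finset ℤ) (a : R → ℤ → ℝ)
    {φ ψ η₁ η₂ : Finset R → E → ℝ} (τ : ℝ)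
    (hl : ∀ B, ¬ IsHeavy B → φ B = ψ B ∧ φ B = η₁ B ∧ φ B = η₂ B)
    (hh : ∀ B, IsHeavy B → ∀ x, φ B x = ψ B x + τ * η₁ B x + η₂ B x) (ω : Ω) :
    chaos ξ Λ (fun _ => True) φ a ω = chaos ξ Λ (fun _ => True) ψ a ω +
      τ * chaos ξ Λ (HasHeavyFiber Λ) η₁ a ω + chaos ξ Λ (HasHeavyFiber Λ) η₂ a ω := by
  classical
  simp only [chaos, Finset.filter_true]
  rw [add_assoc, Finset.mul_sum, ← Finset.sum_add_distrib, Finset.sum_filter,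
    ← Finset.sum_add_distrib]
  refine Finset.sum_congr rfl fun g hg => ?_
  split_ifs with h
  · obtain ⟨l, hlΛ, hlH⟩ := h
    have hlight : ∀ l' ∈ Λ.erase l, ¬ IsHeavy (fiber g l') := fun l' hl' h' =>
      (Finset.mem_erase.1 hl').1 (IsHeavy.unique h' hlH)
    rw [← Finset.mul_prod_erase _ _ hlΛ, ← Finset.mul_prod_erase _ _ hlΛ,
      ← Finset.mul_prod_erase _ _ hlΛ, ← Finset.mul_prod_erase _ _ hlΛ, hh _ hlH,
      ← Finset.prod_congr rfl fun l' hl' => congrFun (hl _ (hlight l' hl')).1 (ξ l' ω),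
      ← Finset.prod_congr rfl fun l' hl' => congrFun (hl _ (hlight l' hl')).2.1 (ξ l' ω),
      ← Finset.prod_congr rfl fun l' hl' => congrFun (hl _ (hlight l' hl')).2.2 (ξ l' ω)]
    ring
  · rw [add_zero]
    congr 1
    refine Finset.prod_congr rfl fun l hlΛ => congrFun (hl _ fun h' => h ⟨l, hlΛ, h'⟩).1 _

-- Sort the monomials by their unique heavy block `B` and its point `l`. The other variables then
-- range freely over the window without `l`, so they reassemble into a product of linear forms that
-- does not involve `ξ l`.
open Classical in
lemma chaos_heavy_eq (ξ : ℤ → Ω → (R → ℝ)) (Λ : Finset ℤ) (a : R → ℤ → ℝ)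
    {η : Finset R → (R → ℝ) → ℝ} (hl : ∀ B, ¬ IsHeavy B → η B = monomial id B) (ω : Ω) :
    chaos ξ Λ (HasHeavyFiber Λ) η a ω = ∑ l ∈ Λ, ∑ B : Finset R with IsHeavy B,
      (∏ r ∈ B, a r l) * (η B (ξ l ω) *
        ∏ r : (Bᶜ : Finset R), ∑ l' ∈ Λ.erase l, a r l' * ξ l' ω r) := by
  set f : (R → ℤ) → ℝ := fun g => (∏ r, a r (g r)) * ∏ l ∈ Λ, η (fiber g l) (ξ l ω) with hf
  have h1 : chaos ξ Λ (HasHeavyFiber Λ) η a ω = ∑ l ∈ Λ, ∑ g ∈ Fintype.piFinset (fun _ : R => Λ),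
      if IsHeavy (fiber g l) then f g else 0 := by
    rw [Finset.sum_comm, chaos, Finset.sum_filter]
    refine Finset.sum_congr rfl fun g _ => ?_
    split_ifs with h
    · obtain ⟨l, hlΛ, hlH⟩ := h
      rw [Finset.sum_eq_single_of_mem l hlΛ, if_pos hlH]
      intro l' _ hne
      rw [if_neg]
      exact fun h' => hne (IsHeavy.unique h' hlH)
    · refine (Finset.sum_eq_zero fun l hlΛ => ?_).symm
      rw [if_neg]
      exact fun h' => h ⟨l, hlΛ, h'⟩
  rw [h1]
  refine Finset.sum_congr rfl fun l hlΛ => ?_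
  rw [← Finset.sum_filter, ← Finset.sum_fiberwise_of_maps_to (g := fun g => fiber g l)
    (t := Finset.univ.filter IsHeavy) (fun g hg => by
      simpa using (Finset.mem_filter.1 hg).2)]
  refine Finset.sum_congr rfl fun B hB => ?_
  have hBH : IsHeavy B := by simpa using hB
  have hset : ((Fintype.piFinset fun _ : R => Λ).filter fun g => IsHeavy (fiber g l)).filter
      (fun g => fiber g l = B) =
      Fintype.piFinset fun r => if r ∈ B then {l} else Λ.erase l := by
    ext g
    simp only [Finset.mem_filter, Fintype.mem_piFinset]
    constructor
    · rintro ⟨⟨h2, -⟩, rfl⟩ r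
      by_cases hr : g r = l
      · simp [hr]
      · simp [hr, h2 r]
    · intro h2
      have h3 : fiber g l = B := by
        ext r
        rw [mem_fiber]
        have := h2 r
        split_ifs at this with hr
        · simpa [hr] using this
        · simpa [hr] using (Finset.mem_erase.1 this).1
      refine ⟨⟨fun r => ?_, by rwa [h3]⟩, h3⟩
      have := h2 r
      split_ifs at this with hr
      · rw [Finset.mem_singleton.1 this]; exact hlΛ
      · exact Finset.mem_of_mem_erase this
  rw [hset]
  have hprod : (∏ r ∈ B, a r l) *
      ∏ r : (Bᶜ : Finset R), ∑ l' ∈ Λ.erase l, a r l' * ξ l' ω r =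
      ∑ g ∈ Fintype.piFinset (fun r => if r ∈ B then {l} else Λ.erase l),
        ∏ r, a r (g r) * (if r ∈ B then 1 else ξ (g r) ω r) := by
    rw [← Finset.prod_univ_sum (fun r => if r ∈ B then {l} else Λ.erase l)
      fun r l' => a r l' * (if r ∈ B then 1 else ξ l' ω r), ← Finset.prod_mul_prod_compl B,
      Finset.prod_coe_sort Bᶜ fun r => ∑ l' ∈ Λ.erase l, a r l' * ξ l' ω r]
    congr 1
    · refine Finset.prod_congr rfl fun r hr => ?_
      simp [hr]
    · refine Finset.prod_congr rfl fun r hr => ?_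
      rw [Finset.mem_compl] at hr
      simp [hr]
  rw [mul_left_comm, hprod, Finset.mul_sum]
  refine Finset.sum_congr rfl fun g hg => ?_
  rw [← hset] at hg
  simp only [Finset.mem_filter, Fintype.mem_piFinset] at hg
  obtain ⟨⟨hgΛ, hgH⟩, rfl⟩ := hg
  have hrest : ∏ l' ∈ Λ.erase l, η (fiber g l') (ξ l' ω) =
      ∏ r, if r ∈ fiber g l then 1 else ξ (g r) ω r := by
    have h2 : ∏ l' ∈ Λ.erase l, η (fiber g l') (ξ l' ω) =
        ∏ l' ∈ Λ.erase l, monomial id (fiber g l') (ξ l' ω) :=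
      Finset.prod_congr rfl fun l' hl' => congrFun (hl _ fun h' =>
        (Finset.mem_erase.1 hl').1 (IsHeavy.unique h' hgH)) _
    rw [h2, ← Finset.prod_fiberwise_of_maps_to (s := Finset.univ) (t := Λ) (g := g)
      (fun r _ => hgΛ r), ← Finset.mul_prod_erase _ _ hlΛ,
      Finset.prod_eq_one (s := Finset.univ.filter fun r => g r = l), one_mul]
    · refine Finset.prod_congr rfl fun l' hl' => Finset.prod_congr rfl fun r hr => ?_
      have hr' : g r = l' := by simpa using hr
      have : g r ≠ l := by rw [hr']; exact (Finset.mem_erase.1 hl').1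
      rw [if_neg (by simpa using this), hr']
      rfl
    · intro r hr
      have hr' : g r = l := by simpa using hr
      simp [hr']
  rw [hf]
  simp only
  rw [← Finset.mul_prod_erase _ _ hlΛ, hrest, Finset.prod_mul_distrib]
  ring

/-- The constant in the first moment bound for polynomials of degree `n` with a heavy block. -/
noncomputable def heavyConst (n : ℕ) (V A : ℝ) : ℝ :=
  2 ^ n * (A ^ (n + 1) * (1 + ∑ k ∈ Finset.range (n + 1), chaosConst k V A))

lemma heavyConst_nonneg (n : ℕ) {V A : ℝ} (hV : 0 ≤ V) (hA : 0 ≤ A) : 0 ≤ heavyConst n V A := by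
  have := Finset.sum_nonneg fun k (_ : k ∈ Finset.range (n + 1)) => chaosConst_nonneg k hV hA
  unfold heavyConst; positivity

/-- Second moment bounds for the products over light blocks, and centred coordinates. -/
structure HasLightMoments (μ : Measure Ω) (ξ : ℤ → Ω → (R → ℝ)) (V : ℝ) : Prop where
  one_le : 1 ≤ V
  memLp : ∀ B : Finset R, ¬ IsHeavy B → MemLp (fun ω => monomial id B (ξ 1 ω)) 2 μ
  integral_sq_le : ∀ B : Finset R, ¬ IsHeavy B → ∫ ω, monomial id B (ξ 1 ω) ^ 2 ∂μ ≤ V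
  mean_zero : ∀ r, ∫ ω, ξ 1 ω r ∂μ = 0

variable [IsProbabilityMeasure μ] {ξ : ℤ → Ω → (R → ℝ)} {Λ : Finset ℤ} {V A : ℝ}
  {a : R → ℤ → ℝ}

lemma monomial_map {B : Finset R} (D : Finset B) (x : R → ℝ) :
    monomial (fun r : B => (r : R)) D x = monomial id (D.map (Function.Embedding.subtype _)) x := by
  simp [monomial]

lemma HasLightMoments.isBlockFamily_compl (h : HasLightMoments μ ξ V) {B : Finset R}
    (hB : IsHeavy B) :
    IsBlockFamily μ ξ (monomial fun r : (Bᶜ : Finset R) => (r : R)) V := by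
  have hD : ∀ D : Finset (Bᶜ : Finset R), ¬ IsHeavy (D.map (Function.Embedding.subtype _)) := by
    intro D
    refine hB.not_isHeavy_of_card_le_compl ?_
    rw [Finset.card_map, ← Fintype.card_coe Bᶜ]
    exact Finset.card_le_univ D
  refine ⟨fun D => measurable_monomial _ _, fun x => by simp [monomial], fun D => ?_, fun D => ?_⟩
  · simp only [monomial_map]
    exact h.memLp _ (hD D)
  · simp only [monomial_map]
    exact h.integral_sq_le _ (hD D)

/-- Subsets of the complement of a heavy block are light, so the second moment bound applies, and
|x| ≤ 1 + x² gives the first moment. The sum over `k` covers every possible size of the complement.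
-/
lemma HasLightMoments.prod_compl_bound (h : HasLightMoments μ ξ V) (hξ : IsIID μ ξ)
    (hA : 1 ≤ A) (ha : ∀ r, ∑ l ∈ Λ, a r l ^ 2 ≤ A) {B : Finset R} (hB : IsHeavy B) :
    Integrable (fun ω => ∏ r : (Bᶜ : Finset R), ∑ l ∈ Λ, a r l * ξ l ω r) μ ∧
    ∫ ω, |∏ r : (Bᶜ : Finset R), ∑ l ∈ Λ, a r l * ξ l ω r| ∂μ ≤
      1 + ∑ k ∈ Finset.range (Fintype.card R + 1), chaosConst k V A := by
  have hη := h.isBlockFamily_compl hB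
  have h1 : ∀ r : (Bᶜ : Finset R),
      blockMean μ ξ (monomial fun r : (Bᶜ : Finset R) => (r : R)) {r} = 0 := by
    intro r
    simp [blockMean, monomial, h.mean_zero]
  have e : ∀ ω, ∏ r : (Bᶜ : Finset R), ∑ l ∈ Λ, a r l * ξ l ω r =
      chaos ξ Λ (fun _ => True) (monomial fun r : (Bᶜ : Finset R) => (r : R))
        (fun r => a r) ω :=
    fun ω => prod_sum_eq_chaos (fun r : (Bᶜ : Finset R) => (r : R)) Λ ξ (fun r => a r) ω
  simp only [e]
  have hint := integral_chaos (Λ := Λ) (Q := fun _ => True) (a := fun r : (Bᶜ : Finset R) => a r)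
    hξ hη.measurable hη.integrable
  refine ⟨hint.1, ?_⟩
  have hsq := (integral_chaos_mul (Λ := Λ) (Q := fun _ => True)
    (a := fun r : (Bᶜ : Finset R) => a r) (b := fun r : (Bᶜ : Finset R) => a r) hξ hη).1
  have hbd := integral_chaos_sq_le (Λ := Λ) (Q := fun _ => True)
    (a := fun r : (Bᶜ : Finset R) => a r) hA (fun r => ha r) hξ hη h1
  simp only [← pow_two] at hsq
  calc _ ≤ ∫ ω, (1 + chaos ξ Λ (fun _ => True) (monomial fun r : (Bᶜ : Finset R) => (r : R))
        (fun r => a r) ω ^ 2) ∂μ := by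
        refine integral_mono hint.1.abs ((integrable_const 1).add hsq) fun ω => ?_
        simp only
        rw [← sq_abs]
        nlinarith [sq_nonneg (|chaos ξ Λ (fun _ => True)
          (monomial fun r : (Bᶜ : Finset R) => (r : R)) (fun r => a r) ω| - 1)]
    _ = 1 + ∫ ω, chaos ξ Λ (fun _ => True) (monomial fun r : (Bᶜ : Finset R) => (r : R))
        (fun r => a r) ω ^ 2 ∂μ := by
        rw [integral_add (integrable_const 1) hsq]; simp
    _ ≤ _ := by
        refine add_le_add le_rfl (hbd.trans ?_)
        refine Finset.single_le_sum (f := fun k => chaosConst k V A)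
          (fun k _ => chaosConst_nonneg k (zero_le_one.trans h.one_le) (zero_le_one.trans hA)) ?_
        rw [Finset.mem_range, Nat.lt_succ_iff]
        rw [Fintype.card_coe]
        exact Finset.card_le_univ _

/-- In `chaos_heavy_eq` each term is a product of independent factors, so first moments multiply.
Summation over `l` converges because a heavy block carries at least two square summable
coefficients. This needs only one moment of the heavy factor. -/
theorem integral_abs_chaos_heavy_le (h : HasLightMoments μ ξ V) (hξ : IsIID μ ξ)
    (hA : 1 ≤ A) (ha : ∀ r, ∑ l ∈ Λ, a r l ^ 2 ≤ A) {η : Finset R → (R → ℝ) → ℝ}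
    (hl : ∀ B, ¬ IsHeavy B → η B = monomial id B) (hm : ∀ B, Measurable (η B)) {δ : ℝ}
    (hδ0 : 0 ≤ δ) (hi : ∀ B, IsHeavy B → Integrable (fun ω => η B (ξ 1 ω)) μ)
    (hδ : ∀ B, IsHeavy B → ∫ ω, |η B (ξ 1 ω)| ∂μ ≤ δ) :
    Integrable (chaos ξ Λ (HasHeavyFiber Λ) η a) μ ∧
    ∫ ω, |chaos ξ Λ (HasHeavyFiber Λ) η a ω| ∂μ ≤ heavyConst (Fintype.card R) V A * δ := by
  classical
  set K := 1 + ∑ k ∈ Finset.range (Fintype.card R + 1), chaosConst k V A with hK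
  have hK0 : 0 ≤ K := by
    have := Finset.sum_nonneg fun k (_ : k ∈ Finset.range (Fintype.card R + 1)) =>
      chaosConst_nonneg k (zero_le_one.trans h.one_le) (zero_le_one.trans hA)
    positivity
  set Y : ℤ → Finset R → Ω → ℝ := fun l B ω => ∏ r : (Bᶜ : Finset R),
    ∑ l' ∈ Λ.erase l, a r l' * ξ l' ω r with hY
  have hterm : ∀ l, ∀ B, IsHeavy B → Integrable (fun ω => η B (ξ l ω) * Y l B ω) μ ∧
      ∫ ω, |η B (ξ l ω) * Y l B ω| ∂μ ≤ δ * K := by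
    intro l B hB
    have ha' : ∀ r, ∑ l' ∈ Λ.erase l, a r l' ^ 2 ≤ A := fun r =>
      (Finset.sum_le_sum_of_subset_of_nonneg (Finset.erase_subset _ _)
        fun _ _ _ => sq_nonneg _).trans (ha r)
    obtain ⟨hYi, hYb⟩ := h.prod_compl_bound hξ hA ha' hB
    -- `Y l B` uses only innovations from `Λ.erase l`.
    have hind : IndepFun (ξ l) (Y l B) μ := by
      have h0 := hξ.indep.indepFun_finset {l} (Λ.erase l) (by simp) hξ.measurable
      refine h0.comp (φ := fun x => x ⟨l, by simp⟩) (ψ := fun x => ∏ r : (Bᶜ : Finset R),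
        ∑ l' : (Λ.erase l : Finset ℤ), a r l' * x l' r) (measurable_pi_apply _) ?_ |>.congr ?_ ?_
      · refine Finset.measurable_fun_prod _ fun r _ => Finset.measurable_fun_sum _ fun l' _ => ?_
        fun_prop
      · exact Eventually.of_forall fun ω => rfl
      · refine Eventually.of_forall fun ω => ?_
        simp only [hY, Function.comp_apply]
        refine Finset.prod_congr rfl fun r _ => ?_
        exact Finset.sum_coe_sort (Λ.erase l) fun l' => a r l' * ξ l' ω r
    have hηi := hξ.integrable_comp (hm B) (hi B hB) l
    have hind1 := hind.comp (hm B) measurable_id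
    have hind2 : IndepFun (fun ω => |η B (ξ l ω)|) (fun ω => |Y l B ω|) μ :=
      hind.comp ((hm B).abs) measurable_abs
    refine ⟨hind1.integrable_mul hηi hYi, ?_⟩
    simp only [abs_mul]
    have h3 := hind2.integral_mul_eq_mul_integral hηi.abs.aestronglyMeasurable
      hYi.abs.aestronglyMeasurable
    have h4 := hξ.integral_comp (hm B).abs l
    refine h3.trans_le ?_
    refine mul_le_mul ?_ hYb (integral_nonneg fun _ => abs_nonneg _) hδ0
    exact h4.trans_le (hδ B hB)
  -- Two variables of `B` give a pair sum; the others are bounded by `A`.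
  have hcoef : ∀ B : Finset R, IsHeavy B →
      ∑ l ∈ Λ, ∏ r ∈ B, |a r l| ≤ A ^ (Fintype.card R + 1) := by
    intro B hB
    obtain ⟨x, hx, y, hy, hxy⟩ := Finset.one_lt_card.1 hB.two_le
    have h1 := blockSum_mono (a := fun r l => |a r l|) hA (fun _ _ => abs_nonneg _)
      (fun r l hl => abs_le_of_sum_sq_le hA ha r hl) (Λ := Λ) (m := {x, y}) (m' := B)
      (by intro z hz; simp only [Finset.mem_insert, Finset.mem_singleton] at hz
          rcases hz with rfl | rfl <;> assumption)
    refine h1.trans ?_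
    rw [blockSum_pair hxy, pow_succ]
    exact mul_le_mul_of_nonneg_left (pairSum_le ha ha x y) (by positivity)
  have heq := fun ω => chaos_heavy_eq ξ Λ a hl ω
  have hint : ∀ l, ∀ B ∈ Finset.univ.filter (fun B : Finset R => IsHeavy B),
      Integrable (fun ω => (∏ r ∈ B, a r l) * (η B (ξ l ω) * Y l B ω)) μ := fun l B hB =>
    (hterm l B (Finset.mem_filter.1 hB).2).1.const_mul _
  have hchaos : Integrable (chaos ξ Λ (HasHeavyFiber Λ) η a) μ := by
    rw [funext heq]
    exact integrable_finsetSum _ fun l _ => integrable_finsetSum _ fun B hB => hint l B hB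
  refine ⟨hchaos, ?_⟩
  calc ∫ ω, |chaos ξ Λ (HasHeavyFiber Λ) η a ω| ∂μ
      ≤ ∫ ω, ∑ l ∈ Λ, ∑ B : Finset R with IsHeavy B,
          |(∏ r ∈ B, a r l) * (η B (ξ l ω) * Y l B ω)| ∂μ := by
        refine integral_mono hchaos.abs (integrable_finsetSum _ fun l _ =>
          integrable_finsetSum _ fun B hB => (hint l B hB).abs) fun ω => ?_
        simp only
        rw [heq]
        refine (Finset.abs_sum_le_sum_abs _ _).trans (Finset.sum_le_sum fun l _ => ?_)
        exact Finset.abs_sum_le_sum_abs _ _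
    _ = ∑ l ∈ Λ, ∑ B : Finset R with IsHeavy B,
          (∏ r ∈ B, |a r l|) * ∫ ω, |η B (ξ l ω) * Y l B ω| ∂μ := by
        rw [integral_finsetSum _ fun l _ => integrable_finsetSum _ fun B hB => (hint l B hB).abs]
        refine Finset.sum_congr rfl fun l _ => ?_
        rw [integral_finsetSum _ fun B hB => (hint l B hB).abs]
        refine Finset.sum_congr rfl fun B _ => ?_
        rw [← integral_const_mul]
        refine integral_congr_ae (Eventually.of_forall fun ω => ?_)
        simp only
        rw [abs_mul, Finset.abs_prod]
    _ ≤ ∑ l ∈ Λ, ∑ B : Finset R with IsHeavy B, (∏ r ∈ B, |a r l|) * (δ * K) := by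
        refine Finset.sum_le_sum fun l _ => Finset.sum_le_sum fun B hB => ?_
        exact mul_le_mul_of_nonneg_left (hterm l B (Finset.mem_filter.1 hB).2).2
          (Finset.prod_nonneg fun _ _ => abs_nonneg _)
    _ = ∑ B : Finset R with IsHeavy B, (∑ l ∈ Λ, ∏ r ∈ B, |a r l|) * (δ * K) := by
        rw [Finset.sum_comm]
        simp only [Finset.sum_mul]
    _ ≤ ∑ B : Finset R with IsHeavy B, A ^ (Fintype.card R + 1) * (δ * K) := by
        refine Finset.sum_le_sum fun B hB => ?_
        exact mul_le_mul_of_nonneg_right (hcoef B (Finset.mem_filter.1 hB).2) (by positivity)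
    _ ≤ 2 ^ Fintype.card R * (A ^ (Fintype.card R + 1) * (δ * K)) := by
        rw [Finset.sum_const, nsmul_eq_mul]
        refine mul_le_mul_of_nonneg_right ?_ (by positivity)
        have := Finset.card_le_univ (Finset.univ.filter fun B : Finset R => IsHeavy B)
        rw [Fintype.card_finset] at this
        exact_mod_cast this
    _ = _ := by rw [heavyConst, ← hK]; ring

end HeavyBlocks

/-! ### Power kernels and sums of coefficients over time. -/

section Kernels

/-- The bracket `max 1 |j|` of an integer. -/
noncomputable def bracket (j : ℤ) : ℝ := max 1 |(j : ℝ)|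

lemma one_le_bracket (j : ℤ) : 1 ≤ bracket j := le_max_left _ _

lemma bracket_pos (j : ℤ) : 0 < bracket j := zero_lt_one.trans_le (one_le_bracket j)

lemma summable_bracket {b : ℝ} (hb : 1 < b) : Summable fun j : ℤ => bracket j ^ (-b) := by
  refine (summable_congr_cofinite ?_).1 (Real.summable_abs_int_rpow hb)
  have : ∀ᶠ j : ℤ in cofinite, j ≠ 0 := (Set.finite_singleton (0 : ℤ)).compl_mem_cofinite
  filter_upwards [this] with j hj
  rw [bracket, max_eq_right]
  exact_mod_cast Int.one_le_abs hj

/-- The sum of the powers `bracket j ^ (-(1 + ε))`. -/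
noncomputable def bracketSum (ε : ℝ) : ℝ := ∑' j : ℤ, bracket j ^ (-(1 + ε))

lemma sum_bracket_le {ι : Type*} {ε : ℝ} (hε : 0 < ε) (F : Finset ι) {f : ι → ℤ}
    (hf : Function.Injective f) : ∑ x ∈ F, bracket (f x) ^ (-(1 + ε)) ≤ bracketSum ε := by
  classical
  rw [← Finset.sum_image (f := fun j => bracket j ^ (-(1 + ε))) (g := f) fun x _ y _ h => hf h]
  exact (summable_bracket (by linarith)).sum_le_tsum _
    fun j _ => Real.rpow_nonneg (bracket_pos j).le _

lemma bracketSum_nonneg (ε : ℝ) : 0 ≤ bracketSum ε :=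
  tsum_nonneg fun j => Real.rpow_nonneg (bracket_pos j).le _

lemma bracket_sub_le (i j : ℤ) : bracket (i - j) ≤ 2 * max (bracket i) (bracket j) := by
  have h1 := one_le_bracket i
  have hi : |(i : ℝ)| ≤ bracket i := le_max_right _ _
  have hj : |(j : ℝ)| ≤ bracket j := le_max_right _ _
  have h2 : bracket i ≤ max (bracket i) (bracket j) := le_max_left _ _
  have h3 : bracket j ≤ max (bracket i) (bracket j) := le_max_right _ _
  rw [bracket]
  refine max_le (by linarith) ?_
  push_cast
  have := abs_sub (i : ℝ) j
  linarith

/-- The power of the maximum is absorbed by the larger variable, which keeps a nonpositive exponent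
and may therefore be replaced by the smaller variable. -/
lemma rpow_max_mul_le {x y β σ τ : ℝ} (hx : 1 ≤ x) (hy : 1 ≤ y) (hσ : β ≤ σ) (hτ : β ≤ τ) :
    max x y ^ β * (x ^ (-σ) * y ^ (-τ)) ≤ x ^ (-(σ + τ - β)) + y ^ (-(σ + τ - β)) := by
  have hx0 : 0 < x := by linarith
  have hy0 : 0 < y := by linarith
  rcases le_total x y with h | h
  · rw [max_eq_right h]
    have h1 : y ^ (-(τ - β)) ≤ x ^ (-(τ - β)) :=
      Real.rpow_le_rpow_of_nonpos hx0 h (by linarith)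
    calc y ^ β * (x ^ (-σ) * y ^ (-τ)) = x ^ (-σ) * y ^ (-(τ - β)) := by
          rw [show -(τ - β) = β + -τ by ring, Real.rpow_add hy0]; ring
      _ ≤ x ^ (-σ) * x ^ (-(τ - β)) := mul_le_mul_of_nonneg_left h1 (by positivity)
      _ = x ^ (-(σ + τ - β)) := by rw [← Real.rpow_add hx0]; congr 1; ring
      _ ≤ _ := by linarith [Real.rpow_pos_of_pos hy0 (-(σ + τ - β))]
  · rw [max_eq_left h]
    have h1 : x ^ (-(σ - β)) ≤ y ^ (-(σ - β)) :=
      Real.rpow_le_rpow_of_nonpos hy0 h (by linarith)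
    calc x ^ β * (x ^ (-σ) * y ^ (-τ)) = x ^ (-(σ - β)) * y ^ (-τ) := by
          rw [show -(σ - β) = β + -σ by ring, Real.rpow_add hx0]; ring
      _ ≤ y ^ (-(σ - β)) * y ^ (-τ) := mul_le_mul_of_nonneg_right h1 (by positivity)
      _ = y ^ (-(σ + τ - β)) := by rw [← Real.rpow_add hy0]; congr 1; ring
      _ ≤ _ := by linarith [Real.rpow_pos_of_pos hx0 (-(σ + τ - β))]

/-- Convolution of two power sequences. -/
lemma sum_bracket_conv_le {σ τ ε : ℝ} (hε : 0 < ε) (hβ : 0 ≤ σ + τ - 1 - ε) (hσ : σ ≤ 1 + ε)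
    (hτ : τ ≤ 1 + ε) (Λ : Finset ℤ) (k k' : ℤ) :
    ∑ l ∈ Λ, bracket (k - l) ^ (-σ) * bracket (k' - l) ^ (-τ) ≤
      2 ^ (σ + τ - 1 - ε) * (2 * bracketSum ε) * bracket (k - k') ^ (-(σ + τ - 1 - ε)) := by
  set β := σ + τ - 1 - ε with hβdef
  have hb : 0 < bracket (k - k') ^ β := Real.rpow_pos_of_pos (bracket_pos _) _
  rw [Real.rpow_neg (bracket_pos _).le, ← div_eq_mul_inv, le_div_iff₀ hb, Finset.sum_mul]
  calc ∑ l ∈ Λ, bracket (k - l) ^ (-σ) * bracket (k' - l) ^ (-τ) * bracket (k - k') ^ β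
      ≤ ∑ l ∈ Λ, 2 ^ β * (bracket (k - l) ^ (-(1 + ε)) + bracket (k' - l) ^ (-(1 + ε))) := by
        refine Finset.sum_le_sum fun l _ => ?_
        -- One of the two distances to `l` is at least half of the bracket of `k - k'`. Moving the
        -- power `β` to that distance leaves the summable exponent `-(1 + ε)`.
        have h1 : bracket (k - k') ≤ 2 * max (bracket (k - l)) (bracket (k' - l)) := by
          have := bracket_sub_le (k - l) (k' - l)
          rwa [sub_sub_sub_cancel_right] at this
        have h2 : bracket (k - k') ^ β ≤
            2 ^ β * max (bracket (k - l)) (bracket (k' - l)) ^ β := by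
          rw [← Real.mul_rpow (by norm_num) ((bracket_pos _).le.trans (le_max_left _ _))]
          exact Real.rpow_le_rpow (bracket_pos _).le h1 hβ
        have h3 := rpow_max_mul_le (β := β) (σ := σ) (τ := τ) (one_le_bracket (k - l))
          (one_le_bracket (k' - l)) (by linarith) (by linarith)
        rw [show σ + τ - β = 1 + ε by rw [hβdef]; ring] at h3
        have h4 : 0 ≤ bracket (k - l) ^ (-σ) * bracket (k' - l) ^ (-τ) :=
          mul_nonneg (Real.rpow_nonneg (bracket_pos _).le _) (Real.rpow_nonneg (bracket_pos _).le _)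
        calc _ ≤ bracket (k - l) ^ (-σ) * bracket (k' - l) ^ (-τ) *
              (2 ^ β * max (bracket (k - l)) (bracket (k' - l)) ^ β) :=
              mul_le_mul_of_nonneg_left h2 h4
          _ = 2 ^ β * (max (bracket (k - l)) (bracket (k' - l)) ^ β *
              (bracket (k - l) ^ (-σ) * bracket (k' - l) ^ (-τ))) := by ring
          _ ≤ _ := mul_le_mul_of_nonneg_left h3 (by positivity)
    _ ≤ 2 ^ β * (2 * bracketSum ε) := by
        rw [← Finset.mul_sum, Finset.sum_add_distrib, two_mul (bracketSum ε)]
        exact mul_le_mul_of_nonneg_left (add_le_add (sum_bracket_le hε Λ sub_right_injective)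
          (sum_bracket_le hε Λ sub_right_injective)) (by positivity)

/-- Double sums of a power kernel over a time interval. -/
lemma sum_sum_bracket_le {β ε : ℝ} (hε : 0 < ε) (hβ : β ≤ 1 + ε) {M : ℕ} (hM : 1 ≤ M) :
    ∑ k ∈ Finset.range M, ∑ k' ∈ Finset.range M, bracket ((k : ℤ) - k') ^ (-β) ≤
      bracketSum ε * (M : ℝ) ^ (2 + ε - β) := by
  have hM' : (1 : ℝ) ≤ M := by exact_mod_cast hM
  have h : ∀ k ∈ Finset.range M, ∑ k' ∈ Finset.range M, bracket ((k : ℤ) - k') ^ (-β) ≤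
      (M : ℝ) ^ (1 + ε - β) * bracketSum ε := by
    intro k hk
    calc _ ≤ ∑ k' ∈ Finset.range M,
          (M : ℝ) ^ (1 + ε - β) * bracket ((k : ℤ) - k') ^ (-(1 + ε)) := by
          refine Finset.sum_le_sum fun k' hk' => ?_
          -- Inside the interval all lags are at most `M`, so raising the decay to the summable
          -- exponent costs the factor `M ^ (1 + ε - β)`.
          have hb : bracket ((k : ℤ) - k') ≤ M := by
            rw [Finset.mem_range] at hk hk'
            refine max_le hM' ?_
            rw [abs_le]
            push_cast
            have h1 : (k : ℝ) ≤ M := by exact_mod_cast hk.le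
            have h2 : (k' : ℝ) ≤ M := by exact_mod_cast hk'.le
            have h3 : (0 : ℝ) ≤ k := by positivity
            have h4 : (0 : ℝ) ≤ k' := by positivity
            constructor <;> linarith
          calc bracket ((k : ℤ) - k') ^ (-β)
              = bracket ((k : ℤ) - k') ^ (1 + ε - β) * bracket ((k : ℤ) - k') ^ (-(1 + ε)) := by
                rw [← Real.rpow_add (bracket_pos _)]; congr 1; ring
            _ ≤ _ := mul_le_mul_of_nonneg_right
                (Real.rpow_le_rpow (bracket_pos _).le hb (by linarith))
                (Real.rpow_nonneg (bracket_pos _).le _)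
      _ ≤ _ := by
          rw [← Finset.mul_sum]
          exact mul_le_mul_of_nonneg_left (sum_bracket_le (f := fun k' : ℕ => (k : ℤ) - k') hε _
            fun x y hxy => by simpa using hxy) (by positivity)
  calc _ ≤ ∑ _k ∈ Finset.range M, (M : ℝ) ^ (1 + ε - β) * bracketSum ε := Finset.sum_le_sum h
    _ = bracketSum ε * ((M : ℝ) ^ (1 : ℝ) * (M : ℝ) ^ (1 + ε - β)) := by
        rw [Finset.sum_const, Finset.card_range, nsmul_eq_mul, Real.rpow_one]; ring
    _ = _ := by rw [← Real.rpow_add (by linarith)]; congr 2; ring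

variable {R : Type*} {c : R → ℤ → ℝ} {A : ℝ}

/-- All finite sums of squares of the coefficients are at most `A`. -/
def SquareBounded (c : R → ℤ → ℝ) (A : ℝ) : Prop := ∀ r (F : Finset ℤ), ∑ j ∈ F, c r j ^ 2 ≤ A

lemma SquareBounded.sum_comp (h : SquareBounded c A) {ι : Type*} (F : Finset ι) {f : ι → ℤ}
    (hf : Function.Injective f) (r : R) : ∑ x ∈ F, c r (f x) ^ 2 ≤ A := by
  classical
  rw [← Finset.sum_image (f := fun j => c r j ^ 2) (g := f) fun x _ y _ h => hf h]
  exact h r _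

lemma SquareBounded.sum_mul_comp (h : SquareBounded c A) {ι : Type*} (F : Finset ι) {f : ι → ℤ}
    (hf : Function.Injective f) (r r' : R) : ∑ x ∈ F, |c r (f x)| * |c r' (f x)| ≤ A := by
  calc ∑ x ∈ F, |c r (f x)| * |c r' (f x)| ≤ ∑ x ∈ F, (c r (f x) ^ 2 + c r' (f x) ^ 2) / 2 := by
        refine Finset.sum_le_sum fun x _ => ?_
        nlinarith [sq_nonneg (|c r (f x)| - |c r' (f x)|), sq_abs (c r (f x)),
          sq_abs (c r' (f x))]
    _ = (∑ x ∈ F, c r (f x) ^ 2 + ∑ x ∈ F, c r' (f x) ^ 2) / 2 := by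
        rw [← Finset.sum_div, Finset.sum_add_distrib]
    _ ≤ A := by linarith [h.sum_comp F hf r, h.sum_comp F hf r']

/-- For fixed `l` the factors with `k'` are summed over time first. The bound is uniform in `Λ` and
`M` and needs only square summability, so this part has no long memory. -/
lemma SquareBounded.sum_four (h : SquareBounded c A) (Λ : Finset ℤ) (k : ℤ) (M : ℕ)
    (i j i' j' : R) :
    ∑ k' ∈ Finset.range M, ∑ l ∈ Λ,
      |c i (k - l)| * |c j (k - l)| * |c i' (k' - l)| * |c j' (k' - l)| ≤ A * A := by
  have hA : 0 ≤ A := by simpa using h i ∅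
  rw [Finset.sum_comm]
  calc _ = ∑ l ∈ Λ, |c i (k - l)| * |c j (k - l)| *
        ∑ k' ∈ Finset.range M, |c i' (k' - l)| * |c j' (k' - l)| := by
        refine Finset.sum_congr rfl fun l _ => ?_
        rw [Finset.mul_sum]
        exact Finset.sum_congr rfl fun k' _ => by ring
    _ ≤ ∑ l ∈ Λ, |c i (k - l)| * |c j (k - l)| * A := by
        refine Finset.sum_le_sum fun l _ => mul_le_mul_of_nonneg_left ?_ (by positivity)
        exact h.sum_mul_comp _ (f := fun k' : ℕ => (k' : ℤ) - l)
          (fun x y hxy => by simpa using hxy) _ _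
    _ ≤ A * A := by
        rw [← Finset.sum_mul]
        exact mul_le_mul_of_nonneg_right
          (h.sum_mul_comp Λ (f := fun l => k - l) sub_right_injective _ _) hA

/-- The two factors that couple `k` with the other block's point are separated by xy ≤ (x² + y²)/2.
In each half one square can be summed on its own, and the other factors form pairs with a common
argument. -/
lemma SquareBounded.sum_six (h : SquareBounded c A) (Λ : Finset ℤ) (k : ℤ) (M : ℕ)
    (i j r' r i' j' : R) :
    ∑ k' ∈ Finset.range M, (∑ l ∈ Λ, |c i (k - l)| * |c j (k - l)| * |c r' (k' - l)|) *
      ∑ l ∈ Λ, |c r (k - l)| * |c i' (k' - l)| * |c j' (k' - l)| ≤ A * A * A := by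
  have hA : 0 ≤ A := by simpa using h i ∅
  have inj : ∀ l : ℤ, Function.Injective fun k' : ℕ => (k' : ℤ) - l :=
    fun l x y hxy => by simpa using hxy
  have inj' : ∀ k : ℤ, Function.Injective fun l : ℤ => k - l := fun k => sub_right_injective
  set u : ℤ → ℝ := fun l => |c i (k - l)| * |c j (k - l)| with hu
  set v : ℕ → ℤ → ℝ := fun k' l => |c i' (k' - l)| * |c j' (k' - l)| with hv
  have hu0 : ∀ l, 0 ≤ u l := fun l => by positivity
  have hv0 : ∀ k' l, 0 ≤ v k' l := fun k' l => by positivity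
  have e : ∀ k' ∈ Finset.range M,
      (∑ l ∈ Λ, |c i (k - l)| * |c j (k - l)| * |c r' (k' - l)|) *
        ∑ l ∈ Λ, |c r (k - l)| * |c i' (k' - l)| * |c j' (k' - l)| ≤
      (∑ l ∈ Λ, u l * c r' (k' - l) ^ 2) * (∑ l ∈ Λ, v k' l) / 2 +
        (∑ l ∈ Λ, u l) * (∑ l ∈ Λ, c r (k - l) ^ 2 * v k' l) / 2 := by
    intro k' _
    rw [Finset.sum_mul_sum, Finset.sum_mul_sum, Finset.sum_mul_sum, Finset.sum_div,
      Finset.sum_div, ← Finset.sum_add_distrib]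
    refine Finset.sum_le_sum fun l _ => ?_
    rw [Finset.sum_div, Finset.sum_div, ← Finset.sum_add_distrib]
    refine Finset.sum_le_sum fun l' _ => ?_
    have h1 : |c r' (k' - l)| * |c r (k - l')| ≤ (c r' (k' - l) ^ 2 + c r (k - l') ^ 2) / 2 := by
      nlinarith [sq_nonneg (|c r' (k' - l)| - |c r (k - l')|), sq_abs (c r' (k' - l)),
        sq_abs (c r (k - l'))]
    have h2 := mul_le_mul_of_nonneg_left h1 (mul_nonneg (hu0 l) (hv0 k' l'))
    calc _ = u l * v k' l' * (|c r' (k' - l)| * |c r (k - l')|) := by simp only [hu, hv]; ring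
      _ ≤ _ := h2
      _ = _ := by ring
  refine (Finset.sum_le_sum e).trans ?_
  rw [Finset.sum_add_distrib, ← Finset.sum_div, ← Finset.sum_div]
  have h1 : ∑ k' ∈ Finset.range M, (∑ l ∈ Λ, u l * c r' (k' - l) ^ 2) * (∑ l ∈ Λ, v k' l) ≤
      A * A * A := by
    calc _ ≤ ∑ k' ∈ Finset.range M, (∑ l ∈ Λ, u l * c r' (k' - l) ^ 2) * A := by
          refine Finset.sum_le_sum fun k' _ => mul_le_mul_of_nonneg_left
            (h.sum_mul_comp Λ (inj' k') _ _) (Finset.sum_nonneg fun l _ => by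
              have := hu0 l; positivity)
      _ = (∑ l ∈ Λ, u l * ∑ k' ∈ Finset.range M, c r' (k' - l) ^ 2) * A := by
          rw [← Finset.sum_mul, Finset.sum_comm]
          simp only [Finset.mul_sum]
      _ ≤ (∑ l ∈ Λ, u l * A) * A := by
          refine mul_le_mul_of_nonneg_right (Finset.sum_le_sum fun l _ => ?_) hA
          exact mul_le_mul_of_nonneg_left (h.sum_comp (Finset.range M) (inj l) r') (hu0 l)
      _ ≤ A * A * A := by
          rw [← Finset.sum_mul]
          exact mul_le_mul_of_nonneg_right (mul_le_mul_of_nonneg_right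
            (h.sum_mul_comp Λ (inj' k) _ _) hA) hA
  have h2 : ∑ k' ∈ Finset.range M, (∑ l ∈ Λ, u l) * (∑ l ∈ Λ, c r (k - l) ^ 2 * v k' l) ≤
      A * A * A := by
    rw [← Finset.mul_sum, Finset.sum_comm, mul_assoc A A A]
    refine mul_le_mul (h.sum_mul_comp Λ (inj' k) _ _) ?_ (Finset.sum_nonneg fun l _ =>
      Finset.sum_nonneg fun k' _ => mul_nonneg (sq_nonneg _) (hv0 k' l)) hA
    calc _ = ∑ l ∈ Λ, c r (k - l) ^ 2 * ∑ k' ∈ Finset.range M, v k' l := by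
          simp only [Finset.mul_sum]
      _ ≤ ∑ l ∈ Λ, c r (k - l) ^ 2 * A := by
          refine Finset.sum_le_sum fun l _ => mul_le_mul_of_nonneg_left ?_ (sq_nonneg _)
          exact h.sum_mul_comp (Finset.range M) (inj l) i' j'
      _ ≤ A * A := by
          rw [← Finset.sum_mul]
          exact mul_le_mul_of_nonneg_right (h.sum_comp Λ (inj' k) r) hA
  linarith

/-- The coefficients of the process at time `k`. -/
def coeffAt (c : R → ℤ → ℝ) (k : ℤ) (r : R) (l : ℤ) : ℝ := c r (k - l)

lemma SquareBounded.coeffAt (h : SquareBounded c A) (Λ : Finset ℤ) (k : ℤ) (r : R) :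
    ∑ l ∈ Λ, coeffAt c k r l ^ 2 ≤ A :=
  h.sum_comp Λ (f := fun l => k - l) sub_right_injective r

/-- The constant in the bound for the double sums of `centredKernel`. -/
def centredConst (n : ℕ) (A : ℝ) : ℝ := n ^ 4 * (A * A) + n ^ 6 * (A * A * A)

lemma SquareBounded.sum_centredKernel_le [Fintype R] (h : SquareBounded c A) (Λ : Finset ℤ)
    (M : ℕ) :
    ∑ k ∈ Finset.range M, ∑ k' ∈ Finset.range M,
      centredKernel Λ (ProductMSLLN.coeffAt c k) (ProductMSLLN.coeffAt c k') ≤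
      centredConst (Fintype.card R) A * M := by
  have h1 : ∀ k : ℕ, ∑ k' ∈ Finset.range M,
      centredKernel Λ (ProductMSLLN.coeffAt c k) (ProductMSLLN.coeffAt c k') ≤
        centredConst (Fintype.card R) A := by
    intro k
    simp only [centredKernel, ProductMSLLN.coeffAt]
    rw [Finset.sum_add_distrib, Finset.sum_comm, Finset.sum_comm (s := Finset.range M)]
    refine add_le_add ?_ ?_
    · refine (Finset.sum_le_sum fun p _ => h.sum_four Λ k M _ _ _ _).trans_eq ?_
      rw [Finset.sum_const, Finset.card_univ, nsmul_eq_mul]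
      simp only [Fintype.card_prod]
      push_cast; ring
    · refine (Finset.sum_le_sum fun p _ => h.sum_six Λ k M _ _ _ _ _ _).trans_eq ?_
      rw [Finset.sum_const, Finset.card_univ, nsmul_eq_mul]
      simp only [Fintype.card_prod]
      push_cast; ring
  refine (Finset.sum_le_sum fun k _ => h1 k).trans_eq ?_
  rw [Finset.sum_const, Finset.card_range, nsmul_eq_mul, mul_comm]

end Kernels

/-! ### A Rademacher–Menshov inequality. -/

section MaximalInequality

variable {Ω : Type*} [MeasurableSpace Ω] {μ : Measure Ω}

/-- The sum of the squares of the sums over all dyadic subintervals of `[0, 2 ^ N)`. -/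
def dyadicSq : ℕ → (ℕ → ℝ) → ℝ
  | 0, x => x 0 ^ 2
  | N + 1, x => dyadicSq N x + dyadicSq N (fun k => x (2 ^ N + k)) +
      (∑ k ∈ Finset.range (2 ^ (N + 1)), x k) ^ 2

lemma dyadicSq_nonneg (N : ℕ) (x : ℕ → ℝ) : 0 ≤ dyadicSq N x := by
  induction N generalizing x with
  | zero => exact sq_nonneg _
  | succ N ih =>
    rw [dyadicSq]
    have := ih x
    have := ih fun k => x (2 ^ N + k)
    positivity

lemma sq_sum_le_dyadicSq (N : ℕ) (x : ℕ → ℝ) :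
    (∑ k ∈ Finset.range (2 ^ N), x k) ^ 2 ≤ dyadicSq N x := by
  cases N with
  | zero => simp [dyadicSq]
  | succ N =>
    rw [dyadicSq]
    linarith [dyadicSq_nonneg N x, dyadicSq_nonneg N fun k => x (2 ^ N + k)]

/-- An initial segment is a union of at most `N + 1` disjoint dyadic intervals, one per level;
Cauchy–Schwarz over the levels gives the factor. -/
lemma sq_partial_sum_le_dyadicSq (N : ℕ) (x : ℕ → ℝ) {n : ℕ} (hn : n ≤ 2 ^ N) :
    (∑ k ∈ Finset.range n, x k) ^ 2 ≤ (N + 1) * dyadicSq N x := by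
  induction N generalizing x n with
  | zero =>
    have : n = 0 ∨ n = 1 := by simp at hn; omega
    rcases this with rfl | rfl
    · simpa [dyadicSq] using sq_nonneg _
    · simp [dyadicSq]
  | succ N ih =>
    have h1 := dyadicSq_nonneg N x
    have h2 := dyadicSq_nonneg N fun k => x (2 ^ N + k)
    have h3 := sq_sum_le_dyadicSq N x
    have hN : (0 : ℝ) ≤ N := by positivity
    have hD : dyadicSq N x + dyadicSq N (fun k => x (2 ^ N + k)) ≤ dyadicSq (N + 1) x := by
      rw [dyadicSq]
      linarith [sq_nonneg (∑ k ∈ Finset.range (2 ^ (N + 1)), x k)]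
    push_cast
    refine le_trans ?_ (mul_le_mul_of_nonneg_left hD (by positivity))
    rcases le_total n (2 ^ N) with h | h
    · have := ih x h
      nlinarith
    · obtain ⟨m, rfl⟩ := Nat.exists_eq_add_of_le h
      have hm : m ≤ 2 ^ N := by rw [pow_succ] at hn; omega
      have h4 := ih (fun k => x (2 ^ N + k)) hm
      rw [Finset.sum_range_add]
      set s := ∑ k ∈ Finset.range (2 ^ N), x k
      set t := ∑ k ∈ Finset.range m, x (2 ^ N + k)
      -- Cauchy–Schwarz with weights 1 and `N + 1`: the full half `s` is a single interval, while
      -- `t` already uses up to `N + 1` of them.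
      have h5 : ((N : ℝ) + 1) * (s + t) ^ 2 ≤ (N + 1) * ((N + 2) * s ^ 2) + (N + 2) * t ^ 2 := by
        nlinarith [sq_nonneg ((N + 1) * s - t)]
      have h6 : ((N : ℝ) + 2) * t ^ 2 ≤
          (N + 2) * ((N + 1) * dyadicSq N fun k => x (2 ^ N + k)) :=
        mul_le_mul_of_nonneg_left h4 (by linarith)
      have h7 : ((N : ℝ) + 1) * ((N + 2) * s ^ 2) ≤ (N + 1) * ((N + 2) * dyadicSq N x) := by
        gcongr
      have h8 : ((N : ℝ) + 1) * (s + t) ^ 2 ≤ (N + 1) * ((N + 1 + 1) *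
          (dyadicSq N x + dyadicSq N fun k => x (2 ^ N + k))) := by nlinarith
      exact le_of_mul_le_mul_left h8 (by linarith)

lemma integral_sq_sum_le {X : ℕ → Ω → ℝ} {κ : ℕ → ℕ → ℝ}
    (hX : ∀ k k', Integrable (fun ω => X k ω * X k' ω) μ)
    (hκ : ∀ k k', ∫ ω, X k ω * X k' ω ∂μ ≤ κ k k') (n : ℕ) :
    Integrable (fun ω => (∑ k ∈ Finset.range n, X k ω) ^ 2) μ ∧
    ∫ ω, (∑ k ∈ Finset.range n, X k ω) ^ 2 ∂μ ≤
      ∑ k ∈ Finset.range n, ∑ k' ∈ Finset.range n, κ k k' := by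
  simp only [pow_two, Finset.sum_mul_sum]
  refine ⟨integrable_finsetSum _ fun k _ => integrable_finsetSum _ fun k' _ => hX k k', ?_⟩
  rw [integral_finsetSum _ fun k _ => integrable_finsetSum _ fun k' _ => hX k k']
  refine Finset.sum_le_sum fun k _ => ?_
  rw [integral_finsetSum _ fun k' _ => hX k k']
  exact Finset.sum_le_sum fun k' _ => hκ k k'

/-- The squares over the dyadic intervals of one level are disjoint, so by nonnegativity of `κ` each
of the `N + 1` levels costs at most the full double sum. -/
lemma integral_dyadicSq_le {X : ℕ → Ω → ℝ} {κ : ℕ → ℕ → ℝ} (hκ0 : ∀ k k', 0 ≤ κ k k')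
    (hX : ∀ k k', Integrable (fun ω => X k ω * X k' ω) μ)
    (hκ : ∀ k k', ∫ ω, X k ω * X k' ω ∂μ ≤ κ k k') (N : ℕ) :
    Integrable (fun ω => dyadicSq N fun k => X k ω) μ ∧
    ∫ ω, dyadicSq N (fun k => X k ω) ∂μ ≤
      (N + 1) * ∑ k ∈ Finset.range (2 ^ N), ∑ k' ∈ Finset.range (2 ^ N), κ k k' := by
  induction N generalizing X κ with
  | zero =>
    simp only [dyadicSq, pow_two]
    exact ⟨hX 0 0, by simpa using hκ 0 0⟩
  | succ N ih =>
    obtain ⟨i1, b1⟩ := ih hκ0 hX hκ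
    obtain ⟨i2, b2⟩ := ih (X := fun k => X (2 ^ N + k)) (κ := fun k k' => κ (2 ^ N + k) (2 ^ N + k'))
      (fun _ _ => hκ0 _ _) (fun _ _ => hX _ _) (fun _ _ => hκ _ _)
    obtain ⟨i3, b3⟩ := integral_sq_sum_le hX hκ (2 ^ (N + 1))
    simp only [dyadicSq]
    refine ⟨(i1.add i2).add i3, ?_⟩
    have heq := integral_add (i1.add i2) i3
    rw [integral_add' i1 i2] at heq
    refine heq.trans_le ?_
    have hsub : ∑ k ∈ Finset.range (2 ^ N), ∑ k' ∈ Finset.range (2 ^ N), κ k k' +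
        ∑ k ∈ Finset.range (2 ^ N), ∑ k' ∈ Finset.range (2 ^ N), κ (2 ^ N + k) (2 ^ N + k') ≤
        ∑ k ∈ Finset.range (2 ^ (N + 1)), ∑ k' ∈ Finset.range (2 ^ (N + 1)), κ k k' := by
      rw [pow_succ, mul_two, Finset.sum_range_add]
      refine add_le_add (Finset.sum_le_sum fun k _ => ?_) (Finset.sum_le_sum fun k _ => ?_)
      · rw [Finset.sum_range_add]
        linarith [Finset.sum_nonneg fun k' (_ : k' ∈ Finset.range (2 ^ N)) => hκ0 k (2 ^ N + k')]
      · rw [Finset.sum_range_add]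
        linarith [Finset.sum_nonneg fun k' (_ : k' ∈ Finset.range (2 ^ N)) => hκ0 (2 ^ N + k) k']
    have hN : (0 : ℝ) ≤ N + 1 := by positivity
    have := mul_le_mul_of_nonneg_left hsub hN
    push_cast
    linarith

/-- A Rademacher–Menshov maximal inequality in probability. -/
theorem measureReal_max_partial_sum_le [IsFiniteMeasure μ] {X : ℕ → Ω → ℝ} {κ : ℕ → ℕ → ℝ}
    (hκ0 : ∀ k k', 0 ≤ κ k k')
    (hX : ∀ k k', Integrable (fun ω => X k ω * X k' ω) μ)
    (hκ : ∀ k k', ∫ ω, X k ω * X k' ω ∂μ ≤ κ k k') (N : ℕ) {t : ℝ} (ht : 0 < t) :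
    μ.real {ω | ∃ n ≤ 2 ^ N, t ≤ |∑ k ∈ Finset.range n, X k ω|} ≤
      (N + 1) ^ 2 * (∑ k ∈ Finset.range (2 ^ N), ∑ k' ∈ Finset.range (2 ^ N), κ k k') / t ^ 2 := by
  obtain ⟨hi, hb⟩ := integral_dyadicSq_le hκ0 hX hκ N
  have h1 : {ω | ∃ n ≤ 2 ^ N, t ≤ |∑ k ∈ Finset.range n, X k ω|} ⊆
      {ω | t ^ 2 ≤ (N + 1) * dyadicSq N fun k => X k ω} := by
    rintro ω ⟨n, hn, htn⟩
    refine le_trans ?_ (sq_partial_sum_le_dyadicSq N (fun k => X k ω) hn)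
    rw [← sq_abs (∑ k ∈ Finset.range n, X k ω)]
    exact pow_le_pow_left₀ ht.le htn 2
  have h2 := mul_meas_ge_le_integral_of_nonneg (μ := μ)
    (Eventually.of_forall fun ω => mul_nonneg (by positivity : (0 : ℝ) ≤ N + 1)
      (dyadicSq_nonneg N fun k => X k ω)) (hi.const_mul _) (t ^ 2)
  rw [integral_const_mul] at h2
  rw [le_div_iff₀ (by positivity), mul_comm]
  calc _ ≤ t ^ 2 * μ.real {ω | t ^ 2 ≤ (N + 1) * dyadicSq N fun k => X k ω} :=
        mul_le_mul_of_nonneg_left (measureReal_mono h1) (by positivity)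
    _ ≤ (N + 1) * ∫ ω, dyadicSq N (fun k => X k ω) ∂μ := h2
    _ ≤ (N + 1) * ((N + 1) *
          ∑ k ∈ Finset.range (2 ^ N), ∑ k' ∈ Finset.range (2 ^ N), κ k k') :=
        mul_le_mul_of_nonneg_left hb (by positivity)
    _ = _ := by ring

end MaximalInequality

/-! ### Truncation of real numbers. -/

section Truncation

/-- The part of a number below a level. -/
noncomputable def truncLow (u y : ℝ) : ℝ := if |y| ≤ u then y else 0

/-- The part of a number above a level. -/
noncomputable def truncHigh (u y : ℝ) : ℝ := if |y| ≤ u then 0 else y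

lemma truncLow_add_truncHigh (u y : ℝ) : truncLow u y + truncHigh u y = y := by
  unfold truncLow truncHigh; split_ifs <;> simp

lemma measurable_truncLow (u : ℝ) : Measurable (truncLow u) :=
  Measurable.ite (measurableSet_le measurable_abs measurable_const) measurable_id measurable_const

lemma measurable_truncHigh (u : ℝ) : Measurable (truncHigh u) :=
  Measurable.ite (measurableSet_le measurable_abs measurable_const) measurable_const measurable_id

/-- Write y² = |y|^(2-q) |y|^q and use |y| ≤ u in the first factor; zero is separate because powers
add only for a positive base. -/
lemma truncLow_sq_le {u q : ℝ} (hu : 0 < u) (hq : q ≤ 2) (y : ℝ) :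
    truncLow u y ^ 2 ≤ u ^ (2 - q) * |y| ^ q := by
  unfold truncLow
  split_ifs with h
  · rcases eq_or_ne y 0 with rfl | hy
    · simp only [ne_eq, OfNat.ofNat_ne_zero, not_false_eq_true, zero_pow]
      positivity
    · have hy' : 0 < |y| := abs_pos.2 hy
      calc y ^ 2 = |y| ^ (2 - q) * |y| ^ q := by
            rw [← Real.rpow_add hy', ← sq_abs]; simp
        _ ≤ _ := mul_le_mul_of_nonneg_right (Real.rpow_le_rpow hy'.le h (by linarith))
            (by positivity)
  · simp only [ne_eq, OfNat.ofNat_ne_zero, not_false_eq_true, zero_pow]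
    positivity

/-- Write |y| = |y|^(1-q) |y|^q; the first exponent is nonpositive and |y| > u. -/
lemma abs_truncHigh_le {u q : ℝ} (hu : 0 < u) (hq : 1 ≤ q) (y : ℝ) :
    |truncHigh u y| ≤ u ^ (1 - q) * |y| ^ q := by
  unfold truncHigh
  split_ifs with h
  · rw [abs_zero]; positivity
  · rw [not_le] at h
    have hy' : 0 < |y| := hu.trans h
    calc |y| = |y| ^ (1 - q) * |y| ^ q := by rw [← Real.rpow_add hy']; simp
      _ ≤ _ := mul_le_mul_of_nonneg_right
          (Real.rpow_le_rpow_of_nonpos hu h.le (by linarith)) (by positivity)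

lemma abs_le_one_add_rpow {q : ℝ} (hq : 1 ≤ q) (y : ℝ) : |y| ≤ 1 + |y| ^ q := by
  rcases le_total |y| 1 with h | h
  · linarith [Real.rpow_nonneg (abs_nonneg y) q]
  · have := Real.rpow_le_rpow_of_exponent_le h hq
    rw [Real.rpow_one] at this
    linarith

end Truncation

/-! ### The three parts of a heavy block product. -/

section Families

variable {Ω R : Type*} [MeasurableSpace Ω] {μ : Measure Ω} [Fintype R]

/-- Bounds for the moments of order `q` of the products over heavy blocks. -/
structure HasHeavyMoments (μ : Measure Ω) (ξ : ℤ → Ω → (R → ℝ)) (q K : ℝ) : Prop where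
  integrable : ∀ B : Finset R, IsHeavy B → Integrable (fun ω => |monomial id B (ξ 1 ω)| ^ q) μ
  integral_le : ∀ B : Finset R, IsHeavy B → ∫ ω, |monomial id B (ξ 1 ω)| ^ q ∂μ ≤ K

open Classical in
/-- Heavy block products are replaced by their means. -/
noncomputable def lightFamily (μ : Measure Ω) (ξ : ℤ → Ω → (R → ℝ)) (B : Finset R) (x : R → ℝ) : ℝ :=
  if IsHeavy B then ∫ ω, monomial id B (ξ 1 ω) ∂μ else monomial id B x

open Classical in
/-- Heavy block products are truncated at level `u`, centred, and divided by `τ`. -/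
noncomputable def lowFamily (μ : Measure Ω) (ξ : ℤ → Ω → (R → ℝ)) (u τ : ℝ) (B : Finset R)
    (x : R → ℝ) : ℝ :=
  if IsHeavy B then
    (truncLow u (monomial id B x) - ∫ ω, truncLow u (monomial id B (ξ 1 ω)) ∂μ) / τ
  else monomial id B x

open Classical in
/-- Heavy block products are replaced by their parts above level `u`, centred. -/
noncomputable def highFamily (μ : Measure Ω) (ξ : ℤ → Ω → (R → ℝ)) (u : ℝ) (B : Finset R)
    (x : R → ℝ) : ℝ :=
  if IsHeavy B then
    truncHigh u (monomial id B x) - ∫ ω, truncHigh u (monomial id B (ξ 1 ω)) ∂μ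
  else monomial id B x

variable [DecidableEq R]

lemma measurable_lightFamily (μ : Measure Ω) (ξ : ℤ → Ω → (R → ℝ)) (B : Finset R) :
    Measurable (lightFamily μ ξ B) := by
  unfold lightFamily
  split_ifs
  exacts [measurable_const, measurable_monomial _ _]

lemma measurable_lowFamily (μ : Measure Ω) (ξ : ℤ → Ω → (R → ℝ)) (u τ : ℝ) (B : Finset R) :
    Measurable (lowFamily μ ξ u τ B) := by
  unfold lowFamily
  split_ifs
  exacts [(((measurable_truncLow u).comp (measurable_monomial _ _)).sub_const _).div_const _,
    measurable_monomial _ _]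

lemma measurable_highFamily (μ : Measure Ω) (ξ : ℤ → Ω → (R → ℝ)) (u : ℝ) (B : Finset R) :
    Measurable (highFamily μ ξ u B) := by
  unfold highFamily
  split_ifs
  exacts [((measurable_truncHigh u).comp (measurable_monomial _ _)).sub_const _,
    measurable_monomial _ _]

variable [IsProbabilityMeasure μ] {ξ : ℤ → Ω → (R → ℝ)} {V q K : ℝ}

lemma HasHeavyMoments.integrable_monomial (h : HasHeavyMoments μ ξ q K) (hξ : IsIID μ ξ)
    (hq : 1 ≤ q) {B : Finset R} (hB : IsHeavy B) :
    Integrable (fun ω => monomial id B (ξ 1 ω)) μ := by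
  refine ((integrable_const (1 : ℝ)).add (h.integrable B hB)).mono'
    ((measurable_monomial id B).comp (hξ.measurable 1)).aestronglyMeasurable
    (Eventually.of_forall fun ω => ?_)
  exact abs_le_one_add_rpow hq _

lemma HasHeavyMoments.abs_integral_le (h : HasHeavyMoments μ ξ q K) (hξ : IsIID μ ξ)
    (hq : 1 ≤ q) {B : Finset R} (hB : IsHeavy B) :
    |∫ ω, monomial id B (ξ 1 ω) ∂μ| ≤ 1 + K := by
  refine abs_integral_le_integral_abs.trans ?_
  calc ∫ ω, |monomial id B (ξ 1 ω)| ∂μ ≤ ∫ ω, (1 + |monomial id B (ξ 1 ω)| ^ q) ∂μ :=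
        integral_mono (h.integrable_monomial hξ hq hB).abs
          ((integrable_const 1).add (h.integrable B hB)) fun ω => abs_le_one_add_rpow hq _
    _ = 1 + ∫ ω, |monomial id B (ξ 1 ω)| ^ q ∂μ := by
        rw [integral_add (integrable_const 1) (h.integrable B hB)]; simp
    _ ≤ 1 + K := by linarith [h.integral_le B hB]

lemma isBlockFamily_lightFamily (hl : HasLightMoments μ ξ V) (hh : HasHeavyMoments μ ξ q K)
    (hξ : IsIID μ ξ) (hq : 1 ≤ q) : IsBlockFamily μ ξ (lightFamily μ ξ) (V + (1 + K) ^ 2) where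
  measurable := measurable_lightFamily μ ξ
  empty x := by simp [lightFamily, not_isHeavy_empty, monomial]
  memLp B := by
    by_cases hB : IsHeavy B
    · simp only [lightFamily, hB, if_true]
      exact memLp_const _
    · simp only [lightFamily, hB, if_false]
      exact hl.memLp B hB
  integral_sq_le B := by
    by_cases hB : IsHeavy B
    · simp only [lightFamily, hB, if_true, integral_const, probReal_univ, one_smul]
      have := pow_le_pow_left₀ (abs_nonneg _) (hh.abs_integral_le hξ hq hB) 2
      rw [sq_abs] at this
      linarith [hl.one_le]
    · simp only [lightFamily, hB, if_false]
      linarith [hl.integral_sq_le B hB, sq_nonneg (1 + K)]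

lemma blockMean_lightFamily (B : Finset R) :
    blockMean μ ξ (lightFamily μ ξ) B = ∫ ω, monomial id B (ξ 1 ω) ∂μ := by
  by_cases hB : IsHeavy B <;> simp [blockMean, lightFamily, hB]

lemma blockMean_singleton_of_light {η : Finset R → (R → ℝ) → ℝ} (hl : HasLightMoments μ ξ V)
    (hη : ∀ B, ¬ IsHeavy B → η B = monomial id B) (r : R) : blockMean μ ξ η {r} = 0 := by
  rw [blockMean, hη _ (not_isHeavy_of_card_le_one (by simp))]
  simpa [monomial] using hl.mean_zero r

lemma lightFamily_of_light {B : Finset R} (hB : ¬ IsHeavy B) :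
    lightFamily μ ξ B = monomial id B := by
  ext x; simp [lightFamily, hB]

lemma lowFamily_of_light (u τ : ℝ) {B : Finset R} (hB : ¬ IsHeavy B) :
    lowFamily μ ξ u τ B = monomial id B := by
  ext x; simp [lowFamily, hB]

lemma highFamily_of_light (u : ℝ) {B : Finset R} (hB : ¬ IsHeavy B) :
    highFamily μ ξ u B = monomial id B := by
  ext x; simp [highFamily, hB]

lemma memLp_truncLow (hξ : IsIID μ ξ) (u : ℝ) (B : Finset R) :
    MemLp (fun ω => truncLow u (monomial id B (ξ 1 ω))) 2 μ := by
  refine MemLp.of_bound (((measurable_truncLow u).comp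
    (measurable_monomial id B)).comp (hξ.measurable 1)).aestronglyMeasurable |u|
    (Eventually.of_forall fun ω => ?_)
  rw [Real.norm_eq_abs, truncLow]
  split_ifs with h
  · exact h.trans (le_abs_self u)
  · simp

lemma integrable_truncHigh (hξ : IsIID μ ξ) (hh : HasHeavyMoments μ ξ q K) (hq : 1 ≤ q) {u : ℝ}
    {B : Finset R} (hB : IsHeavy B) :
    Integrable (fun ω => truncHigh u (monomial id B (ξ 1 ω))) μ := by
  refine (hh.integrable_monomial hξ hq hB).mono (((measurable_truncHigh u).comp
    (measurable_monomial id B)).comp (hξ.measurable 1)).aestronglyMeasurable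
    (Eventually.of_forall fun ω => ?_)
  rw [Real.norm_eq_abs, Real.norm_eq_abs, truncHigh]
  split_ifs
  · simp
  · exact le_rfl

lemma integral_centred_sq_le {f : Ω → ℝ} (hf : MemLp f 2 μ) :
    ∫ ω, (f ω - ∫ ω', f ω' ∂μ) ^ 2 ∂μ ≤ ∫ ω, f ω ^ 2 ∂μ := by
  have h1 := variance_le_expectation_sq (X := f) (μ := μ) hf.aestronglyMeasurable
  rw [variance_eq_integral hf.aestronglyMeasurable.aemeasurable] at h1
  exact h1

/-- The truncated heavy product has second moment at most `u ^ (2 - q) * K`, so division by the root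
of that power gives a bound independent of `u`. As a monomial has one heavy block, the divisor
reappears exactly once in `chaos_split`. -/
lemma isBlockFamily_lowFamily (hl : HasLightMoments μ ξ V) (hh : HasHeavyMoments μ ξ q K)
    (hξ : IsIID μ ξ) (hq : q ≤ 2) (hK : 0 ≤ K) {u : ℝ} (hu : 0 < u) :
    IsBlockFamily μ ξ (lowFamily μ ξ u (Real.sqrt (u ^ (2 - q)))) (V + (1 + K) ^ 2) where
  measurable := measurable_lowFamily μ ξ _ _
  empty x := by simp [lowFamily, not_isHeavy_empty, monomial]
  memLp B := by
    by_cases hB : IsHeavy B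
    · simp only [lowFamily, hB, if_true, div_eq_mul_inv]
      exact ((memLp_truncLow hξ u B).sub (memLp_const _)).mul_const _
    · simp only [lowFamily, hB, if_false]
      exact hl.memLp B hB
  integral_sq_le B := by
    have hτ : 0 < u ^ (2 - q) := Real.rpow_pos_of_pos hu _
    by_cases hB : IsHeavy B
    · simp only [lowFamily, hB, if_true, div_pow, Real.sq_sqrt hτ.le]
      rw [integral_div, div_le_iff₀ hτ]
      refine (integral_centred_sq_le (memLp_truncLow hξ u B)).trans ?_
      calc ∫ ω, truncLow u (monomial id B (ξ 1 ω)) ^ 2 ∂μ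
          ≤ ∫ ω, u ^ (2 - q) * |monomial id B (ξ 1 ω)| ^ q ∂μ :=
            integral_mono (memLp_truncLow hξ u B).integrable_sq
              ((hh.integrable B hB).const_mul _) fun ω => truncLow_sq_le hu hq _
        _ ≤ u ^ (2 - q) * K := by
            rw [integral_const_mul]
            exact mul_le_mul_of_nonneg_left (hh.integral_le B hB) hτ.le
        _ ≤ _ := by
            rw [mul_comm]
            refine mul_le_mul_of_nonneg_right ?_ hτ.le
            nlinarith [hl.one_le]
    · simp only [lowFamily, hB, if_false]
      linarith [hl.integral_sq_le B hB, sq_nonneg (1 + K)]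

lemma blockMean_lowFamily (hξ : IsIID μ ξ) (u τ : ℝ) {B : Finset R} (hB : IsHeavy B) :
    blockMean μ ξ (lowFamily μ ξ u τ) B = 0 := by
  simp only [blockMean, lowFamily, hB, if_true]
  rw [integral_div, integral_sub ((memLp_truncLow hξ u B).integrable (by norm_num))
    (integrable_const _)]
  simp

lemma highFamily_bound (hh : HasHeavyMoments μ ξ q K)
    (hξ : IsIID μ ξ) (hq : 1 ≤ q) {u : ℝ} (hu : 0 < u) {B : Finset R} (hB : IsHeavy B) :
    Integrable (fun ω => highFamily μ ξ u B (ξ 1 ω)) μ ∧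
    ∫ ω, |highFamily μ ξ u B (ξ 1 ω)| ∂μ ≤ 2 * (u ^ (1 - q) * K) := by
  have hi := integrable_truncHigh hξ hh hq (u := u) hB
  have hb : ∫ ω, |truncHigh u (monomial id B (ξ 1 ω))| ∂μ ≤ u ^ (1 - q) * K := by
    calc _ ≤ ∫ ω, u ^ (1 - q) * |monomial id B (ξ 1 ω)| ^ q ∂μ :=
          integral_mono hi.abs ((hh.integrable B hB).const_mul _)
            fun ω => abs_truncHigh_le hu hq _
      _ ≤ _ := by
          rw [integral_const_mul]
          exact mul_le_mul_of_nonneg_left (hh.integral_le B hB) (by positivity)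
  simp only [highFamily, hB, if_true]
  refine ⟨hi.sub (integrable_const _), ?_⟩
  calc _ ≤ ∫ ω, (|truncHigh u (monomial id B (ξ 1 ω))| +
        |∫ ω', truncHigh u (monomial id B (ξ 1 ω')) ∂μ|) ∂μ :=
        integral_mono (hi.sub (integrable_const _)).abs
          (hi.abs.add (integrable_const _)) fun ω => abs_sub _ _
    _ = ∫ ω, |truncHigh u (monomial id B (ξ 1 ω))| ∂μ +
        |∫ ω', truncHigh u (monomial id B (ξ 1 ω')) ∂μ| := by
        rw [integral_add hi.abs (integrable_const _)]; simp
    _ ≤ _ := by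
        have := abs_integral_le_integral_abs (μ := μ)
          (f := fun ω => truncHigh u (monomial id B (ξ 1 ω)))
        linarith

lemma monomial_split (hξ : IsIID μ ξ) (hh : HasHeavyMoments μ ξ q K) (hq : 1 ≤ q) {u τ : ℝ}
    (hτ : τ ≠ 0) {B : Finset R} (hB : IsHeavy B) (x : R → ℝ) :
    monomial id B x = lightFamily μ ξ B x + τ * lowFamily μ ξ u τ B x + highFamily μ ξ u B x := by
  simp only [lightFamily, lowFamily, highFamily, hB, if_true]
  have h1 : ∫ ω, monomial id B (ξ 1 ω) ∂μ = ∫ ω, truncLow u (monomial id B (ξ 1 ω)) ∂μ +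
      ∫ ω, truncHigh u (monomial id B (ξ 1 ω)) ∂μ := by
    rw [← integral_add ((memLp_truncLow hξ u B).integrable (by norm_num))
      (integrable_truncHigh hξ hh hq hB)]
    simp only [truncLow_add_truncHigh]
  rw [h1, mul_div_cancel₀ _ hτ]
  linarith [truncLow_add_truncHigh u (monomial id B x)]

end Families

/-! ### The maximal inequality for products over a finite window. -/

section MaximalBound

variable {Ω R : Type*} [MeasurableSpace Ω] {μ : Measure Ω} [IsProbabilityMeasure μ]

lemma integral_centred_mul {X Y : Ω → ℝ} (hX : Integrable X μ) (hY : Integrable Y μ)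
    (hXY : Integrable (fun ω => X ω * Y ω) μ) :
    Integrable (fun ω => (X ω - ∫ ω', X ω' ∂μ) * (Y ω - ∫ ω', Y ω' ∂μ)) μ ∧
    ∫ ω, (X ω - ∫ ω', X ω' ∂μ) * (Y ω - ∫ ω', Y ω' ∂μ) ∂μ =
      ∫ ω, X ω * Y ω ∂μ - (∫ ω, X ω ∂μ) * ∫ ω, Y ω ∂μ := by
  have e : ∀ ω, (X ω - ∫ ω', X ω' ∂μ) * (Y ω - ∫ ω', Y ω' ∂μ) =
      X ω * Y ω - X ω * (∫ ω', Y ω' ∂μ) - ((∫ ω', X ω' ∂μ) * Y ω -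
        (∫ ω', X ω' ∂μ) * ∫ ω', Y ω' ∂μ) := fun ω => by ring
  simp only [e]
  have i1 := hX.mul_const (∫ ω', Y ω' ∂μ)
  have i2 := hY.const_mul (∫ ω', X ω' ∂μ)
  have i3 := integrable_const (μ := μ) ((∫ ω', X ω' ∂μ) * ∫ ω', Y ω' ∂μ)
  refine ⟨(hXY.sub i1).sub (i2.sub i3), ?_⟩
  have h := integral_sub (hXY.sub i1) (i2.sub i3)
  rw [integral_sub' hXY i1, integral_sub' i2 i3, integral_mul_const, integral_const_mul] at h
  refine h.trans ?_
  simp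

/-- The maximal inequality for centred square integrable variables. -/
lemma measureReal_max_centred_le {X : ℕ → Ω → ℝ} {κ : ℕ → ℕ → ℝ} (hX : ∀ k, Integrable (X k) μ)
    (hXX : ∀ k k', Integrable (fun ω => X k ω * X k' ω) μ)
    (hκ : ∀ k k', |∫ ω, X k ω * X k' ω ∂μ - (∫ ω, X k ω ∂μ) * ∫ ω, X k' ω ∂μ| ≤ κ k k')
    (N : ℕ) {t : ℝ} (ht : 0 < t) :
    μ.real {ω | ∃ n ≤ 2 ^ N, t ≤ |∑ k ∈ Finset.range n, (X k ω - ∫ ω', X k ω' ∂μ)|} ≤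
      (N + 1) ^ 2 * (∑ k ∈ Finset.range (2 ^ N), ∑ k' ∈ Finset.range (2 ^ N), κ k k') / t ^ 2 :=
  measureReal_max_partial_sum_le (X := fun k ω => X k ω - ∫ ω', X k ω' ∂μ)
    (fun k k' => (abs_nonneg _).trans (hκ k k'))
    (fun k k' => (integral_centred_mul (hX k) (hX k') (hXX k k')).1)
    (fun k k' => by
      rw [(integral_centred_mul (hX k) (hX k') (hXX k k')).2]
      exact (le_abs_self _).trans (hκ k k')) N ht

/-- The maximal inequality for integrable variables which follows from the triangle inequality. -/
lemma measureReal_max_integrable_le {X : ℕ → Ω → ℝ} {δ : ℝ} (hX : ∀ k, Integrable (X k) μ)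
    (hδ : ∀ k, ∫ ω, |X k ω| ∂μ ≤ δ) (M : ℕ) {t : ℝ} (ht : 0 < t) :
    μ.real {ω | ∃ n ≤ M, t ≤ |∑ k ∈ Finset.range n, (X k ω - ∫ ω', X k ω' ∂μ)|} ≤
      M * (2 * δ) / t := by
  have hi : ∀ k, Integrable (fun ω => |X k ω - ∫ ω', X k ω' ∂μ|) μ :=
    fun k => ((hX k).sub (integrable_const _)).abs
  have h1 : {ω | ∃ n ≤ M, t ≤ |∑ k ∈ Finset.range n, (X k ω - ∫ ω', X k ω' ∂μ)|} ⊆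
      {ω | t ≤ ∑ k ∈ Finset.range M, |X k ω - ∫ ω', X k ω' ∂μ|} := by
    rintro ω ⟨n, hn, h⟩
    refine h.trans ((Finset.abs_sum_le_sum_abs _ _).trans ?_)
    exact Finset.sum_le_sum_of_subset_of_nonneg (Finset.range_mono hn) fun _ _ _ => abs_nonneg _
  have h2 := mul_meas_ge_le_integral_of_nonneg (μ := μ)
    (Eventually.of_forall fun ω => Finset.sum_nonneg
      fun k (_ : k ∈ Finset.range M) => abs_nonneg (X k ω - ∫ ω', X k ω' ∂μ))
    (integrable_finsetSum _ fun k _ => hi k) t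
  rw [integral_finsetSum _ fun k _ => hi k] at h2
  have h3 : ∀ k, ∫ ω, |X k ω - ∫ ω', X k ω' ∂μ| ∂μ ≤ 2 * δ := by
    intro k
    calc _ ≤ ∫ ω, (|X k ω| + |∫ ω', X k ω' ∂μ|) ∂μ :=
          integral_mono (hi k) ((hX k).abs.add (integrable_const _)) fun ω => abs_sub _ _
      _ = ∫ ω, |X k ω| ∂μ + |∫ ω', X k ω' ∂μ| := by
          rw [integral_add (hX k).abs (integrable_const _)]; simp
      _ ≤ 2 * δ := by linarith [hδ k, abs_integral_le_integral_abs (μ := μ) (f := X k)]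
  have h4 : ∑ k ∈ Finset.range M, ∫ ω, |X k ω - ∫ ω', X k ω' ∂μ| ∂μ ≤ M * (2 * δ) := by
    refine (Finset.sum_le_sum fun k _ => h3 k).trans_eq ?_
    rw [Finset.sum_const, Finset.card_range, nsmul_eq_mul]
  rw [le_div_iff₀ ht, mul_comm]
  exact (mul_le_mul_of_nonneg_left (measureReal_mono h1) ht.le).trans (h2.trans h4)

lemma measureReal_max_add_three_le {X Y Z W : ℕ → Ω → ℝ} (h : ∀ k ω, X k ω = Y k ω + Z k ω + W k ω)
    (M : ℕ) (t : ℝ) :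
    μ.real {ω | ∃ n ≤ M, 3 * t ≤ |∑ k ∈ Finset.range n, X k ω|} ≤
      μ.real {ω | ∃ n ≤ M, t ≤ |∑ k ∈ Finset.range n, Y k ω|} +
      μ.real {ω | ∃ n ≤ M, t ≤ |∑ k ∈ Finset.range n, Z k ω|} +
      μ.real {ω | ∃ n ≤ M, t ≤ |∑ k ∈ Finset.range n, W k ω|} := by
  refine le_trans (measureReal_mono ?_) ((measureReal_union_le _ _).trans
    (add_le_add (measureReal_union_le _ _) le_rfl))
  rintro ω ⟨n, hn, h1⟩
  simp only [h, Finset.sum_add_distrib] at h1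
  by_contra hc
  simp only [Set.mem_union, Set.mem_ofPred_eq, not_or, not_exists, not_and, not_le] at hc
  have h2 := hc.1.1 n hn
  have h3 := hc.1.2 n hn
  have h4 := hc.2 n hn
  have := abs_add_three (∑ k ∈ Finset.range n, Y k ω) (∑ k ∈ Finset.range n, Z k ω)
    (∑ k ∈ Finset.range n, W k ω)
  linarith

variable [Fintype R] [DecidableEq R] {ξ : ℤ → Ω → (R → ℝ)} {V q K A : ℝ} {c : R → ℤ → ℝ}

/-- The product process with finitely many innovations. -/
def finiteProduct (ξ : ℤ → Ω → (R → ℝ)) (Λ : Finset ℤ) (a : R → ℤ → ℝ) (ω : Ω) : ℝ :=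
  ∏ r, ∑ l ∈ Λ, a r l * ξ l ω r

lemma finiteProduct_eq (hh : HasHeavyMoments μ ξ q K) (hξ : IsIID μ ξ) (hq : 1 ≤ q) {u τ : ℝ}
    (hτ : τ ≠ 0) (Λ : Finset ℤ) (a : R → ℤ → ℝ) (ω : Ω) :
    finiteProduct ξ Λ a ω = chaos ξ Λ (fun _ => True) (lightFamily μ ξ) a ω +
      τ * chaos ξ Λ (HasHeavyFiber Λ) (lowFamily μ ξ u τ) a ω +
      chaos ξ Λ (HasHeavyFiber Λ) (highFamily μ ξ u) a ω := by
  rw [finiteProduct]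
  refine (prod_sum_eq_chaos id Λ ξ a ω).trans (chaos_split ξ Λ a τ ?_ ?_ ω)
  · intro B hB
    rw [lightFamily_of_light hB, lowFamily_of_light _ _ hB, highFamily_of_light _ hB]
    exact ⟨rfl, rfl, rfl⟩
  · exact fun B hB x => monomial_split hξ hh hq hτ hB x

/-- The covariance of the light parts of two products. -/
noncomputable def lightCov (μ : Measure Ω) (ξ : ℤ → Ω → (R → ℝ)) (Λ : Finset ℤ)
    (a b : R → ℤ → ℝ) : ℝ :=
  |∫ ω, chaos ξ Λ (fun _ => True) (lightFamily μ ξ) a ω *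
      chaos ξ Λ (fun _ => True) (lightFamily μ ξ) b ω ∂μ -
    (∫ ω, chaos ξ Λ (fun _ => True) (lightFamily μ ξ) a ω ∂μ) *
      ∫ ω, chaos ξ Λ (fun _ => True) (lightFamily μ ξ) b ω ∂μ|

/-- The maximal inequality for products with finitely many innovations. -/
theorem measureReal_max_finiteProduct_le (hl : HasLightMoments μ ξ V)
    (hh : HasHeavyMoments μ ξ q K) (hξ : IsIID μ ξ) (hq1 : 1 < q) (hq2 : q ≤ 2) (hK : 0 ≤ K)
    (hA : 1 ≤ A) (hc : SquareBounded c A) (Λ : Finset ℤ) (N : ℕ) {t : ℝ} (ht : 0 < t) :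
    μ.real {ω | ∃ n ≤ 2 ^ N, 3 * t ≤ |∑ k ∈ Finset.range n,
        (finiteProduct ξ Λ (coeffAt c k) ω - ∫ ω', finiteProduct ξ Λ (coeffAt c k) ω' ∂μ)|} ≤
      (N + 1) ^ 2 * (∑ k ∈ Finset.range (2 ^ N), ∑ k' ∈ Finset.range (2 ^ N),
        lightCov μ ξ Λ (coeffAt c k) (coeffAt c k')) / t ^ 2 +
      (N + 1) ^ 2 * (chaosConst (Fintype.card R) (V + (1 + K) ^ 2) A *
        centredConst (Fintype.card R) A * ((2 : ℝ) ^ N) ^ (2 / q)) / t ^ 2 +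
      4 * heavyConst (Fintype.card R) V A * K * ((2 : ℝ) ^ N) ^ (1 / q) / t := by
  set M : ℝ := (2 : ℝ) ^ N with hM
  have hM0 : 0 < M := by positivity
  -- This level balances the parts: the low part has variance of order `u ^ (2 - q) * M = M ^ (2 /
  -- q)`, and the high part has first moment of order `M * u ^ (1 - q) = M ^ (1 / q)`.
  set u : ℝ := M ^ (1 / q) with hu
  have hu0 : 0 < u := Real.rpow_pos_of_pos hM0 _
  set τ : ℝ := Real.sqrt (u ^ (2 - q)) with hτ
  have hτ0 : 0 < τ := Real.sqrt_pos.2 (Real.rpow_pos_of_pos hu0 _)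
  have hτ2 : τ ^ 2 = u ^ (2 - q) := Real.sq_sqrt (Real.rpow_nonneg hu0.le _)
  set Y : ℕ → Ω → ℝ := fun k => chaos ξ Λ (fun _ => True) (lightFamily μ ξ) (coeffAt c k) with hY
  set Z : ℕ → Ω → ℝ := fun k => chaos ξ Λ (HasHeavyFiber Λ) (lowFamily μ ξ u τ) (coeffAt c k)
    with hZ
  set W : ℕ → Ω → ℝ := fun k => chaos ξ Λ (HasHeavyFiber Λ) (highFamily μ ξ u) (coeffAt c k)
    with hW
  have fY := isBlockFamily_lightFamily hl hh hξ hq1.le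
  have fZ := isBlockFamily_lowFamily hl hh hξ hq2 hK hu0
  have ha : ∀ (k : ℕ) r, ∑ l ∈ Λ, coeffAt c k r l ^ 2 ≤ A := fun k r => hc.coeffAt Λ k r
  have iY : ∀ k, Integrable (Y k) μ := fun k => (integral_chaos hξ fY.measurable fY.integrable).1
  have iZ : ∀ k, Integrable (Z k) μ := fun k => (integral_chaos hξ fZ.measurable fZ.integrable).1
  have bW : ∀ k, Integrable (W k) μ ∧ ∫ ω, |W k ω| ∂μ ≤
      heavyConst (Fintype.card R) V A * (2 * (u ^ (1 - q) * K)) := fun k =>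
    integral_abs_chaos_heavy_le hl hξ hA (ha k) (fun B hB => highFamily_of_light u hB)
      (measurable_highFamily μ ξ u) (by positivity)
      (fun B hB => (highFamily_bound hh hξ hq1.le hu0 hB).1)
      (fun B hB => (highFamily_bound hh hξ hq1.le hu0 hB).2)
  have iτZ : ∀ k, Integrable (fun ω => τ * Z k ω) μ := fun k => (iZ k).const_mul _
  have hsplit : ∀ k ω, finiteProduct ξ Λ (coeffAt c (k : ℕ)) ω = Y k ω + τ * Z k ω + W k ω :=
    fun k ω => finiteProduct_eq hh hξ hq1.le hτ0.ne' Λ _ ω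
  have hmean : ∀ k : ℕ, ∫ ω, finiteProduct ξ Λ (coeffAt c k) ω ∂μ =
      ∫ ω, Y k ω ∂μ + ∫ ω, τ * Z k ω ∂μ + ∫ ω, W k ω ∂μ := by
    intro k
    simp only [hsplit]
    have h1 := integral_add ((iY k).add (iτZ k)) (bW k).1
    rw [integral_add' (iY k) (iτZ k)] at h1
    exact h1
  refine (measureReal_max_add_three_le (Y := fun k ω => Y k ω - ∫ ω', Y k ω' ∂μ)
    (Z := fun k ω => τ * Z k ω - ∫ ω', τ * Z k ω' ∂μ)
    (W := fun k ω => W k ω - ∫ ω', W k ω' ∂μ) (fun k ω => ?_) (2 ^ N) t).trans ?_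
  · rw [hsplit, hmean]; ring
  refine add_le_add (add_le_add ?_ ?_) ?_
  · exact measureReal_max_centred_le iY (fun k k' => (integral_chaos_mul hξ fY).1)
      (fun k k' => le_rfl) N ht
  · have h1 := measureReal_max_centred_le (X := fun k ω => τ * Z k ω)
      (κ := fun k k' => τ ^ 2 * (chaosConst (Fintype.card R) (V + (1 + K) ^ 2) A *
        centredKernel Λ (coeffAt c k) (coeffAt c k'))) iτZ ?_ ?_ N ht
    · refine h1.trans ?_
      refine div_le_div_of_nonneg_right (mul_le_mul_of_nonneg_left ?_ (by positivity))
        (by positivity)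
      simp only [← Finset.mul_sum]
      have h2 := hc.sum_centredKernel_le Λ (2 ^ N)
      have h3 : 0 ≤ chaosConst (Fintype.card R) (V + (1 + K) ^ 2) A :=
        chaosConst_nonneg _ (zero_le_one.trans fY.one_le) (zero_le_one.trans hA)
      calc _ ≤ τ ^ 2 * (chaosConst (Fintype.card R) (V + (1 + K) ^ 2) A *
            (centredConst (Fintype.card R) A * ((2 ^ N : ℕ) : ℝ))) :=
            mul_le_mul_of_nonneg_left (mul_le_mul_of_nonneg_left h2 h3) (by positivity)
        _ = chaosConst (Fintype.card R) (V + (1 + K) ^ 2) A *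
            centredConst (Fintype.card R) A * (u ^ (2 - q) * M) := by
            rw [hτ2]; push_cast; ring
        _ = _ := by
            congr 1
            rw [hu, ← Real.rpow_mul hM0.le]
            nth_rewrite 2 [← Real.rpow_one M]
            rw [← Real.rpow_add hM0]
            congr 1
            field_simp
            ring
    · intro k k'
      have h2 := (integral_chaos_mul (Λ := Λ) (Q := HasHeavyFiber Λ) (a := coeffAt c k)
        (b := coeffAt c k') hξ fZ).1.const_mul (τ ^ 2)
      refine h2.congr (Eventually.of_forall fun ω => ?_)
      simp only [hZ]; ring
    · intro k k'
      have h2 := abs_chaos_cov_le_centred (Q := HasHeavyFiber Λ) (H := IsHeavy) hA (ha k) (ha k')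
        hξ fZ (blockMean_singleton_of_light hl fun B hB => lowFamily_of_light _ _ hB)
        (fun B hB => ⟨blockMean_lowFamily hξ _ _ hB, hB.two_le⟩) (fun g hg => hg)
      have h3 : ∫ ω, τ * Z k ω * (τ * Z k' ω) ∂μ -
          (∫ ω, τ * Z k ω ∂μ) * ∫ ω, τ * Z k' ω ∂μ =
          τ ^ 2 * (∫ ω, Z k ω * Z k' ω ∂μ - (∫ ω, Z k ω ∂μ) * ∫ ω, Z k' ω ∂μ) := by
        rw [integral_const_mul, integral_const_mul, mul_sub, ← integral_const_mul (τ ^ 2)]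
        congr 1
        · exact integral_congr_ae (Eventually.of_forall fun ω => by simp only; ring)
        · ring
      rw [h3, abs_mul, abs_of_nonneg (sq_nonneg τ)]
      exact mul_le_mul_of_nonneg_left h2 (sq_nonneg τ)
  · refine (measureReal_max_integrable_le (fun k => (bW k).1) (fun k => (bW k).2) (2 ^ N)
      ht).trans_eq ?_
    congr 1
    have : ((2 ^ N : ℕ) : ℝ) * u ^ (1 - q) = u := by
      push_cast
      rw [← hM, hu, ← Real.rpow_mul hM0.le]
      nth_rewrite 1 [← Real.rpow_one M]
      rw [← Real.rpow_add hM0]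
      congr 1
      field_simp
      ring
    linear_combination (4 * heavyConst (Fintype.card R) V A * K) * this

end MaximalBound

/-! ### Covariance sums of the light part under power decay. -/

section LightCovariances

variable {Ω R : Type*} [MeasurableSpace Ω] {μ : Measure Ω} [IsProbabilityMeasure μ]
  {c : R → ℤ → ℝ} {σ : R → ℝ} {κ ε : ℝ}

/-- The coefficients decay like powers. -/
def PowerBounded (c : R → ℤ → ℝ) (κ : ℝ) (σ : R → ℝ) : Prop :=
  ∀ r j, |c r j| ≤ κ * bracket j ^ (-σ r)

lemma PowerBounded.exists_squareBounded [Fintype R] (hσ : ∀ r, 1 / 2 < σ r) (κ : ℝ) :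
    ∃ A, 1 ≤ A ∧ ∀ c : R → ℤ → ℝ, PowerBounded c κ σ → SquareBounded c A := by
  refine ⟨1 + ∑ r, κ ^ 2 * bracketSum (2 * σ r - 1), ?_, fun c hc r F => ?_⟩
  · have := Finset.sum_nonneg fun r (_ : r ∈ Finset.univ) =>
      mul_nonneg (sq_nonneg κ) (bracketSum_nonneg (2 * σ r - 1))
    linarith
  · calc ∑ j ∈ F, c r j ^ 2 ≤ ∑ j ∈ F, κ ^ 2 * bracket j ^ (-(1 + (2 * σ r - 1))) := by
          refine Finset.sum_le_sum fun j _ => ?_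
          have h1 := pow_le_pow_left₀ (abs_nonneg _) (hc r j) 2
          rw [sq_abs, mul_pow, ← Real.rpow_natCast (bracket j ^ (-σ r)),
            ← Real.rpow_mul (bracket_pos j).le] at h1
          refine h1.trans_eq ?_
          congr 2
          push_cast; ring
      _ ≤ κ ^ 2 * bracketSum (2 * σ r - 1) := by
          rw [← Finset.mul_sum]
          exact mul_le_mul_of_nonneg_left (sum_bracket_le (f := fun j => j)
            (by linarith [hσ r]) F Function.injective_id) (sq_nonneg κ)
      _ ≤ _ := by
          have := Finset.single_le_sum (f := fun r => κ ^ 2 * bracketSum (2 * σ r - 1))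
            (fun r _ => mul_nonneg (sq_nonneg κ) (bracketSum_nonneg _)) (Finset.mem_univ r)
          linarith

lemma PowerBounded.pairSum_le (h : PowerBounded c κ σ) (hσ1 : ∀ r, σ r ≤ 1) (hε : 0 < ε) {r r' : R}
    (hβ : 0 ≤ σ r + σ r' - 1 - ε) (Λ : Finset ℤ) (k k' : ℤ) :
    pairSum Λ (coeffAt c k r) (coeffAt c k' r') ≤
      κ ^ 2 * (4 * bracketSum ε) * bracket (k - k') ^ (-(σ r + σ r' - 1 - ε)) := by
  have hb : 0 ≤ bracket (k - k') ^ (-(σ r + σ r' - 1 - ε)) := Real.rpow_nonneg (bracket_pos _).le _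
  calc pairSum Λ (coeffAt c k r) (coeffAt c k' r')
      ≤ ∑ l ∈ Λ, κ ^ 2 * (bracket (k - l) ^ (-σ r) * bracket (k' - l) ^ (-σ r')) := by
        refine Finset.sum_le_sum fun l _ => ?_
        refine (mul_le_mul (h r (k - l)) (h r' (k' - l)) (abs_nonneg _)
          ((abs_nonneg _).trans (h r (k - l)))).trans_eq ?_
        ring
    _ ≤ κ ^ 2 * (2 ^ (σ r + σ r' - 1 - ε) * (2 * bracketSum ε) *
          bracket (k - k') ^ (-(σ r + σ r' - 1 - ε))) := by
        rw [← Finset.mul_sum]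
        exact mul_le_mul_of_nonneg_left (sum_bracket_conv_le hε hβ (by linarith [hσ1 r])
          (by linarith [hσ1 r']) Λ k k') (sq_nonneg κ)
    _ ≤ κ ^ 2 * (2 * (2 * bracketSum ε) * bracket (k - k') ^ (-(σ r + σ r' - 1 - ε))) := by
        have h2 : (2 : ℝ) ^ (σ r + σ r' - 1 - ε) ≤ 2 := by
          have := Real.rpow_le_rpow_of_exponent_le (x := 2) (by norm_num)
            (show σ r + σ r' - 1 - ε ≤ 1 by linarith [hσ1 r, hσ1 r'])
          rwa [Real.rpow_one] at this
        have := bracketSum_nonneg ε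
        gcongr
    _ = _ := by ring

lemma bracket_rpow_anti (j : ℤ) {b b' : ℝ} (h : b ≤ b') : bracket j ^ (-b') ≤ bracket j ^ (-b) :=
  Real.rpow_le_rpow_of_exponent_le (one_le_bracket j) (by linarith)

variable [Fintype R] [DecidableEq R] {ξ : ℤ → Ω → (R → ℝ)} {V A : ℝ}

/-- One shared pair gives decay `2 * σ₀ - 1 - ε` in the lag, and the double sum over a block
subtracts this from `2 + ε`. -/
lemma sum_lightCov_le_of_pair (hξ : IsIID μ ξ)
    (hη : IsBlockFamily μ ξ (lightFamily μ ξ) V)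
    (h1 : ∀ r, blockMean μ ξ (lightFamily μ ξ) {r} = 0) (hA : 1 ≤ A) (hc : SquareBounded c A)
    (hp : PowerBounded c κ σ) (hσ1 : ∀ r, σ r ≤ 1) (hε : 0 < ε) {σ₀ : ℝ} (hσ₀ : ∀ r, σ₀ ≤ σ r)
    (hσ₀1 : σ₀ ≤ 1) (hβ : 0 ≤ 2 * σ₀ - 1 - ε) (Λ : Finset ℤ) {M : ℕ} (hM : 1 ≤ M) :
    ∑ k ∈ Finset.range M, ∑ k' ∈ Finset.range M, lightCov μ ξ Λ (coeffAt c k) (coeffAt c k') ≤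
      chaosConst (Fintype.card R) V A * (Fintype.card R ^ 2 * (κ ^ 2 * (4 * bracketSum ε))) *
        bracketSum ε * (M : ℝ) ^ (3 - 2 * σ₀ + 2 * ε) := by
  have hC : 0 ≤ chaosConst (Fintype.card R) V A :=
    chaosConst_nonneg _ (zero_le_one.trans hη.one_le) (zero_le_one.trans hA)
  have hS := bracketSum_nonneg ε
  have h2 : ∀ k k' : ℕ, lightCov μ ξ Λ (coeffAt c k) (coeffAt c k') ≤
      chaosConst (Fintype.card R) V A * (Fintype.card R ^ 2 * (κ ^ 2 * (4 * bracketSum ε))) *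
        bracket ((k : ℤ) - k') ^ (-(2 * σ₀ - 1 - ε)) := by
    intro k k'
    refine (abs_chaos_cov_le_pair hA (fun r => hc.coeffAt Λ k r) (fun r => hc.coeffAt Λ k' r)
      hξ hη h1).trans ?_
    rw [mul_assoc]
    refine mul_le_mul_of_nonneg_left ?_ hC
    calc _ ≤ ∑ _p : R × R, κ ^ 2 * (4 * bracketSum ε) *
          bracket ((k : ℤ) - k') ^ (-(2 * σ₀ - 1 - ε)) := by
          refine Finset.sum_le_sum fun p _ => ?_
          have h3 := hσ₀ p.1
          have h4 := hσ₀ p.2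
          refine (hp.pairSum_le hσ1 hε (by linarith) Λ k k').trans ?_
          exact mul_le_mul_of_nonneg_left (bracket_rpow_anti _ (by linarith)) (by positivity)
      _ = _ := by
          rw [Finset.sum_const, Finset.card_univ, nsmul_eq_mul, Fintype.card_prod]
          push_cast; ring
  refine (Finset.sum_le_sum fun k _ => Finset.sum_le_sum fun k' _ => h2 k k').trans ?_
  simp only [← Finset.mul_sum]
  rw [mul_assoc _ (bracketSum ε)]
  refine mul_le_mul_of_nonneg_left ?_ (by positivity)
  refine (sum_sum_bracket_le hε (by linarith) hM).trans_eq ?_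
  congr 2; ring

/-- Two shared pairs use two distinct indices from each monomial, so the decay rates add up to at
least `2 * τ - 2 - 2 * ε`. The exponent `β` is capped at 1, as faster decay cannot bring a double
sum below order `M`. -/
lemma sum_lightCov_le_of_two_pairs (hξ : IsIID μ ξ)
    (hη : IsBlockFamily μ ξ (lightFamily μ ξ) V)
    (hodd : ∀ B : Finset R, Odd B.card → blockMean μ ξ (lightFamily μ ξ) B = 0)
    (hR : Even (Fintype.card R)) (hA : 1 ≤ A) (hc : SquareBounded c A)
    (hp : PowerBounded c κ σ) (hσ1 : ∀ r, σ r ≤ 1) (hε : 0 < ε)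
    (hσε : ∀ r r', 0 ≤ σ r + σ r' - 1 - ε) {β τ : ℝ} (hτ : ∀ i j, i ≠ j → τ ≤ σ i + σ j)
    (hβ1 : β ≤ 1) (hβ : β ≤ 2 * τ - 2 - 2 * ε) (Λ : Finset ℤ) {M : ℕ} (hM : 1 ≤ M) :
    ∑ k ∈ Finset.range M, ∑ k' ∈ Finset.range M, lightCov μ ξ Λ (coeffAt c k) (coeffAt c k') ≤
      chaosConst (Fintype.card R) V A *
        (Fintype.card R ^ 4 * (κ ^ 2 * (4 * bracketSum ε)) ^ 2) *
        bracketSum ε * (M : ℝ) ^ (2 + ε - β) := by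
  classical
  have hC : 0 ≤ chaosConst (Fintype.card R) V A :=
    chaosConst_nonneg _ (zero_le_one.trans hη.one_le) (zero_le_one.trans hA)
  have hS := bracketSum_nonneg ε
  have h2 : ∀ k k' : ℕ, lightCov μ ξ Λ (coeffAt c k) (coeffAt c k') ≤
      chaosConst (Fintype.card R) V A *
        (Fintype.card R ^ 4 * (κ ^ 2 * (4 * bracketSum ε)) ^ 2) *
        bracket ((k : ℤ) - k') ^ (-β) := by
    intro k k'
    have hb : 0 ≤ bracket ((k : ℤ) - k') ^ (-β) := Real.rpow_nonneg (bracket_pos _).le _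
    refine (abs_chaos_cov_le_two_pairs hA (fun r => hc.coeffAt Λ k r)
      (fun r => hc.coeffAt Λ k' r) hξ hη hodd hR).trans ?_
    rw [mul_assoc]
    refine mul_le_mul_of_nonneg_left ?_ hC
    calc _ ≤ ∑ p : (R × R) × (R × R) with p.1.1 ≠ p.1.2 ∧ p.2.1 ≠ p.2.2,
          (κ ^ 2 * (4 * bracketSum ε)) ^ 2 * bracket ((k : ℤ) - k') ^ (-β) := by
          refine Finset.sum_le_sum fun p hp' => ?_
          rw [Finset.mem_filter] at hp'
          have h3 := hτ _ _ hp'.2.1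
          have h4 := hτ _ _ hp'.2.2
          refine (mul_le_mul (hp.pairSum_le hσ1 hε (hσε _ _) Λ k k')
            (hp.pairSum_le hσ1 hε (hσε _ _) Λ k k') (pairSum_nonneg _ _ _)
            (mul_nonneg (by positivity) (Real.rpow_nonneg (bracket_pos _).le _))).trans ?_
          rw [mul_mul_mul_comm, ← Real.rpow_add (bracket_pos _), ← pow_two, ← neg_add]
          exact mul_le_mul_of_nonneg_left (bracket_rpow_anti _ (by linarith)) (by positivity)
      _ ≤ ∑ _p : (R × R) × (R × R),
          (κ ^ 2 * (4 * bracketSum ε)) ^ 2 * bracket ((k : ℤ) - k') ^ (-β) :=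
          Finset.sum_le_sum_of_subset_of_nonneg (Finset.filter_subset _ _)
            fun _ _ _ => by positivity
      _ = _ := by
          rw [Finset.sum_const, Finset.card_univ, nsmul_eq_mul]
          simp only [Fintype.card_prod]
          push_cast; ring
  refine (Finset.sum_le_sum fun k _ => Finset.sum_le_sum fun k' _ => h2 k k').trans ?_
  simp only [← Finset.mul_sum]
  rw [mul_assoc _ (bracketSum ε)]
  refine mul_le_mul_of_nonneg_left ?_ (by positivity)
  exact sum_sum_bracket_le hε (by linarith) hM

end LightCovariances

/-! ### A uniform first moment bound. -/

section FirstMoment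

variable {Ω R : Type*} [MeasurableSpace Ω] {μ : Measure Ω} [IsProbabilityMeasure μ]
  [Fintype R] [DecidableEq R] {ξ : ℤ → Ω → (R → ℝ)} {V q K A : ℝ}

/-- A first moment bound for products of linear forms with square bounded coefficients. -/
theorem integral_abs_finiteProduct_le (hl : HasLightMoments μ ξ V)
    (hh : HasHeavyMoments μ ξ q K) (hξ : IsIID μ ξ) (hq1 : 1 < q) (hq2 : q ≤ 2) (hK : 0 ≤ K)
    (hA : 1 ≤ A) {Λ : Finset ℤ} {a : R → ℤ → ℝ} (ha : ∀ r, ∑ l ∈ Λ, a r l ^ 2 ≤ A) :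
    Integrable (finiteProduct ξ Λ a) μ ∧
      ∫ ω, |finiteProduct ξ Λ a ω| ∂μ ≤ 1 + (chaosConst (Fintype.card R) (V + (1 + K) ^ 2) A +
        chaosConst (Fintype.card R) (V + (1 + K) ^ 2) A) +
        heavyConst (Fintype.card R) V A * (2 * K) := by
  have fY := isBlockFamily_lightFamily hl hh hξ hq1.le
  -- Any fixed level works here; level 1 makes the normalising factor equal to 1.
  have fZ := isBlockFamily_lowFamily hl hh hξ hq2 hK one_pos
  rw [Real.one_rpow, Real.sqrt_one] at fZ
  set Y := chaos ξ Λ (fun _ => True) (lightFamily μ ξ) a with hY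
  set Z := chaos ξ Λ (HasHeavyFiber Λ) (lowFamily μ ξ 1 1) a with hZ
  set W := chaos ξ Λ (HasHeavyFiber Λ) (highFamily μ ξ 1) a with hW
  have bW : Integrable W μ ∧ ∫ ω, |W ω| ∂μ ≤ heavyConst (Fintype.card R) V A * (2 * K) :=
    integral_abs_chaos_heavy_le hl hξ hA ha (fun B hB => highFamily_of_light 1 hB)
      (measurable_highFamily μ ξ 1) (by positivity)
      (fun B hB => (highFamily_bound hh hξ hq1.le one_pos hB).1)
      (fun B hB => by simpa using (highFamily_bound hh hξ hq1.le one_pos hB).2)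
  have iY : Integrable Y μ := (integral_chaos hξ fY.measurable fY.integrable).1
  have iZ : Integrable Z μ := (integral_chaos hξ fZ.measurable fZ.integrable).1
  have sY : Integrable (fun ω => Y ω ^ 2) μ := by
    simpa only [pow_two] using (integral_chaos_mul (a := a) (b := a) hξ fY).1
  have sZ : Integrable (fun ω => Z ω ^ 2) μ := by
    simpa only [pow_two] using (integral_chaos_mul (a := a) (b := a) hξ fZ).1
  have bY : ∫ ω, Y ω ^ 2 ∂μ ≤ chaosConst (Fintype.card R) (V + (1 + K) ^ 2) A :=
    integral_chaos_sq_le hA ha hξ fY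
      (blockMean_singleton_of_light hl fun B hB => lightFamily_of_light hB)
  have bZ : ∫ ω, Z ω ^ 2 ∂μ ≤ chaosConst (Fintype.card R) (V + (1 + K) ^ 2) A :=
    integral_chaos_sq_le hA ha hξ fZ
      (blockMean_singleton_of_light hl fun B hB => lowFamily_of_light _ _ hB)
  have hsplit : finiteProduct ξ Λ a = fun ω => Y ω + Z ω + W ω := by
    ext ω
    rw [finiteProduct_eq hh hξ hq1.le (u := 1) one_ne_zero, one_mul]
  have hint : Integrable (finiteProduct ξ Λ a) μ := by
    rw [hsplit]; exact (iY.add iZ).add bW.1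
  refine ⟨hint, ?_⟩
  have iS : Integrable (fun ω => Y ω ^ 2 + Z ω ^ 2) μ := sY.add sZ
  have iS' : Integrable (fun ω => 1 + (Y ω ^ 2 + Z ω ^ 2)) μ := (integrable_const 1).add iS
  calc ∫ ω, |finiteProduct ξ Λ a ω| ∂μ
      ≤ ∫ ω, (1 + (Y ω ^ 2 + Z ω ^ 2) + |W ω|) ∂μ := by
        refine integral_mono hint.abs (iS'.add bW.1.abs) fun ω => ?_
        simp only
        rw [hsplit]
        have h1 := abs_add_three (Y ω) (Z ω) (W ω)
        nlinarith [sq_nonneg (|Y ω| - 1 / 2), sq_nonneg (|Z ω| - 1 / 2), sq_abs (Y ω),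
          sq_abs (Z ω)]
    _ = 1 + (∫ ω, Y ω ^ 2 ∂μ + ∫ ω, Z ω ^ 2 ∂μ) + ∫ ω, |W ω| ∂μ := by
        rw [integral_add iS' bW.1.abs, integral_add (integrable_const 1) iS, integral_add sY sZ]
        simp
    _ ≤ _ := by linarith [bW.2]

end FirstMoment

/-! ### Almost sure convergence of the linear series. -/

section RandomSeries

variable {Ω : Type*} [MeasurableSpace Ω] {μ : Measure Ω} [IsProbabilityMeasure μ]

/-- A series of independent centred variables with summable variances converges almost surely. -/
theorem ae_exists_tendsto_sum_range {Y : ℕ → Ω → ℝ} {C : ℝ} (hm : ∀ i, Measurable (Y i))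
    (hY : iIndepFun Y μ) (h2 : ∀ i, MemLp (Y i) 2 μ) (h0 : ∀ i, ∫ ω, Y i ω ∂μ = 0)
    (hC : ∀ n, ∑ i ∈ Finset.range n, ∫ ω, Y i ω ^ 2 ∂μ ≤ C) :
    ∀ᵐ ω ∂μ, ∃ y, Tendsto (fun n => ∑ i ∈ Finset.range n, Y i ω) atTop (𝓝 y) := by
  have hsm : ∀ i, StronglyMeasurable (Y i) := fun i => (hm i).stronglyMeasurable
  have hi : ∀ i, Integrable (Y i) μ := fun i => (h2 i).integrable (by norm_num)
  -- The sum includes `Y n`, in step with the natural filtration at time `n`.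
  set S : ℕ → Ω → ℝ := fun n => ∑ i ∈ Finset.range (n + 1), Y i with hS
  have hmart : Martingale S (Filtration.natural Y hsm) μ := by
    refine martingale_nat (fun n => ?_) (fun n => integrable_finsetSum' _ fun i _ => hi i)
      fun n => ?_
    · refine Finset.stronglyMeasurable_sum _ fun i hin => ?_
      exact (Filtration.stronglyAdapted_natural hsm i).mono
        ((Filtration.natural Y hsm).mono (Nat.lt_succ_iff.1 (Finset.mem_range.1 hin)))
    · have e : S (n + 1) = S n + Y (n + 1) := Finset.sum_range_succ _ _
      rw [e]
      have h1 := condExp_add (integrable_finsetSum' (Finset.range (n + 1)) fun i _ => hi i)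
        (hi (n + 1)) (Filtration.natural Y hsm n)
      have h3 := hY.condExp_natural_ae_eq_of_lt hsm (Nat.lt_succ_self n)
      have h4 : μ[S n | Filtration.natural Y hsm n] = S n :=
        condExp_of_stronglyMeasurable _ (Finset.stronglyMeasurable_sum _ fun i hin =>
          (Filtration.stronglyAdapted_natural hsm i).mono
          ((Filtration.natural Y hsm).mono (Nat.lt_succ_iff.1 (Finset.mem_range.1 hin))))
          (integrable_finsetSum' _ fun i _ => hi i)
      filter_upwards [h1, h3] with ω h1 h3
      rw [h1, Pi.add_apply, h4, h3, h0, add_zero]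
  have hsq : ∀ n, ∫ ω, S n ω ^ 2 ∂μ ≤ C := fun n => by
    have hv := IndepFun.variance_sum (μ := μ) (X := Y) (s := Finset.range (n + 1))
      (fun i _ => h2 i) (fun i _ j _ hij => hY.indepFun hij)
    have e1 : variance (S n) μ = ∫ ω, S n ω ^ 2 ∂μ := by
      refine variance_of_integral_eq_zero
        (Finset.aemeasurable_sum _ fun i _ => (hm i).aemeasurable) ?_
      simp only [hS, Finset.sum_apply]
      rw [integral_finsetSum _ fun i _ => hi i]
      simp [h0]
    rw [← e1]
    refine (hv.trans (Finset.sum_congr rfl fun i _ => ?_)).trans_le (hC (n + 1))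
    exact variance_of_integral_eq_zero (hm i).aemeasurable (h0 i)
  -- Martingale convergence asks for boundedness in mean; it follows from the variance bound by |x|
  -- ≤ 1 + x².
  have hbdd : ∀ n, eLpNorm (S n) 1 μ ≤ ((1 + C).toNNReal : ENNReal) := fun n => by
    have hS2 : MemLp (S n) 2 μ := memLp_finsetSum' _ fun i _ => h2 i
    rw [eLpNorm_one_eq_lintegral_enorm, ← ofReal_integral_norm_eq_lintegral_enorm
      (hS2.integrable (by norm_num))]
    refine ENNReal.ofReal_le_ofReal ?_
    calc ∫ ω, ‖S n ω‖ ∂μ ≤ ∫ ω, (1 + S n ω ^ 2) ∂μ := by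
          refine integral_mono (hS2.integrable (by norm_num)).norm
            ((integrable_const _).add hS2.integrable_sq) fun ω => ?_
          show |S n ω| ≤ 1 + S n ω ^ 2
          nlinarith [sq_nonneg (|S n ω| - 1), sq_abs (S n ω), abs_nonneg (S n ω)]
      _ = 1 + ∫ ω, S n ω ^ 2 ∂μ := by
          rw [integral_add (integrable_const _) hS2.integrable_sq]; simp
      _ ≤ 1 + C := by linarith [hsq n]
  filter_upwards [hmart.submartingale.exists_ae_tendsto_of_bdd hbdd] with ω ⟨y, hy⟩
  refine ⟨y, (tendsto_add_atTop_iff_nat 1).1 ?_⟩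
  simpa [hS] using hy

/-- A two-sided series converges when both of its one-sided parts do. -/
lemma hasSum_conditional_of_tendsto {f : ℤ → ℝ} {y z : ℝ}
    (hy : Tendsto (fun n : ℕ => ∑ i ∈ Finset.range n, f i) atTop (𝓝 y))
    (hz : Tendsto (fun n : ℕ => ∑ i ∈ Finset.range n, f (-(i : ℤ) - 1)) atTop (𝓝 z)) :
    HasSum f (y + z) (SummationFilter.conditional ℤ) := by
  -- Nonnegative integers are listed as `i` and negative ones as `-i - 1`, so 0 is counted once.
  have hsum : ∀ a b : ℤ, a ≤ 0 → 0 ≤ b → ∑ i ∈ Finset.Icc a b, f i =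
      ∑ i ∈ Finset.range (b + 1).toNat, f i + ∑ i ∈ Finset.range (-a).toNat, f (-(i : ℤ) - 1) := by
    intro a b ha hb
    have e : Finset.Icc a b = (Finset.range (b + 1).toNat).image (fun i : ℕ => (i : ℤ)) ∪
        (Finset.range (-a).toNat).image (fun i : ℕ => -(i : ℤ) - 1) := by
      ext x
      simp only [Finset.mem_Icc, Finset.mem_union, Finset.mem_image, Finset.mem_range]
      constructor
      · intro hx
        rcases le_or_gt 0 x with h | h
        · exact Or.inl ⟨x.toNat, by omega, by omega⟩
        · exact Or.inr ⟨(-x - 1).toNat, by omega, by omega⟩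
      · rintro (⟨i, hi, rfl⟩ | ⟨i, hi, rfl⟩) <;> omega
    rw [e, Finset.sum_union, Finset.sum_image (fun _ _ _ _ h => by simpa using h),
      Finset.sum_image (fun _ _ _ _ h => by simpa using h)]
    rw [Finset.disjoint_left]
    simp only [Finset.mem_image, Finset.mem_range]
    rintro x ⟨i, _, rfl⟩ ⟨j, _, hj⟩
    omega
  rw [HasSum, SummationFilter.conditional_filter, tendsto_map'_iff]
  have hb : Tendsto (fun p : ℤ × ℤ => (p.2 + 1).toNat) (atBot ×ˢ atTop) atTop := by
    refine tendsto_atTop.2 fun n => ?_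
    filter_upwards [tendsto_snd.eventually (eventually_ge_atTop (n : ℤ))] with p hp
    omega
  have ha : Tendsto (fun p : ℤ × ℤ => (-p.1).toNat) (atBot ×ˢ atTop) atTop := by
    refine tendsto_atTop.2 fun n => ?_
    filter_upwards [tendsto_fst.eventually (eventually_le_atBot (-(n : ℤ)))] with p hp
    omega
  refine ((hy.comp hb).add (hz.comp ha)).congr' ?_
  filter_upwards [tendsto_fst.eventually (eventually_le_atBot 0),
    tendsto_snd.eventually (eventually_ge_atTop 0)] with p h1 h2
  exact (hsum p.1 p.2 h1 h2).symm

variable {R : Type*} [Fintype R] [DecidableEq R] {ξ : ℤ → Ω → (R → ℝ)} {V A : ℝ}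

lemma HasLightMoments.memLp_apply (h : HasLightMoments μ ξ V) (r : R) :
    MemLp (fun ω => ξ 1 ω r) 2 μ := by
  simpa [monomial] using h.memLp {r} (not_isHeavy_of_card_le_one (by simp))

lemma HasLightMoments.integral_apply_sq_le (h : HasLightMoments μ ξ V) (r : R) :
    ∫ ω, ξ 1 ω r ^ 2 ∂μ ≤ V := by
  simpa [monomial] using h.integral_sq_le {r} (not_isHeavy_of_card_le_one (by simp))

lemma HasLightMoments.ae_exists_tendsto (hl : HasLightMoments μ ξ V) (hξ : IsIID μ ξ) (r : R)
    {b : ℤ → ℝ} (hb : ∀ F : Finset ℤ, ∑ l ∈ F, b l ^ 2 ≤ A) {f : ℕ → ℤ}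
    (hf : Function.Injective f) :
    ∀ᵐ ω ∂μ, ∃ y, Tendsto (fun n => ∑ i ∈ Finset.range n, b (f i) * ξ (f i) ω r) atTop (𝓝 y) := by
  have hid : ∀ l, IdentDistrib (fun ω => ξ l ω r) (fun ω => ξ 1 ω r) μ μ := fun l =>
    (hξ.identDistrib l).comp (measurable_pi_apply r)
  refine ae_exists_tendsto_sum_range (C := A * V)
    (fun i => ((measurable_pi_apply r).comp (hξ.measurable _)).const_mul _) ?_
    (fun i => ((hid _).memLp_iff.2 (hl.memLp_apply r)).const_mul _) (fun i => ?_) fun n => ?_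
  · exact (hξ.indep.precomp hf).comp (fun i x => b (f i) * x r) fun i =>
      (measurable_pi_apply r).const_mul _
  · rw [integral_const_mul, (hid _).integral_eq, hl.mean_zero, mul_zero]
  · have e : ∀ i, ∫ ω, (b (f i) * ξ (f i) ω r) ^ 2 ∂μ = b (f i) ^ 2 * ∫ ω, ξ 1 ω r ^ 2 ∂μ := by
      intro i
      simp_rw [mul_pow]
      rw [integral_const_mul]
      congr 1
      exact ((hid (f i)).comp (u := fun x : ℝ => x ^ 2) (by fun_prop)).integral_eq
    simp_rw [e]
    rw [← Finset.sum_mul]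
    have h1 : ∑ i ∈ Finset.range n, b (f i) ^ 2 ≤ A := by
      have := hb ((Finset.range n).map ⟨f, hf⟩)
      simpa using this
    exact mul_le_mul h1 (hl.integral_apply_sq_le r) (integral_nonneg fun _ => sq_nonneg _)
      (by simpa using hb ∅)

/-- Almost sure convergence of a two-sided linear series. -/
theorem HasLightMoments.ae_summable (hl : HasLightMoments μ ξ V) (hξ : IsIID μ ξ) (r : R)
    {b : ℤ → ℝ} (hb : ∀ F : Finset ℤ, ∑ l ∈ F, b l ^ 2 ≤ A) :
    ∀ᵐ ω ∂μ, Summable (fun l : ℤ => b l * ξ l ω r) (SummationFilter.conditional ℤ) := by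
  filter_upwards [hl.ae_exists_tendsto hξ r hb (f := fun i : ℕ => (i : ℤ)) Nat.cast_injective,
    hl.ae_exists_tendsto hξ r hb (f := fun i : ℕ => -(i : ℤ) - 1) fun i j h => by simpa using h]
    with ω ⟨y, hy⟩ ⟨z, hz⟩
  exact ⟨_, hasSum_conditional_of_tendsto hy hz⟩

end RandomSeries

/-! ### Convergence in mean of the window approximations, and stationarity. -/

section MeanConvergence

variable {Ω R : Type*} [MeasurableSpace Ω] {μ : Measure Ω} [IsProbabilityMeasure μ]
  [Fintype R] [DecidableEq R] {ξ : ℤ → Ω → (R → ℝ)} {V q K A : ℝ}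

/-- The constant in the first moment bound for products of linear forms. -/
noncomputable def productConst (n : ℕ) (V K A : ℝ) : ℝ :=
  1 + (chaosConst n (V + (1 + K) ^ 2) A + chaosConst n (V + (1 + K) ^ 2) A) +
    heavyConst n V A * (2 * K)

/-- Dropping summation indices with small coefficients changes the product little in mean. -/
lemma integral_abs_finiteProduct_sub_le (hl : HasLightMoments μ ξ V)
    (hh : HasHeavyMoments μ ξ q K) (hξ : IsIID μ ξ) (hq1 : 1 < q) (hq2 : q ≤ 2) (hK : 0 ≤ K)
    (hA : 1 ≤ A) {F Λ : Finset ℤ} (hF : F ⊆ Λ) {a : R → ℤ → ℝ} (ha : ∀ r, ∑ l ∈ Λ, a r l ^ 2 ≤ A)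
    {η : ℝ} (hη : 0 < η) (hs : ∀ r, ∑ l ∈ Λ \ F, a r l ^ 2 ≤ η ^ 2 * A) :
    ∫ ω, |finiteProduct ξ Λ a ω - finiteProduct ξ F a ω| ∂μ ≤
      Fintype.card R * (η * productConst (Fintype.card R) V K A) := by
  -- The factors in `S` use the whole window `Λ`, the others only `F`; enlarging `S` by one index
  -- changes one factor at a time.
  set b : Finset R → R → ℤ → ℝ := fun S r l => if r ∈ S ∨ l ∈ F then a r l else 0 with hb
  have hbA : ∀ S r, ∑ l ∈ Λ, b S r l ^ 2 ≤ A := fun S r => by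
    refine (Finset.sum_le_sum fun l _ => ?_).trans (ha r)
    simp only [hb]
    split_ifs
    · exact le_rfl
    · simpa using sq_nonneg (a r l)
  have hbi : ∀ S, Integrable (finiteProduct ξ Λ (b S)) μ := fun S =>
    (integral_abs_finiteProduct_le hl hh hξ hq1 hq2 hK hA (hbA S)).1
  have key : ∀ S : Finset R, ∫ ω, |finiteProduct ξ Λ (b S) ω - finiteProduct ξ Λ (b ∅) ω| ∂μ ≤
      S.card * (η * productConst (Fintype.card R) V K A) := by
    intro S
    induction S using Finset.induction_on with
    | empty => simp
    | insert r S hr ih =>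
      -- The changed factor has coefficients only outside `F`. Divided by `η` they still have square
      -- sum at most `A`, so the uniform first moment bound applies and the increment gains the
      -- factor `η`.
      set d : R → ℤ → ℝ := fun r' l =>
        if r' = r then (if l ∈ F then 0 else a r l / η) else b S r' l with hd
      have hdA : ∀ r', ∑ l ∈ Λ, d r' l ^ 2 ≤ A := fun r' => by
        by_cases h : r' = r
        · subst h
          have e : ∑ l ∈ Λ, d r' l ^ 2 = (∑ l ∈ Λ \ F, a r' l ^ 2) / η ^ 2 := by
            rw [Finset.sum_div, Finset.sdiff_eq_filter, Finset.sum_filter]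
            refine Finset.sum_congr rfl fun l _ => ?_
            by_cases hlF : l ∈ F <;> simp [hd, hlF, div_pow]
          rw [e, div_le_iff₀ (by positivity), mul_comm]
          exact hs r'
        · simpa [hd, h] using hbA S r'
      obtain ⟨hdi, hdb⟩ := integral_abs_finiteProduct_le hl hh hξ hq1 hq2 hK hA hdA
      have hstep : ∀ ω, finiteProduct ξ Λ (b (insert r S)) ω - finiteProduct ξ Λ (b S) ω =
          η * finiteProduct ξ Λ d ω := fun ω => by
        unfold finiteProduct
        have h1 : ∏ r' ∈ Finset.univ.erase r, ∑ l ∈ Λ, b (insert r S) r' l * ξ l ω r' =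
            ∏ r' ∈ Finset.univ.erase r, ∑ l ∈ Λ, b S r' l * ξ l ω r' :=
          Finset.prod_congr rfl fun r' hr' => Finset.sum_congr rfl fun l _ => by
            simp [hb, Finset.ne_of_mem_erase hr']
        have h2 : ∏ r' ∈ Finset.univ.erase r, ∑ l ∈ Λ, d r' l * ξ l ω r' =
            ∏ r' ∈ Finset.univ.erase r, ∑ l ∈ Λ, b S r' l * ξ l ω r' :=
          Finset.prod_congr rfl fun r' hr' => Finset.sum_congr rfl fun l _ => by
            simp [hd, Finset.ne_of_mem_erase hr']
        rw [← Finset.mul_prod_erase _ _ (Finset.mem_univ r),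
          ← Finset.mul_prod_erase _ (fun r' => ∑ l ∈ Λ, b S r' l * ξ l ω r') (Finset.mem_univ r),
          ← Finset.mul_prod_erase _ (fun r' => ∑ l ∈ Λ, d r' l * ξ l ω r') (Finset.mem_univ r),
          h1, h2, ← sub_mul, ← mul_assoc, ← Finset.sum_sub_distrib, Finset.mul_sum]
        congr 1
        refine Finset.sum_congr rfl fun l _ => ?_
        by_cases hlF : l ∈ F <;> simp [hb, hd, hr, hlF]
        field_simp
      have e : ∫ ω, |finiteProduct ξ Λ (b (insert r S)) ω - finiteProduct ξ Λ (b S) ω| ∂μ ≤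
          η * productConst (Fintype.card R) V K A := by
        simp_rw [hstep, abs_mul, abs_of_pos hη]
        rw [integral_const_mul]
        exact mul_le_mul_of_nonneg_left hdb hη.le
      rw [Finset.card_insert_of_notMem hr]
      calc _ ≤ ∫ ω, (|finiteProduct ξ Λ (b (insert r S)) ω - finiteProduct ξ Λ (b S) ω| +
            |finiteProduct ξ Λ (b S) ω - finiteProduct ξ Λ (b ∅) ω|) ∂μ :=
            integral_mono ((hbi _).sub (hbi _)).abs
              (((hbi _).sub (hbi _)).abs.add ((hbi _).sub (hbi _)).abs)
              fun ω => abs_sub_le _ _ _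
        _ = _ := integral_add ((hbi _).sub (hbi _)).abs ((hbi _).sub (hbi _)).abs
        _ ≤ _ := by
            push_cast
            linarith
  have h1 : ∀ ω, finiteProduct ξ Λ (b Finset.univ) ω = finiteProduct ξ Λ a ω := fun ω => by
    simp [finiteProduct, hb]
  have h2 : ∀ ω, finiteProduct ξ Λ (b ∅) ω = finiteProduct ξ F a ω := fun ω => by
    unfold finiteProduct
    refine Finset.prod_congr rfl fun r _ => ?_
    rw [← Finset.sum_subset hF fun l _ hlF => by simp [hb, hlF]]
    exact Finset.sum_congr rfl fun l hlF => by simp [hb, hlF]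
  simpa [h1, h2] using key Finset.univ

/-- Along an exhausting sequence of windows the products converge in mean to their almost sure
limit. -/
theorem integrable_and_tendsto_integral (hl : HasLightMoments μ ξ V)
    (hh : HasHeavyMoments μ ξ q K) (hξ : IsIID μ ξ) (hq1 : 1 < q) (hq2 : q ≤ 2) (hK : 0 ≤ K)
    (hA : 1 ≤ A) {a : R → ℤ → ℝ} (ha : ∀ r (F : Finset ℤ), ∑ l ∈ F, a r l ^ 2 ≤ A)
    {F : ℕ → Finset ℤ} (hF : Monotone F) (hF' : Tendsto F atTop atTop) {d : Ω → ℝ}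
    (hd : ∀ᵐ ω ∂μ, Tendsto (fun m => finiteProduct ξ (F m) a ω) atTop (𝓝 (d ω))) :
    Integrable d μ ∧
      Tendsto (fun m => ∫ ω, finiteProduct ξ (F m) a ω ∂μ) atTop (𝓝 (∫ ω, d ω ∂μ)) := by
  have hi : ∀ m, Integrable (finiteProduct ξ (F m) a) μ := fun m =>
    (integral_abs_finiteProduct_le hl hh hξ hq1 hq2 hK hA fun r => ha r (F m)).1
  set D : ℝ := Fintype.card R * productConst (Fintype.card R) V K A with hD
  have hD0 : 0 ≤ D := by
    have := (integral_nonneg fun ω => abs_nonneg _).trans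
      (integral_abs_finiteProduct_le hl hh hξ hq1 hq2 hK hA fun r => ha r ∅).2
    exact mul_nonneg (Nat.cast_nonneg _) this
  have hcauchy : ∀ ε : ℝ, 0 < ε → ∃ m₀, ∀ m ≥ m₀, ∀ m' ≥ m,
      ∫ ω, |finiteProduct ξ (F m') a ω - finiteProduct ξ (F m) a ω| ∂μ ≤ ε := by
    intro ε hε
    obtain ⟨η, hη, hηε⟩ : ∃ η : ℝ, 0 < η ∧ η * D ≤ ε :=
      ⟨ε / (D + 1), by positivity, by
        rw [div_mul_eq_mul_div, div_le_iff₀ (by positivity)]; nlinarith⟩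
    have hsum : ∀ r, Summable fun l => a r l ^ 2 := fun r =>
      summable_of_sum_le (fun l => sq_nonneg _) (ha r)
    have h1 : ∀ r, ∃ s : Finset ℤ, ∀ t, Disjoint t s → ∑ l ∈ t, a r l ^ 2 ≤ η ^ 2 * A := fun r => by
      obtain ⟨s, hs⟩ := summable_iff_vanishing_norm.1 (hsum r) (η ^ 2 * A) (by positivity)
      exact ⟨s, fun t ht => (le_abs_self _).trans (hs t ht).le⟩
    choose s hs using h1
    obtain ⟨m₀, hm₀⟩ := (hF'.eventually (eventually_ge_atTop (Finset.univ.biUnion s))).exists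
    refine ⟨m₀, fun m hm m' hm' => ?_⟩
    have := integral_abs_finiteProduct_sub_le hl hh hξ hq1 hq2 hK hA (hF hm')
      (fun r => ha r (F m')) hη fun r => hs r _ (Finset.disjoint_left.2 fun l h1 h2 =>
        (Finset.mem_sdiff.1 h1).2 (hF hm (hm₀ (Finset.mem_biUnion.2 ⟨r, Finset.mem_univ r, h2⟩))))
    refine this.trans (le_trans (le_of_eq ?_) hηε)
    rw [hD]; ring
  have hdm : AEStronglyMeasurable d μ :=
    aestronglyMeasurable_of_tendsto_ae atTop (fun m => (hi m).aestronglyMeasurable) hd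
  -- Fatou's lemma identifies the almost sure limit `d` as the limit in mean of the Cauchy sequence.
  have hfatou : ∀ ε : ℝ, 0 < ε → ∃ m₀, ∀ m ≥ m₀,
      ∫⁻ ω, ‖d ω - finiteProduct ξ (F m) a ω‖ₑ ∂μ ≤ ENNReal.ofReal ε := by
    intro ε hε
    obtain ⟨m₀, hm₀⟩ := hcauchy ε hε
    refine ⟨m₀, fun m hm => ?_⟩
    have h1 : ∀ᵐ ω ∂μ, Tendsto (fun m' => finiteProduct ξ (F m') a ω - finiteProduct ξ (F m) a ω)
        atTop (𝓝 (d ω - finiteProduct ξ (F m) a ω)) := by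
      filter_upwards [hd] with ω hω
      exact hω.sub_const _
    have h2 := Lp.eLpNorm_lim_le_liminf_eLpNorm (p := 1)
      (fun m' => ((hi m').sub (hi m)).aestronglyMeasurable)
      (fun ω => d ω - finiteProduct ξ (F m) a ω) h1
    rw [eLpNorm_one_eq_lintegral_enorm] at h2
    refine h2.trans (liminf_le_of_frequently_le' (Eventually.frequently ?_))
    filter_upwards [eventually_ge_atTop m] with m' hm'
    rw [eLpNorm_one_eq_lintegral_enorm]
    have h3 := ofReal_integral_norm_eq_lintegral_enorm ((hi m').sub (hi m))
    rw [← h3]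
    exact ENNReal.ofReal_le_ofReal (hm₀ m hm m' hm')
  have hid : Integrable d μ := by
    obtain ⟨m, hm⟩ := hfatou 1 one_pos
    have h1 : Integrable (fun ω => d ω - finiteProduct ξ (F m) a ω) μ :=
      ⟨hdm.sub (hi m).aestronglyMeasurable, (hm m le_rfl).trans_lt ENNReal.ofReal_lt_top⟩
    exact (h1.add (hi m)).congr (Eventually.of_forall fun ω => sub_add_cancel _ _)
  refine ⟨hid, Metric.tendsto_atTop.2 fun ε hε => ?_⟩
  obtain ⟨m₀, hm₀⟩ := hfatou (ε / 2) (half_pos hε)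
  refine ⟨m₀, fun m hm => ?_⟩
  have h1 := hm₀ m hm
  have h2 := ofReal_integral_norm_eq_lintegral_enorm (hid.sub (hi m))
  simp only [Pi.sub_apply] at h2
  rw [← h2, ENNReal.ofReal_le_ofReal_iff (half_pos hε).le] at h1
  rw [dist_comm, Real.dist_eq, ← integral_sub hid (hi m)]
  exact (abs_integral_le_integral_abs.trans h1).trans_lt (half_lt_self hε)

/-- Expectations of finite products are invariant under translation. -/
lemma integral_finiteProduct_translate (hξ : IsIID μ ξ) (F : Finset ℤ) (a : R → ℤ → ℝ) (k : ℤ) :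
    ∫ ω, finiteProduct ξ (F.map (Equiv.addRight k).toEmbedding) (fun r l => a r (l - k)) ω ∂μ =
      ∫ ω, finiteProduct ξ F a ω ∂μ := by
  -- Every shift of the innovations has the same product law.
  have hlaw : ∀ k : ℤ, Measure.map (fun ω l => ξ (l + k) ω) μ =
      Measure.infinitePi fun _ : ℤ => Measure.map (ξ 1) μ := fun k => by
    rw [(iIndepFun_iff_map_fun_eq_infinitePi_map fun l => hξ.measurable _).1
      (hξ.indep.precomp (g := fun l : ℤ => l + k) (add_left_injective k))]
    congr 1
    ext1 l
    exact (hξ.identDistrib _).map_eq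
  set G : (ℤ → R → ℝ) → ℝ := fun x => ∏ r, ∑ l ∈ F, a r l * x l r with hG
  have hGm : Measurable G := by
    refine Finset.measurable_fun_prod _ fun r _ => Finset.measurable_fun_sum _ fun l _ => ?_
    exact ((measurable_pi_apply r).comp (measurable_pi_apply (X := fun _ : ℤ => R → ℝ) l)).const_mul _
  have hint : ∀ k : ℤ, ∫ ω, G (fun l => ξ (l + k) ω) ∂μ =
      ∫ x, G x ∂(Measure.infinitePi fun _ : ℤ => Measure.map (ξ 1) μ) := fun k => by
    rw [← hlaw k, integral_map (measurable_pi_lambda _ fun l => hξ.measurable _).aemeasurable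
      hGm.aestronglyMeasurable]
  have h1 : ∀ ω, finiteProduct ξ (F.map (Equiv.addRight k).toEmbedding)
      (fun r l => a r (l - k)) ω = G (fun l => ξ (l + k) ω) := fun ω => by
    simp [finiteProduct, hG]
  have h2 : ∀ ω, finiteProduct ξ F a ω = G (fun l => ξ (l + 0) ω) := fun ω => by
    simp [finiteProduct, hG]
  simp_rw [h1, h2, hint]

end MeanConvergence

/-! ### From dyadic maxima to almost sure convergence. -/

section DyadicBorelCantelli

/-- Control of the maxima over dyadic blocks gives control of the normalized sums. -/
lemma tendsto_of_dyadic {x : ℕ → ℝ} {p : ℝ} (hp : 0 < p)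
    (h : ∀ j : ℕ, ∀ᶠ N : ℕ in atTop, ∀ n ≤ 2 ^ N, |∑ k ∈ Finset.range n, x k| <
      1 / ((j : ℝ) + 1) * ((2 : ℝ) ^ N) ^ (1 / p)) :
    Tendsto (fun n : ℕ => (n : ℝ) ^ (-(1 / p)) * ∑ k ∈ Finset.Icc 1 n, x k) atTop (𝓝 0) := by
  refine Metric.tendsto_atTop'.2 fun ε hε => ?_
  obtain ⟨j, hj⟩ := exists_nat_one_div_lt (K := ℝ) (ε := ε / (2 * 4 ^ (1 / p))) (by positivity)
  obtain ⟨N₀, hN₀⟩ := eventually_atTop.1 (h j)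
  refine ⟨2 ^ N₀, fun n hn => ?_⟩
  have hn1 : 1 ≤ n := (Nat.one_le_two_pow).trans hn.le
  -- The partial sums start at index 0, so summation up to `n` has `n + 1` terms, and the block `2 ^
  -- N` has to contain them all.
  set N := Nat.clog 2 (n + 1) with hN
  have h1 : n + 1 ≤ 2 ^ N := Nat.le_pow_clog one_lt_two _
  have h2 : 2 ^ N ≤ 4 * n := by
    have h3 : 2 ^ N.pred < n + 1 := Nat.pow_pred_clog_lt_self one_lt_two (by omega)
    have h4 : 0 < N := Nat.clog_pos one_lt_two (by omega)
    obtain ⟨N', hN'⟩ : ∃ N', N = N' + 1 := ⟨N - 1, by omega⟩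
    rw [hN', Nat.pred_succ] at h3
    rw [hN', pow_succ]
    omega
  have hNN : N₀ ≤ N := by
    have : 2 ^ N₀ < 2 ^ N := hn.trans_le (by omega)
    exact ((Nat.pow_lt_pow_iff_right one_lt_two).1 this).le
  have h5 := hN₀ N hNN (n + 1) h1
  have h6 := hN₀ N hNN 1 (by omega)
  -- The term at 0 is removed as a partial sum of length one, covered by the same dyadic bound; this
  -- is the source of the factor 2 in the choice of `j`.
  have e : ∑ k ∈ Finset.Icc 1 n, x k =
      ∑ k ∈ Finset.range (n + 1), x k - ∑ k ∈ Finset.range 1, x k := by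
    rw [← Finset.sum_Ico_eq_sub _ (by omega : 1 ≤ n + 1)]
    rfl
  have hn0 : (0 : ℝ) < n := by exact_mod_cast hn1
  have h7 : ((2 : ℝ) ^ N) ^ (1 / p) ≤ 4 ^ (1 / p) * (n : ℝ) ^ (1 / p) := by
    rw [← Real.mul_rpow (by norm_num) hn0.le]
    exact Real.rpow_le_rpow (by positivity) (by exact_mod_cast h2) (by positivity)
  have h8 : |∑ k ∈ Finset.Icc 1 n, x k| <
      ε / (2 * 4 ^ (1 / p)) * (2 * (4 ^ (1 / p) * (n : ℝ) ^ (1 / p))) := by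
    rw [e]
    refine (abs_sub _ _).trans_lt ?_
    have hpos : (0 : ℝ) < ((2 : ℝ) ^ N) ^ (1 / p) := by positivity
    calc _ < 1 / ((j : ℝ) + 1) * (2 * ((2 : ℝ) ^ N) ^ (1 / p)) := by linarith
      _ ≤ ε / (2 * 4 ^ (1 / p)) * (2 * (4 ^ (1 / p) * (n : ℝ) ^ (1 / p))) := by gcongr
  rw [Real.dist_eq, sub_zero, abs_mul, abs_of_pos (Real.rpow_pos_of_pos hn0 _),
    Real.rpow_neg hn0.le, inv_mul_lt_iff₀ (Real.rpow_pos_of_pos hn0 _)]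
  refine h8.trans_eq ?_
  field_simp

variable {Ω : Type*} [MeasurableSpace Ω] {μ : Measure Ω} [IsProbabilityMeasure μ]

/-- A probability bound for maxima passes to almost sure limits. -/
lemma measureReal_max_le_of_tendsto {S : ℕ → ℕ → Ω → ℝ} {T : ℕ → Ω → ℝ}
    (h : ∀ n, ∀ᵐ ω ∂μ, Tendsto (fun m => S m n ω) atTop (𝓝 (T n ω))) {M : ℕ} {t t' δ : ℝ}
    (htt : t < t') (hδ : ∀ m, μ.real {ω | ∃ n ≤ M, t ≤ |S m n ω|} ≤ δ) :
    μ.real {ω | ∃ n ≤ M, t' ≤ |T n ω|} ≤ δ := by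
  set E : ℕ → Set Ω := fun m => {ω | ∃ n ≤ M, t ≤ |S m n ω|} with hE
  have hδ0 : 0 ≤ δ := measureReal_nonneg.trans (hδ 0)
  -- The strict inequality `t < t'` makes the approximants exceed `t` eventually, so the limit event
  -- lies in the lower limit of the `E m`, whose probability is at most `δ`.
  have hsub : {ω | ∃ n ≤ M, t' ≤ |T n ω|} ≤ᵐ[μ] ⋃ m, ⋂ i, E (m + i) := by
    filter_upwards [ae_all_iff.2 h] with ω hω
    rintro ⟨n, hn, hnt⟩
    have h1 := ((hω n).abs).eventually (eventually_gt_nhds (htt.trans_le hnt))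
    obtain ⟨m₀, hm₀⟩ := eventually_atTop.1 h1
    exact Set.mem_iUnion.2 ⟨m₀, Set.mem_iInter.2 fun i => ⟨n, hn, (hm₀ _ (by omega)).le⟩⟩
  have hmono : Monotone fun m => ⋂ i, E (m + i) := by
    refine monotone_nat_of_le_succ fun m ω hω => Set.mem_iInter.2 fun i => ?_
    have := Set.mem_iInter.1 hω (i + 1)
    rwa [show m + (i + 1) = m + 1 + i by ring] at this
  have hle : μ {ω | ∃ n ≤ M, t' ≤ |T n ω|} ≤ ENNReal.ofReal δ := by
    refine (measure_mono_ae hsub).trans ?_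
    rw [hmono.measure_iUnion]
    refine iSup_le fun m => (measure_mono (Set.iInter_subset _ 0)).trans ?_
    rw [← ofReal_measureReal]
    exact ENNReal.ofReal_le_ofReal (hδ _)
  exact ENNReal.toReal_le_of_le_ofReal hδ0 hle

/-- A strong law from summable probability bounds over dyadic blocks that are uniform along an
approximating sequence. -/
theorem ae_tendsto_of_dyadic_bound {X : ℕ → ℕ → Ω → ℝ} {Y : ℕ → Ω → ℝ} {p : ℝ} (hp : 0 < p)
    (hX : ∀ k, ∀ᵐ ω ∂μ, Tendsto (fun m => X m k ω) atTop (𝓝 (Y k ω)))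
    (hb : ∀ t : ℝ, 0 < t → ∃ b : ℕ → ℝ, Summable b ∧ ∀ N m,
      μ.real {ω | ∃ n ≤ 2 ^ N, t * ((2 : ℝ) ^ N) ^ (1 / p) ≤
        |∑ k ∈ Finset.range n, X m k ω|} ≤ b N) :
    ∀ᵐ ω ∂μ, Tendsto (fun n : ℕ => (n : ℝ) ^ (-(1 / p)) * ∑ k ∈ Finset.Icc 1 n, Y k ω)
      atTop (𝓝 0) := by
  have hS : ∀ n, ∀ᵐ ω ∂μ, Tendsto (fun m => ∑ k ∈ Finset.range n, X m k ω) atTop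
      (𝓝 (∑ k ∈ Finset.range n, Y k ω)) := fun n => by
    filter_upwards [ae_all_iff.2 hX] with ω hω
    exact tendsto_finsetSum _ fun k _ => hω k
  have hj : ∀ j : ℕ, ∀ᵐ ω ∂μ, ∀ᶠ N : ℕ in atTop, ∀ n ≤ 2 ^ N, |∑ k ∈ Finset.range n, Y k ω| <
      1 / ((j : ℝ) + 1) * ((2 : ℝ) ^ N) ^ (1 / p) := by
    intro j
    have hpos : (0 : ℝ) < 1 / ((j : ℝ) + 1) := by positivity
    -- Half the level leaves the gap needed to pass to the limit over windows.
    obtain ⟨b, hbs, hb⟩ := hb _ (half_pos hpos)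
    have hbound : ∀ N, μ.real {ω | ∃ n ≤ 2 ^ N, 1 / ((j : ℝ) + 1) * ((2 : ℝ) ^ N) ^ (1 / p) ≤
        |∑ k ∈ Finset.range n, Y k ω|} ≤ b N := fun N => by
      exact measureReal_max_le_of_tendsto hS
        (mul_lt_mul_of_pos_right (half_lt_self hpos) (by positivity)) (hb N)
    have hfin : ∑' N, μ {ω | ∃ n ≤ 2 ^ N, 1 / ((j : ℝ) + 1) * ((2 : ℝ) ^ N) ^ (1 / p) ≤
        |∑ k ∈ Finset.range n, Y k ω|} ≠ ⊤ := by
      refine ne_top_of_le_ne_top hbs.tsum_ofReal_ne_top (ENNReal.tsum_le_tsum fun N => ?_)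
      rw [← ofReal_measureReal]
      exact ENNReal.ofReal_le_ofReal (hbound N)
    filter_upwards [ae_eventually_notMem hfin] with ω hω
    filter_upwards [hω] with N hN n hn
    by_contra hcon
    exact hN ⟨n, hn, not_lt.1 hcon⟩
  filter_upwards [ae_all_iff.2 hj] with ω hω
  exact tendsto_of_dyadic hp hω

/-- Polynomial factors do not affect the summability of dyadic powers. -/
lemma summable_dyadic {e : ℝ} (he : e < 0) (C : ℝ) :
    Summable fun N : ℕ => C * ((N + 1) ^ 2 * ((2 : ℝ) ^ N) ^ e) := by
  have h1 : ∀ N : ℕ, ((2 : ℝ) ^ N) ^ e = ((2 : ℝ) ^ e) ^ N := fun N => by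
    rw [← Real.rpow_natCast, ← Real.rpow_natCast, ← Real.rpow_mul two_pos.le,
      ← Real.rpow_mul two_pos.le, mul_comm]
  have hr : ‖(2 : ℝ) ^ e‖ < 1 := by
    rw [Real.norm_of_nonneg (by positivity)]
    exact Real.rpow_lt_one_of_one_lt_of_neg one_lt_two he
  have h2 := (summable_pow_mul_geometric_of_norm_lt_one 2 hr).add
    (((summable_pow_mul_geometric_of_norm_lt_one 1 hr).mul_left 2).add
      (summable_pow_mul_geometric_of_norm_lt_one 0 hr))
  refine (h2.congr fun N => ?_).mul_left C
  rw [h1]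
  ring

end DyadicBorelCantelli

/-! ### The strong law from a covariance bound. -/

section ProductProcess

variable {Ω : Type*} [MeasurableSpace Ω] {μ : Measure Ω} [IsProbabilityMeasure μ]
  {s : ℕ} {ξ : ℤ → Ω → (Fin s → ℝ)} {V q K A : ℝ} {c : Fin s → ℤ → ℝ}

lemma tendsto_Icc_prod_conditional :
    Tendsto (fun p : ℤ × ℤ => Finset.Icc p.1 p.2) (atBot ×ˢ atTop)
      (SummationFilter.conditional ℤ).filter := by
  rw [SummationFilter.conditional_filter]
  exact tendsto_map

lemma tendsto_Icc_conditional {u v : ℕ → ℤ} (hu : Tendsto u atTop atBot)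
    (hv : Tendsto v atTop atTop) :
    Tendsto (fun m => Finset.Icc (u m) (v m)) atTop (SummationFilter.conditional ℤ).filter := by
  have h1 : Tendsto (fun m => (u m, v m)) atTop (atBot ×ˢ atTop) := hu.prodMk hv
  intro S hS
  exact h1 (tendsto_Icc_prod_conditional hS)

lemma tendsto_Icc_atTop {u v : ℕ → ℤ} (hu : Tendsto u atTop atBot) (hv : Tendsto v atTop atTop) :
    Tendsto (fun m => Finset.Icc (u m) (v m)) atTop atTop :=
  (tendsto_Icc_conditional hu hv).mono_right (SummationFilter.conditional ℤ).le_atTop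

lemma ae_tendsto_finiteProduct (hl : HasLightMoments μ ξ V) (hξ : IsIID μ ξ)
    (hc : SquareBounded c A) (k : ℤ) {u v : ℕ → ℤ} (hu : Tendsto u atTop atBot)
    (hv : Tendsto v atTop atTop) :
    ∀ᵐ ω ∂μ, Tendsto (fun m => finiteProduct ξ (Finset.Icc (u m) (v m)) (coeffAt c k) ω) atTop
      (𝓝 (productProcess c ξ k ω)) := by
  have h : ∀ r, ∀ᵐ ω ∂μ,
      Summable (fun l : ℤ => coeffAt c k r l * ξ l ω r) (SummationFilter.conditional ℤ) := fun r =>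
    hl.ae_summable hξ r fun F => hc.coeffAt F k r
  filter_upwards [ae_all_iff.2 h] with ω hω
  refine tendsto_finsetProd _ fun r _ => ?_
  have h1 : Tendsto (fun F : Finset ℤ => ∑ l ∈ F, coeffAt c k r l * ξ l ω r)
    (SummationFilter.conditional ℤ).filter (𝓝 (linearProcess c ξ r k ω)) := (hω r).hasSum
  exact h1.comp (tendsto_Icc_conditional hu hv)

lemma tendsto_window_left (k : ℤ) : Tendsto (fun m : ℕ => -(m : ℤ) + k) atTop atBot :=
  tendsto_atBot_add_const_right _ _ (tendsto_neg_atTop_atBot.comp tendsto_natCast_atTop_atTop)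

lemma tendsto_window_right (k : ℤ) : Tendsto (fun m : ℕ => (m : ℤ) + k) atTop atTop :=
  tendsto_atTop_add_const_right _ _ tendsto_natCast_atTop_atTop

lemma monotone_window (k : ℤ) : Monotone fun m : ℕ => Finset.Icc (-(m : ℤ) + k) (m + k) :=
  fun _ _ h => Finset.Icc_subset_Icc (by lia) (by lia)

/-- Integrability of the product process and convergence of the means along any translate of the
symmetric windows. -/
lemma integrable_productProcess_and_tendsto (hl : HasLightMoments μ ξ V)
    (hh : HasHeavyMoments μ ξ q K) (hξ : IsIID μ ξ) (hq1 : 1 < q) (hq2 : q ≤ 2) (hK : 0 ≤ K)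
    (hA : 1 ≤ A) (hc : SquareBounded c A) (j k : ℤ) :
    Integrable (productProcess c ξ k) μ ∧
      Tendsto (fun m : ℕ => ∫ ω, finiteProduct ξ (Finset.Icc (-(m : ℤ) + j) (m + j))
        (coeffAt c k) ω ∂μ) atTop (𝓝 (∫ ω, productProcess c ξ k ω ∂μ)) :=
  integrable_and_tendsto_integral hl hh hξ hq1 hq2 hK hA (fun r F => hc.coeffAt F k r)
    (monotone_window j) (tendsto_Icc_atTop (tendsto_window_left j) (tendsto_window_right j))
    (ae_tendsto_finiteProduct hl hξ hc k (tendsto_window_left j) (tendsto_window_right j))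

/-- For time `k` use the symmetric windows shifted by `k`: the finite products then have exactly the
same means as at time 0, and the limit of the means does not depend on the choice of windows. -/
lemma integral_productProcess_eq (hl : HasLightMoments μ ξ V)
    (hh : HasHeavyMoments μ ξ q K) (hξ : IsIID μ ξ) (hq1 : 1 < q) (hq2 : q ≤ 2) (hK : 0 ≤ K)
    (hA : 1 ≤ A) (hc : SquareBounded c A) (k : ℤ) :
    ∫ ω, productProcess c ξ k ω ∂μ = ∫ ω, productProcess c ξ 0 ω ∂μ := by
  refine tendsto_nhds_unique
    (integrable_productProcess_and_tendsto hl hh hξ hq1 hq2 hK hA hc k k).2 ?_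
  refine (integrable_productProcess_and_tendsto hl hh hξ hq1 hq2 hK hA hc 0 0).2.congr fun m => ?_
  rw [← integral_finiteProduct_translate hξ _ (coeffAt c 0) k]
  have e1 : (Finset.Icc (-(m : ℤ) + 0) (m + 0)).map (Equiv.addRight k).toEmbedding =
      Finset.Icc (-(m : ℤ) + k) (m + k) := by
    ext x
    simp
  have e2 : (fun r l => coeffAt c 0 r (l - k)) = coeffAt c k := by
    funext r l
    simp [coeffAt]
  rw [e1, e2]

/-- The strong law for the product process, given a bound for the covariances of its light part. -/
theorem strongLaw_of_sum_lightCov_le (hl : HasLightMoments μ ξ V)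
    (hh : HasHeavyMoments μ ξ q K) (hξ : IsIID μ ξ) (hq1 : 1 < q) (hq2 : q ≤ 2) (hK : 0 ≤ K)
    (hA : 1 ≤ A) (hc : SquareBounded c A) {p : ℝ} (hp : 0 < p) (hpq : p < q) {C e : ℝ}
    (he : e < 2 / p)
    (hC : ∀ (Λ : Finset ℤ) (M : ℕ), 1 ≤ M → ∑ k ∈ Finset.range M, ∑ k' ∈ Finset.range M,
      lightCov μ ξ Λ (coeffAt c k) (coeffAt c k') ≤ C * (M : ℝ) ^ e) :
    StrongLaw μ (productProcess c ξ) p := by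
  have hmean := integral_productProcess_eq hl hh hξ hq1 hq2 hK hA hc
  -- The approximants are centred by their own means, as the maximal inequality requires; these
  -- converge to E d_k = E d_1.
  refine ae_tendsto_of_dyadic_bound
    (X := fun m k ω => finiteProduct ξ (Finset.Icc (-(m : ℤ) + 0) (m + 0)) (coeffAt c k) ω -
      ∫ ω', finiteProduct ξ (Finset.Icc (-(m : ℤ) + 0) (m + 0)) (coeffAt c k) ω' ∂μ)
    (Y := fun k ω => productProcess c ξ k ω - ∫ ω', productProcess c ξ 1 ω' ∂μ) hp
    (fun k => ?_) fun t ht => ?_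
  · filter_upwards [ae_tendsto_finiteProduct hl hξ hc k (tendsto_window_left 0)
      (tendsto_window_right 0)] with ω hω
    rw [hmean 1, ← hmean k]
    exact hω.sub (integrable_productProcess_and_tendsto hl hh hξ hq1 hq2 hK hA hc 0 k).2
  have hq0 : 0 < q := by linarith
  have hinv : 1 / q < 1 / p := one_div_lt_one_div_of_lt hp hpq
  set G := chaosConst (Fintype.card (Fin s)) (V + (1 + K) ^ 2) A *
    centredConst (Fintype.card (Fin s)) A with hG
  set H := 4 * heavyConst (Fintype.card (Fin s)) V A * K with hH
  have hH0 : 0 ≤ H := by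
    have := heavyConst_nonneg (Fintype.card (Fin s)) (zero_le_one.trans hl.one_le)
      (zero_le_one.trans hA)
    positivity
  -- One series for each of the light, low and high parts; the exponents are negative because `e < 2
  -- / p` and `p < q`. The factors 9 and 3 come from the level `t / 3`.
  refine ⟨_, ((summable_dyadic (e := e - 2 / p) (by linarith) (C * 9 / t ^ 2)).add
    (summable_dyadic (e := 2 / q - 2 / p) (by
      have e1 : 2 / q = 2 * (1 / q) := by ring
      have e2 : 2 / p = 2 * (1 / p) := by ring
      linarith) (G * 9 / t ^ 2))).add
    (summable_dyadic (e := 1 / q - 1 / p) (by linarith) (H * 3 / t)), fun N m => ?_⟩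
  have hx : (0 : ℝ) < 2 ^ N := by positivity
  have hxp : (0 : ℝ) < ((2 : ℝ) ^ N) ^ (1 / p) := Real.rpow_pos_of_pos hx _
  have hmax := measureReal_max_finiteProduct_le hl hh hξ hq1 hq2 hK hA hc
    (Finset.Icc (-(m : ℤ) + 0) (m + 0)) N (t := t / 3 * ((2 : ℝ) ^ N) ^ (1 / p)) (by positivity)
  have e3 : 3 * (t / 3 * ((2 : ℝ) ^ N) ^ (1 / p)) = t * ((2 : ℝ) ^ N) ^ (1 / p) := by ring
  rw [e3] at hmax
  rw [← hG, ← hH] at hmax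
  refine hmax.trans ?_
  have hsq : (((2 : ℝ) ^ N) ^ (1 / p)) ^ 2 = ((2 : ℝ) ^ N) ^ (2 / p) := by
    rw [← Real.rpow_natCast, ← Real.rpow_mul hx.le]
    congr 1
    push_cast
    ring
  have hCN := hC (Finset.Icc (-(m : ℤ) + 0) (m + 0)) (2 ^ N) Nat.one_le_two_pow
  push_cast at hCN
  refine add_le_add (add_le_add ?_ ?_) ?_
  · rw [Real.rpow_sub hx, ← hsq]
    calc _ ≤ ((N : ℝ) + 1) ^ 2 * (C * ((2 : ℝ) ^ N) ^ e) / (t / 3 * ((2 : ℝ) ^ N) ^ (1 / p)) ^ 2 := by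
          gcongr
      _ = _ := by field_simp; norm_num
  · rw [Real.rpow_sub hx, ← hsq]
    exact le_of_eq (by field_simp; norm_num)
  · rw [Real.rpow_sub hx]
    calc _ = H * 3 / t * (1 * (((2 : ℝ) ^ N) ^ (1 / q) / ((2 : ℝ) ^ N) ^ (1 / p))) := by
          field_simp
      _ ≤ _ := by
          gcongr
          -- The high part has no logarithmic factor; a spare `(N + 1) ^ 2` is inserted to fit
          -- `summable_dyadic`.
          exact one_le_pow₀ (by linarith [Nat.cast_nonneg (α := ℝ) N])

end ProductProcess

/-! ### Moments and decay from the hypotheses. -/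

section Moments

variable {Ω : Type*} [MeasurableSpace Ω] {μ : Measure Ω} [IsProbabilityMeasure μ]

/-- A polynomial tail bound gives the moments of smaller order. -/
lemma integrable_rpow_of_tail {X : Ω → ℝ} (hX : Measurable X) (hX0 : ∀ ω, 0 ≤ X ω) {q α C : ℝ}
    (hq : 1 ≤ q) (hα : q < α) (hC : ∀ t : ℝ, 1 ≤ t → t ^ α * μ.real {ω | t < X ω} ≤ C) :
    Integrable (fun ω => X ω ^ q) μ := by
  have hq0 : 0 < q := by linarith
  refine ⟨(hX.pow_const q).aestronglyMeasurable, ?_⟩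
  have e : ∫⁻ ω, ‖X ω ^ q‖ₑ ∂μ = ∫⁻ ω, ENNReal.ofReal (X ω ^ q) ∂μ :=
    lintegral_congr fun ω => Real.enorm_eq_ofReal (Real.rpow_nonneg (hX0 ω) q)
  rw [HasFiniteIntegral, e, lintegral_rpow_eq_lintegral_meas_lt_mul μ
    (Eventually.of_forall hX0) hX.aemeasurable hq0]
  refine ENNReal.mul_lt_top ENNReal.ofReal_lt_top ?_
  -- The tail bound is available only from 1 on; below 1 the integrand is at most 1.
  rw [← Set.Ioc_union_Ioi_eq_Ioi (zero_le_one (α := ℝ))]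
  refine (lintegral_union_le _ _ _).trans_lt (ENNReal.add_lt_top.2 ⟨?_, ?_⟩)
  · calc _ ≤ ∫⁻ _ in Set.Ioc (0 : ℝ) 1, 1 := by
          refine setLIntegral_mono measurable_const fun t ht => ?_
          refine mul_le_one' prob_le_one (ENNReal.ofReal_le_one.2 ?_)
          exact Real.rpow_le_one ht.1.le ht.2 (by linarith)
      _ < ⊤ := by simp
  · have hint : IntegrableOn (fun t : ℝ => C * t ^ (q - 1 - α)) (Set.Ioi 1) :=
      (integrableOn_Ioi_rpow_of_lt (by linarith) one_pos).const_mul C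
    refine lt_of_le_of_lt ?_ hint.setLIntegral_lt_top
    refine setLIntegral_mono (by fun_prop) fun t ht => ?_
    have ht0 : (0 : ℝ) < t := one_pos.trans ht
    rw [← ofReal_measureReal, ← ENNReal.ofReal_mul measureReal_nonneg]
    refine ENNReal.ofReal_le_ofReal ?_
    have h1 := hC t (le_of_lt ht)
    have h2 : μ.real {ω | t < X ω} ≤ C * t ^ (-α) := by
      rw [Real.rpow_neg ht0.le, ← div_eq_mul_inv, le_div_iff₀ (Real.rpow_pos_of_pos ht0 _), mul_comm]
      exact h1
    calc _ ≤ C * t ^ (-α) * t ^ (q - 1) := by gcongr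
      _ = _ := by
        rw [mul_assoc, ← Real.rpow_add ht0]
        congr 2
        ring

variable {s : ℕ} {ξ : ℤ → Ω → (Fin s → ℝ)}

lemma IsInnovation.isIID (h : IsInnovation μ ξ) : IsIID μ ξ :=
  ⟨h.measurable, h.indep, h.identDistrib⟩

/-- A light block has `2 * B.card ≤ max s 2`, so the squared product is at most that power of the
largest coordinate, or 1. -/
lemma monomial_sq_le (hs : 1 ≤ s) {B : Finset (Fin s)} (hB : ¬ IsHeavy B) (x : Fin s → ℝ) :
    monomial id B x ^ 2 ≤ 1 + ∑ r, |x r| ^ (max s 2) := by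
  have : Nonempty (Fin s) := ⟨⟨0, hs⟩⟩
  obtain ⟨r₀, hr₀⟩ := Finite.exists_max fun r => |x r|
  have hB' : B.card * 2 ≤ max s 2 := by
    rw [IsHeavy, Fintype.card_fin] at hB
    omega
  have h1 : |monomial id B x| ≤ max 1 |x r₀| ^ B.card := by
    unfold monomial
    rw [Finset.abs_prod]
    rw [← Finset.prod_const]
    exact Finset.prod_le_prod (fun r _ => abs_nonneg _)
      fun r _ => (hr₀ r).trans (le_max_right _ _)
  calc monomial id B x ^ 2 = |monomial id B x| ^ 2 := (sq_abs _).symm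
    _ ≤ (max 1 |x r₀| ^ B.card) ^ 2 := by gcongr
    _ = max 1 |x r₀| ^ (B.card * 2) := (pow_mul _ _ _).symm
    _ ≤ max 1 |x r₀| ^ (max s 2) := pow_le_pow_right₀ (le_max_left _ _) hB'
    _ ≤ 1 + |x r₀| ^ (max s 2) := by
        have := pow_nonneg (abs_nonneg (x r₀)) (max s 2)
        rcases max_cases 1 |x r₀| with ⟨h, _⟩ | ⟨h, _⟩ <;> rw [h]
        · simp
        · linarith
    _ ≤ _ := by
        have := Finset.single_le_sum (f := fun r => |x r| ^ (max s 2))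
          (fun r _ => by positivity) (Finset.mem_univ r₀)
        linarith

lemma Reg.exists_hasLightMoments (hs : 1 ≤ s) (hξ : IsInnovation μ ξ) (hReg : Reg μ ξ) :
    ∃ V, HasLightMoments μ ξ V := by
  have hsum : Integrable (fun ω => 1 + ∑ r, |ξ 1 ω r| ^ (max s 2)) μ :=
    (integrable_const _).add (integrable_finsetSum _ fun r _ => hReg r)
  have hsq : ∀ B : Finset (Fin s), ¬ IsHeavy B →
      Integrable (fun ω => monomial id B (ξ 1 ω) ^ 2) μ := fun B hB =>
    hsum.mono' ((((measurable_monomial id B).comp (hξ.measurable 1)).pow_const 2).aestronglyMeasurable)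
      (Eventually.of_forall fun ω => by
        rw [Real.norm_of_nonneg (sq_nonneg _)]
        exact monomial_sq_le hs hB _)
  refine ⟨∫ ω, (1 + ∑ r, |ξ 1 ω r| ^ (max s 2)) ∂μ, ?_, fun B hB => ?_, fun B hB => ?_,
    hξ.mean_zero⟩
  · have : ∫ _, (1 : ℝ) ∂μ ≤ ∫ ω, (1 + ∑ r, |ξ 1 ω r| ^ (max s 2)) ∂μ :=
      integral_mono (integrable_const _) hsum fun ω =>
        le_add_of_nonneg_right (Finset.sum_nonneg fun r _ => by positivity)
    simpa using this
  · exact (memLp_two_iff_integrable_sq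
      ((measurable_monomial id B).comp (hξ.measurable 1)).aestronglyMeasurable).2 (hsq B hB)
  · exact integral_mono (hsq B hB) hsum fun ω => monomial_sq_le hs hB _

/-- `Tail` speaks of images of initial segments under permutations; every block has this form. -/
lemma exists_perm_image (B : Finset (Fin s)) :
    ∃ π : Equiv.Perm (Fin s), ∀ j : Fin s, j.val < B.card ↔ π j ∈ B := by
  have hcard : B.card ≤ s := by simpa using B.card_le_univ
  have e : Fintype.card {j : Fin s // j.val < B.card} = Fintype.card {r : Fin s // r ∈ B} := by
    rw [Fintype.card_coe, Fintype.card_subtype, Fin.card_filter_val_lt, min_eq_right hcard]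
  refine ⟨(Fintype.equivOfCardEq e).extendSubtype, fun j => ⟨fun hj => ?_, fun hj => ?_⟩⟩
  · exact (Fintype.equivOfCardEq e).extendSubtype_mem j hj
  · by_contra hn
    exact (Fintype.equivOfCardEq e).extendSubtype_not_mem j hn hj

lemma exists_hasHeavyMoments {q : ℝ} (h : ∀ B : Finset (Fin s), IsHeavy B →
    Integrable (fun ω => |monomial id B (ξ 1 ω)| ^ q) μ) :
    ∃ K, 0 ≤ K ∧ HasHeavyMoments μ ξ q K := by
  have h0 : ∀ B : Finset (Fin s), 0 ≤ ∫ ω, |monomial id B (ξ 1 ω)| ^ q ∂μ := fun B =>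
    integral_nonneg fun ω => by positivity
  refine ⟨∑ B, ∫ ω, |monomial id B (ξ 1 ω)| ^ q ∂μ, Finset.sum_nonneg fun B _ => h0 B, h,
    fun B _ => ?_⟩
  exact Finset.single_le_sum (f := fun B => ∫ ω, |monomial id B (ξ 1 ω)| ^ q ∂μ)
    (fun B _ => h0 B) (Finset.mem_univ B)

/-- Heavy blocks are those of size s - i with i ≤ (s-1)/2 and, when s = 1, none at all, so `Tail`
covers each of them. The exponents α_i are at least α₀, and moments below α₀ suffice. -/
lemma Tail.exists_hasHeavyMoments {α₀ q : ℝ} (hξ : IsInnovation μ ξ) (hT : Tail μ ξ α₀)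
    (hq1 : 1 ≤ q) (hq : q < α₀) : ∃ K, 0 ≤ K ∧ HasHeavyMoments μ ξ q K := by
  refine ProductMSLLN.exists_hasHeavyMoments fun B hB => ?_
  have hB' : max s 2 < 2 * B.card := by simpa [IsHeavy] using hB
  have hcard : B.card ≤ s := by simpa using B.card_le_univ
  obtain ⟨π, hπ⟩ := exists_perm_image B
  obtain ⟨C, hC⟩ := hT π (s - B.card) (by omega)
  have hprod : ∀ ω, ∏ j : Fin s with j.val < s - (s - B.card), |ξ 1 ω (π j)| =
      |monomial id B (ξ 1 ω)| := fun ω => by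
    rw [Nat.sub_sub_self hcard, monomial, Finset.abs_prod]
    exact Finset.prod_equiv π (by simpa using hπ) fun j _ => rfl
  have hα : α₀ ≤ tailExponent s α₀ (s - B.card) := by
    have hs0 : (0 : ℝ) < B.card := by
      have : 0 < B.card := by omega
      exact_mod_cast this
    have hα0 : 0 ≤ α₀ := by linarith
    unfold tailExponent
    refine le_mul_of_one_le_left hα0 ?_
    rw [Nat.cast_sub hcard, sub_sub_cancel, one_le_div hs0]
    exact_mod_cast hcard
  refine integrable_rpow_of_tail (X := fun ω => |monomial id B (ξ 1 ω)|) (C := C)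
    ((measurable_monomial id B).comp (hξ.measurable 1)).norm (fun ω => abs_nonneg _) hq1
    (hq.trans_le hα) fun t ht => ?_
  have := hC (Set.mem_image_of_mem _ (Set.mem_Ici.2 ht))
  simpa only [hprod] using this

lemma Decay.exists_powerBounded {c : Fin s → ℤ → ℝ} {σ : Fin s → ℝ} (h : Decay c σ) :
    ∃ κ, PowerBounded c κ σ := by
  choose C hC using h
  refine ⟨∑ r, (|C r| + |c r 0|), fun r j => ?_⟩
  have h1 : |C r| + |c r 0| ≤ ∑ r, (|C r| + |c r 0|) :=
    Finset.single_le_sum (f := fun r => |C r| + |c r 0|) (fun r _ => by positivity)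
      (Finset.mem_univ r)
  -- At `j = 0` the decay hypothesis need not control the coefficient, so `|c r 0|` was added to the
  -- constant.
  by_cases hj : j = 0
  · subst hj
    simp only [bracket, Int.cast_zero, abs_zero, zero_le_one, sup_of_le_left, Real.one_rpow, mul_one]
    linarith [abs_nonneg (C r)]
  · have hj1 : (1 : ℝ) ≤ |(j : ℝ)| := by exact_mod_cast Int.one_le_abs hj
    have hb : bracket j = |(j : ℝ)| := max_eq_right hj1
    have h2 : |(j : ℝ)| ^ σ r * |c r j| ≤ C r := hC r ⟨j, rfl⟩
    rw [hb, Real.rpow_neg (abs_nonneg _), ← div_eq_mul_inv,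
      le_div_iff₀ (Real.rpow_pos_of_pos (by linarith) _), mul_comm]
    linarith [le_abs_self (C r), abs_nonneg (c r 0)]

end Moments

/-! ### Choice of exponents in the two regimes. -/

section StrongLaws

variable {Ω : Type*} [MeasurableSpace Ω] {μ : Measure Ω} [IsProbabilityMeasure μ]
  {s : ℕ} {ξ : ℤ → Ω → (Fin s → ℝ)} {c : Fin s → ℤ → ℝ} {V q K κ p : ℝ} {σ : Fin s → ℝ}

/-- The strong law when covariances are bounded by a single pairing. -/
theorem strongLaw_of_pair (hs : 1 ≤ s) (hl : HasLightMoments μ ξ V)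
    (hh : HasHeavyMoments μ ξ q K) (hξ : IsIID μ ξ) (hq1 : 1 < q) (hq2 : q ≤ 2) (hK : 0 ≤ K)
    (hc : PowerBounded c κ σ) (hσ : ∀ r, σ r ∈ Set.Ioc (1 / 2 : ℝ) 1) (hp : 0 < p) (hpq : p < q)
    (hpσ : ∀ r, p < 2 / (3 - 2 * σ r)) : StrongLaw μ (productProcess c ξ) p := by
  have : Nonempty (Fin s) := ⟨⟨0, hs⟩⟩
  obtain ⟨r₀, hr₀⟩ := Finite.exists_min σ
  obtain ⟨hσ0, hσ1⟩ := hσ r₀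
  obtain ⟨A, hA, hcA⟩ := PowerBounded.exists_squareBounded (fun r => (hσ r).1) κ
  have hgap : 3 - 2 * σ r₀ < 2 / p := by
    have := hpσ r₀
    rwa [lt_div_iff₀ (by linarith), mul_comm, ← lt_div_iff₀ hp] at this
  -- The first bound keeps the decay exponent nonnegative; the second keeps `3 - 2 * σ r₀ + 2 * ε`
  -- below `2 / p`.
  obtain ⟨ε, hε, hε1, hε2⟩ : ∃ ε : ℝ, 0 < ε ∧ ε ≤ 2 * σ r₀ - 1 ∧ 4 * ε ≤ 2 / p - (3 - 2 * σ r₀) :=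
    ⟨min (2 * σ r₀ - 1) ((2 / p - (3 - 2 * σ r₀)) / 4),
      lt_min (by linarith) (by linarith), min_le_left _ _,
      by linarith [min_le_right (2 * σ r₀ - 1) ((2 / p - (3 - 2 * σ r₀)) / 4)]⟩
  exact strongLaw_of_sum_lightCov_le hl hh hξ hq1 hq2 hK hA (hcA c hc) hp hpq (by linarith)
    fun Λ M hM => sum_lightCov_le_of_pair hξ (isBlockFamily_lightFamily hl hh hξ hq1.le)
      (blockMean_singleton_of_light hl fun B hB => lightFamily_of_light hB) hA (hcA c hc) hc
      (fun r => (hσ r).2) hε hr₀ hσ1 (by linarith) Λ hM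

/-- The strong law when odd moments vanish, so that covariances are bounded by two pairings. -/
theorem strongLaw_of_two_pairs (hs : 2 ≤ s) (hs2 : Even s) (hl : HasLightMoments μ ξ V)
    (hh : HasHeavyMoments μ ξ q K) (hξ : IsIID μ ξ) (hq1 : 1 < q) (hq2 : q ≤ 2) (hK : 0 ≤ K)
    (hodd : ∀ B : Finset (Fin s), Odd B.card → ∫ ω, monomial id B (ξ 1 ω) ∂μ = 0)
    (hc : PowerBounded c κ σ) (hσ : ∀ r, σ r ∈ Set.Ioc (1 / 2 : ℝ) 1) (hp : 0 < p) (hpq : p < q)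
    (hp2 : p < 2) (hpσ : ∀ i j, i < j → p * (2 - (σ i + σ j)) < 1) :
    StrongLaw μ (productProcess c ξ) p := by
  have : Nonempty (Fin s) := ⟨⟨0, by omega⟩⟩
  have : Nonempty {x : Fin s × Fin s // x.1 < x.2} :=
    ⟨⟨(⟨0, by omega⟩, ⟨1, by omega⟩), by simp [Fin.lt_def]⟩⟩
  obtain ⟨r₀, hr₀⟩ := Finite.exists_min σ
  obtain ⟨⟨⟨i, j⟩, hij⟩, hmin⟩ :=
    Finite.exists_min fun x : {x : Fin s × Fin s // x.1 < x.2} => σ x.1.1 + σ x.1.2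
  dsimp only at hij hmin
  set τ := σ i + σ j with hτ
  have hτmin : ∀ i j, i ≠ j → τ ≤ σ i + σ j := fun i j h => by
    rcases lt_or_gt_of_ne h with h | h
    · exact hmin ⟨(i, j), h⟩
    · rw [add_comm]
      exact hmin ⟨(j, i), h⟩
  obtain ⟨A, hA, hcA⟩ := PowerBounded.exists_squareBounded (fun r => (hσ r).1) κ
  have hg1 : 1 < 2 / p := (one_lt_div hp).2 hp2
  have hg2 : 2 * (2 - τ) < 2 / p := by
    rw [lt_div_iff₀ hp]
    linarith [hpσ i j hij]
  have hσ0 := (hσ r₀).1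
  -- With `β` the minimum of 1 and `2 * τ - 2 - 2 * ε`, the growth exponent is `1 + ε` or `2 * (2 -
  -- τ) + 3 * ε`; the last two bounds keep these below `2 / p`.
  obtain ⟨ε, hε, hε1, hε2, hε3⟩ : ∃ ε : ℝ, 0 < ε ∧ ε ≤ 2 * σ r₀ - 1 ∧ 2 * ε ≤ 2 / p - 1 ∧
      4 * ε ≤ 2 / p - 2 * (2 - τ) := by
    refine ⟨min (2 * σ r₀ - 1) (min ((2 / p - 1) / 2) ((2 / p - 2 * (2 - τ)) / 4)),
      lt_min (by linarith) (lt_min (by linarith) (by linarith)), min_le_left _ _, ?_, ?_⟩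
    · have := (min_le_right (2 * σ r₀ - 1) (min ((2 / p - 1) / 2) ((2 / p - 2 * (2 - τ)) / 4))).trans
        (min_le_left _ _)
      linarith
    · have := (min_le_right (2 * σ r₀ - 1) (min ((2 / p - 1) / 2) ((2 / p - 2 * (2 - τ)) / 4))).trans
        (min_le_right _ _)
      linarith
  have hexp : 2 + ε - min 1 (2 * τ - 2 - 2 * ε) < 2 / p := by
    rcases min_cases 1 (2 * τ - 2 - 2 * ε) with ⟨h, _⟩ | ⟨h, _⟩ <;> rw [h] <;> linarith
  exact strongLaw_of_sum_lightCov_le hl hh hξ hq1 hq2 hK hA (hcA c hc) hp hpq hexp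
    fun Λ M hM => sum_lightCov_le_of_two_pairs hξ (isBlockFamily_lightFamily hl hh hξ hq1.le)
      (fun B hB => by rw [blockMean_lightFamily]; exact hodd B hB) (by simpa using hs2) hA
      (hcA c hc) hc (fun r => (hσ r).2) hε (fun r r' => by linarith [hr₀ r, hr₀ r']) hτmin
      (min_le_left _ _) (min_le_right _ _) Λ hM

/-- Odd moments of identical symmetric components vanish. -/
lemma integral_monomial_eq_zero_of_symmetric
    (heq : ∀ r r', (fun ω => ξ 1 ω r) =ᵐ[μ] (fun ω => ξ 1 ω r'))
    (hsymm : ∀ r, IdentDistrib (fun ω => ξ 1 ω r) (fun ω => -ξ 1 ω r) μ μ)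
    {B : Finset (Fin s)} (hB : Odd B.card) : ∫ ω, monomial id B (ξ 1 ω) ∂μ = 0 := by
  obtain ⟨r₀, -⟩ := Finset.card_pos.1 hB.pos
  have h1 : (fun ω => monomial id B (ξ 1 ω)) =ᵐ[μ] fun ω => ξ 1 ω r₀ ^ B.card := by
    filter_upwards [ae_all_iff.2 fun r => heq r r₀] with ω hω
    simp [monomial, hω]
  rw [integral_congr_ae h1]
  have h2 := ((hsymm r₀).comp (u := fun x : ℝ => x ^ B.card) (by fun_prop)).integral_eq
  simp only [Function.comp_def, hB.neg_pow] at h2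
  rw [integral_neg] at h2
  linarith

/-- The order `q` lies strictly between max(p, 1) and min(2, α). -/
lemma exists_exponent {p α : ℝ} (hp2 : p < 2) (hpα : p < α) (hα : 1 < α) :
    ∃ q, 1 < q ∧ q ≤ 2 ∧ p < q ∧ q < α := by
  obtain ⟨q, h1, h2⟩ := exists_between (max_lt (lt_min hp2 hpα) (lt_min one_lt_two hα))
  exact ⟨q, (le_max_right _ _).trans_lt h1, (h2.trans_le (min_le_left _ _)).le,
    (le_max_left _ _).trans_lt h1, h2.trans_le (min_le_right _ _)⟩

end StrongLaws

end ProductMSLLN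

/-! ### The main theorem. -/

theorem mainTheorem1 {Ω : Type*} [MeasurableSpace Ω] (μ : Measure Ω) [IsProbabilityMeasure μ]
    (s : ℕ) (hs : 1 ≤ s) (ξ : ℤ → Ω → (Fin s → ℝ)) (c : Fin s → ℤ → ℝ)
    (α₀ : ℝ) (hα₀ : 1 < α₀) (σ : Fin s → ℝ) (hσ : ∀ r, σ r ∈ Set.Ioc (1 / 2 : ℝ) 1)
    (hξ : ProductMSLLN.IsInnovation μ ξ) (hReg : ProductMSLLN.Reg μ ξ)
    (hTail : ProductMSLLN.Tail μ ξ α₀) (hDecay : ProductMSLLN.Decay c σ) :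
    (∀ r k, ∀ᵐ ω ∂μ,
      Summable (fun l : ℤ => c r (k - l) * ξ l ω r) (SummationFilter.conditional ℤ)) ∧
    Integrable (ProductMSLLN.productProcess c ξ 1) μ ∧
    (∀ p : ℝ, ProductMSLLN.InRange α₀ σ p →
      ProductMSLLN.StrongLaw μ (ProductMSLLN.productProcess c ξ) p) ∧
    ((∀ r r', (fun ω => ξ 1 ω r) =ᵐ[μ] (fun ω => ξ 1 ω r')) →
      (∀ r, IdentDistrib (fun ω => ξ 1 ω r) (fun ω => -ξ 1 ω r) μ μ) →
      Even s →
      ∀ p : ℝ, ProductMSLLN.InRelaxedRange α₀ σ p →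
        ProductMSLLN.StrongLaw μ (ProductMSLLN.productProcess c ξ) p) := by
  open ProductMSLLN in
  obtain ⟨V, hl⟩ := hReg.exists_hasLightMoments hs hξ
  obtain ⟨κ, hc⟩ := hDecay.exists_powerBounded
  obtain ⟨A, hA, hcA⟩ := PowerBounded.exists_squareBounded (fun r => (hσ r).1) κ
  refine ⟨fun r k => hl.ae_summable hξ.isIID r fun F => (hcA c hc).coeffAt F k r, ?_,
    fun p hpR => ?_, fun heq hsymm hs2 p hpR => ?_⟩
  · obtain ⟨q, hq1, hq2, -, hqα⟩ := exists_exponent zero_lt_two (zero_lt_one.trans hα₀) hα₀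
    obtain ⟨K, hK, hh⟩ := hTail.exists_hasHeavyMoments hξ hq1.le hqα
    exact (integrable_productProcess_and_tendsto hl hh hξ.isIID hq1 hq2 hK hA (hcA c hc) 0 1).1
  · obtain ⟨hp, h1, h2, h3⟩ := hpR
    have hlt : (∀ r, p < 2 / (3 - 2 * σ r)) → p < 2 := fun h => by
      have h4 := h ⟨0, hs⟩
      have h5 := (hσ ⟨0, hs⟩).2
      refine h4.trans_le ((div_le_iff₀ (by linarith)).2 (by linarith))
    rcases lt_trichotomy s 2 with hs2 | hs2 | hs2
    · have hs1 : s = 1 := by omega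
      obtain ⟨q, hq1, hq2, hpq, -⟩ := exists_exponent (hlt (h1 hs1)) (hlt (h1 hs1)) one_lt_two
      -- For `s = 1` no block is heavy, so the moment condition is void and `α₀` does not restrict
      -- `p`.
      obtain ⟨K, hK, hh⟩ := exists_hasHeavyMoments (μ := μ) (ξ := ξ) (q := q) fun B hB => by
        have hB2 := hB.two_le
        have hcard : B.card ≤ s := by simpa using B.card_le_univ
        omega
      exact strongLaw_of_pair hs hl hh hξ.isIID hq1 hq2 hK hc hσ hp hpq (h1 hs1)
    · obtain ⟨hp2, hpα, hpσ⟩ := h2 hs2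
      obtain ⟨q, hq1, hq2, hpq, hqα⟩ := exists_exponent hp2 hpα hα₀
      obtain ⟨K, hK, hh⟩ := hTail.exists_hasHeavyMoments hξ hq1.le hqα
      -- For `s = 2` the odd blocks are singletons, which have mean zero without any symmetry.
      refine strongLaw_of_two_pairs hs2.ge (hs2 ▸ even_two) hl hh hξ.isIID hq1 hq2 hK
        (fun B hB => ?_) hc hσ hp hpq hp2 hpσ
      have hcard : B.card ≤ s := by simpa using B.card_le_univ
      obtain ⟨m, hm⟩ := hB
      obtain ⟨r, rfl⟩ := Finset.card_eq_one.1 (by omega : B.card = 1)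
      simpa [monomial] using hl.mean_zero r
    · obtain ⟨hpα, hpσ⟩ := h3 hs2
      obtain ⟨q, hq1, hq2, hpq, hqα⟩ := exists_exponent (hlt hpσ) hpα hα₀
      obtain ⟨K, hK, hh⟩ := hTail.exists_hasHeavyMoments hξ hq1.le hqα
      exact strongLaw_of_pair hs hl hh hξ.isIID hq1 hq2 hK hc hσ hp hpq hpσ
  · obtain ⟨hp, hp2, hpα, hpσ⟩ := hpR
    obtain ⟨q, hq1, hq2, hpq, hqα⟩ := exists_exponent hp2 hpα hα₀
    obtain ⟨K, hK, hh⟩ := hTail.exists_hasHeavyMoments hξ hq1.le hqα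
    have hs2' : 2 ≤ s := by
      obtain ⟨m, hm⟩ := hs2
      omega
    exact strongLaw_of_two_pairs hs2' hs2 hl hh hξ.isIID hq1 hq2 hK
      (fun B hB => integral_monomial_eq_zero_of_symmetric heq hsymm hB) hc hσ hp hpq hp2 hpσ
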